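/- Let $M$ be a compact manifold of class $\mathcal C^\infty$ and real dimension $2n-k$, with a smooth CR structure $H_{0,1}M\subset T_{\mathbb C}M$ of CR dimension $n-k$ (a subbundle of complex rank $n-k$, closed under brackets, with $H_{0,1}M\cap H_{1,0}M=0$, where $H_{1,0}M=\overline{H_{0,1}M}$); put $HM=H_{1,0}M\oplus H_{0,1}M$. Smooth $(p,r)$-forms are the sections of $\Lambda^p(T_{\mathbb C}M/H_{0,1}M)^*\otimes\Lambda^r(H_{0,1}M)^*$, $\bar\partial_b$ is the tangential Cauchy–Riemann operator on them, and $H^{p,r}(M)$ is the corresponding smooth cohomology. Let $(\mathcal B^l(M))_{l\in\mathbb N}$ be a sequence of anisotropic Banach spaces: Banach spaces of integrable functions on $M$, continuously included in $L^1(M)$, with $\mathcal B^{l+1}(M)\subset\mathcal B^l(M)$, such that $Xf\in\mathcal B^{l}(M)$ (weak derivative) for $f\in\mathcal B^{l+1}(M)$ and every smooth section $X$ of $HM$, and such that $fg\in\mathcal B^l(M)$ for $f\in\mathcal B^l(M)$ and $g\in\mathcal C^{\theta(l)}(M)$, where $\theta:\mathbb N\to\mathbb N$ is nondecreasing. Let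 $\mathcal B^l_{p,r}(M)$ be the space of $(p,r)$-forms with coefficients in $\mathcal B^l(M)$. The spaces are called adapted in degree $r\ge1$ if for every $p$ with $H^{p,r}(M)=0$ there are linear operators $A_s:\mathcal B^0_{p,s}(M)\to\mathcal B^0_{p,s-1}(M)$, $s=r,r+1$, that are continuous from $\mathcal B^l_{p,s}(M)$ to $\mathcal B^{l+1}_{p,s-1}(M)$ for every $l\in\mathbb N$ and satisfy $f=\bar\partial_bA_rf+A_{r+1}\bar\partial_bf$ for every $f\in\mathcal B^l_{p,r}(M)$, $l\ge1$. Assume $\bigcap_l\mathcal B^l(M)=\mathcal C^\infty(M)$. Let $q$ be an integer with $1\le q\le(n-k)/2$ and let $s_1(q),s_2(q)$ be natural numbers. Then there are $\delta_l>0$, $l\in\mathbb N$, such that the following holds for every smooth form $\Phi\in\mathcal C^\infty_{0,1}(M,H_{1,0}M)$ for which the horizontal perturbation $\widehat H_{0,1}M=\{\bar Z-\Phi(\bar Z)\mid\bar Z\in H_{0,1}M\}$ is a CR structure and which satisfies $\|\Phi\|_{\mathcal C^{\theta(l)}}<\delta_l$ for all $l$. Write $\widehat M=(M,\widehat H_{0,1}M)$,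 let $\bar\partial_b^\Phi$ be its tangential Cauchy–Riemann operator, and let $H^{p,r}_\Phi(\widehat M)$ be the quotient of the smooth $\bar\partial_b^\Phi$-closed $(p,r)$-forms of $\widehat M$ by the image under $\bar\partial_b^\Phi$ of its smooth $(p,r-1)$-forms. (i) Suppose that the spaces are adapted in every degree $r$ with $1\le r\le s_1(q)$. If $1\le r\le s_1(q)$ and $H^{p,r-p}(M)=0$ for all $0\le p\le r-1$, then $H^{0,r}_\Phi(\widehat M)=0$. (ii) Suppose that the spaces are adapted in every degree $r\ge1$ with $s_2(q)\le r\le n-k$. If $r\ge1$, $s_2(q)\le r\le n-k$ and $H^{n-p,r+p}(M)=0$ for all $0\le p\le n-k-r$, then $H^{n,r}_\Phi(\widehat M)=0$. -/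

import Mathlib

open MeasureTheory
open scoped Manifold ContDiff

noncomputable section

namespace CR

/-! ### Smooth complex functions and complex vector fields -/

/-- Multiplication of complex numbers is smooth over the reals. -/
instance instContMDiffRingComplex : ContMDiffRing 𝓘(ℝ, ℂ) ∞ ℂ :=
  { instNormedSpaceLieAddGroup with
    contMDiff_mul := by
      rw [contMDiff_iff]
      refine ⟨continuous_mul, fun x y => ?_⟩
      simp only [mfld_simps, chartAt_self_eq]
      rw [contDiffOn_univ]
      exact contDiff_mul }

/-- `C^∞(M)`: smooth complex-valued functions on an `m`-dimensional real manifold. -/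
abbrev Smooth (m : ℕ) (M : Type*) [TopologicalSpace M]
    [ChartedSpace (EuclideanSpace ℝ (Fin m)) M] : Type _ :=
  C^∞⟮𝓡 m, M; 𝓘(ℝ, ℂ), ℂ⟯

/-- Smooth sections of the complexified tangent bundle, as derivations of `C^∞(M)`.
(An `ℝ`-linear derivation kills the constant `i`, hence is `ℂ`-linear.) The bracket of
derivations is the Lie bracket of vector fields. -/
abbrev VF (m : ℕ) (M : Type*) [TopologicalSpace M]
    [ChartedSpace (EuclideanSpace ℝ (Fin m)) M] : Type _ :=
  Derivation ℝ (Smooth m M) (Smooth m M)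

section Basic

variable {m : ℕ} {M : Type*} [TopologicalSpace M] [ChartedSpace (EuclideanSpace ℝ (Fin m)) M]

/-- Complex conjugation of functions. -/
def conjFn (a : Smooth m M) : Smooth m M :=
  ⟨fun x => (starRingEnd ℂ) (a x), Complex.conjCLE.contDiff.contMDiff.comp a.contMDiff⟩

@[simp]
theorem conjFn_apply (a : Smooth m M) (x : M) : conjFn a x = (starRingEnd ℂ) (a x) := rfl

/-- Complex conjugation of vector fields, `X̄ a = conj (X (conj a))`. -/
def conjVF (X : VF m M) : VF m M :=
  Derivation.mk'
    { toFun := fun a => conjFn (X (conjFn a))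
      map_add' := fun a b => by
        have h : conjFn (a + b) = conjFn a + conjFn b := by ext x; simp
        rw [h, map_add]; ext x; simp
      map_smul' := fun c a => by
        have h : conjFn (c • a) = c • conjFn a := by ext x; simp
        rw [h, X.map_smul]; ext x; simp }
    (fun a b => by
      have h : conjFn (a * b) = conjFn a * conjFn b := by ext x; simp
      change conjFn (X (conjFn (a * b))) = _
      rw [h, Derivation.leibniz]; ext x; simp)

@[simp]
theorem conjVF_apply (X : VF m M) (a : Smooth m M) : conjVF X a = conjFn (X (conjFn a)) := rfl

/-- The conjugate `{X | X̄ ∈ S}` of a module of vector fields. -/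
def conjSub (S : Submodule (Smooth m M) (VF m M)) : Submodule (Smooth m M) (VF m M) where
  carrier := {X | conjVF X ∈ S}
  add_mem' := fun {X Y} hX hY => by
    have h : conjVF (X + Y) = conjVF X + conjVF Y := by ext a x; simp
    simpa only [Set.mem_ofPred_eq, h] using S.add_mem hX hY
  zero_mem' := by
    have h : conjVF (0 : VF m M) = 0 := by ext a x; simp
    simp only [Set.mem_ofPred_eq, h, S.zero_mem]
  smul_mem' := fun c X hX => by
    have h : conjVF (c • X) = conjFn c • conjVF X := by ext a x; simp
    simpa only [Set.mem_ofPred_eq, h] using S.smul_mem (conjFn c) hX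

/-- The fibre at `x` of a module `S` of vector fields: the complex space of tangent vectors
`a ↦ (X a)(x)`, `X ∈ S`. -/
def fiber (S : Submodule (Smooth m M) (VF m M)) (x : M) : Submodule ℂ (Smooth m M → ℂ) :=
  Submodule.span ℂ (Set.range fun (X : S) (a : Smooth m M) => (X : VF m M) a x)

end Basic

/-! ### CR structures and their `(p,r)`-forms -/

/-- A smooth CR structure of CR dimension `d` on `M`, given by the module `H` of the smooth
sections of `H_{0,1}M`. Submodules of vector fields that have a complement are the same as smooth
subbundles, so the first two conditions say that `H_{0,1}` and its conjugate `H_{1,0}` are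
subbundles that meet only in zero at every point. -/
structure CRStructure (m : ℕ) (M : Type*) [TopologicalSpace M]
    [ChartedSpace (EuclideanSpace ℝ (Fin m)) M] (d : ℕ) where
  /-- sections of `H_{0,1}M` -/
  H : Submodule (Smooth m M) (VF m M)
  disjoint_conj : Disjoint H (conjSub H)
  exists_isCompl : ∃ K : Submodule (Smooth m M) (VF m M), IsCompl (H ⊔ conjSub H) K
  rank_eq : ∀ x : M, Module.finrank ℂ (fiber H x) = d
  lie_mem : ∀ Z ∈ H, ∀ W ∈ H, ⁅Z, W⁆ ∈ H

section Forms

variable {m : ℕ} {M : Type*} [TopologicalSpace M] [ChartedSpace (EuclideanSpace ℝ (Fin m)) M]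
  {d : ℕ}

/-- The bracket of two sections of `H_{0,1}M`. -/
def CRStructure.br (S : CRStructure m M d) (Z W : S.H) : S.H :=
  ⟨⁅(Z : VF m M), (W : VF m M)⁆, S.lie_mem Z Z.2 W W.2⟩

/-- `(p,r)`-forms with coefficients in the `C^∞(M)`-module `N`: sections of
`Λ^p (T_ℂM / H_{0,1}M)^* ⊗ Λ^r (H_{0,1}M)^*` with coefficients in `N`, as alternating maps. -/
abbrev Form (S : CRStructure m M d) (p r : ℕ) (N : Type*) [AddCommGroup N]
    [Module (Smooth m M) N] : Type _ :=
  S.H [⋀^Fin r]→ₗ[Smooth m M] ((VF m M ⧸ S.H) [⋀^Fin p]→ₗ[Smooth m M] N)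

/-- The value `f(Z_1,…,Z_r; X_1,…,X_p)` with `Z_i` in `H_{0,1}M` and with arbitrary vector fields
`X_j`, taken modulo `H_{0,1}M`. -/
def Form.ev {S : CRStructure m M d} {p r : ℕ} {N : Type*} [AddCommGroup N]
    [Module (Smooth m M) N] (f : Form S p r N) (Z : Fin r → S.H) (X : Fin p → VF m M) : N :=
  f Z (fun j => S.H.mkQ (X j))

/-- The value `(∂̄_b f)(Z_0,…,Z_r; X_1,…,X_p)` of the tangential Cauchy-Riemann operator, where
`act` is the action of vector fields on coefficients. This is the invariant formula for the
exterior derivative along `H_{0,1}M`; the bracket `[Z_i, Z_j]`, `i < j`, stands in the place of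
`Z_j`, which absorbs the usual sign `(-1)^(i+j)`. -/
def dbar {S : CRStructure m M d} {p r : ℕ} {N : Type*} [AddCommGroup N]
    [Module (Smooth m M) N] (act : VF m M → N → N) (f : Form S p r N)
    (Z : Fin (r + 1) → S.H) (X : Fin p → VF m M) : N :=
  ∑ i : Fin (r + 1), (-1 : ℤ) ^ (i : ℕ) •
    (act (Z i) (f.ev (i.removeNth Z) X)
      - (∑ j : Fin r, if i ≤ j.castSucc then
          f.ev (Function.update (i.removeNth Z) j (S.br (Z i) (i.removeNth Z j))) X else 0)
      - ∑ j : Fin p, f.ev (i.removeNth Z) (Function.update X j ⁅(Z i : VF m M), X j⁆))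

/-- A smooth `(p,r)`-form with `∂̄_b f = 0`. -/
def IsClosedForm {S : CRStructure m M d} {p r : ℕ} (f : Form S p r (Smooth m M)) : Prop :=
  ∀ Z X, dbar (fun Y a => Y a) f Z X = 0

/-- `H^{p,r}(M) = 0` for the smooth tangential Cauchy-Riemann cohomology of the CR structure. -/
def CohomologyVanishes (S : CRStructure m M d) (p : ℕ) : ℕ → Prop
  | 0 => ∀ f : Form S p 0 (Smooth m M), IsClosedForm f → f = 0
  | r + 1 => ∀ f : Form S p (r + 1) (Smooth m M), IsClosedForm f →
      ∃ u : Form S p r (Smooth m M), ∀ Z X, dbar (fun Y a => Y a) u Z X = f.ev Z X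

/-- The graph `{Z - Φ(Z) | Z ∈ H_{0,1}M}` of a smooth form `Φ : H_{0,1}M → H_{1,0}M`. -/
def graph (S : CRStructure m M d) (Φ : S.H →ₗ[Smooth m M] conjSub S.H) :
    Submodule (Smooth m M) (VF m M) :=
  LinearMap.range (S.H.subtype - (conjSub S.H).subtype ∘ₗ Φ)

/-! ### Norms -/

/-- Finite families used to write norms: `X` generates all vector fields, with coefficients
given by the 1-forms `ξ`, and `Z` generates the sections of `H_{0,1}M`. -/
structure Frames (S : CRStructure m M d) where
  N₁ : ℕ
  N₂ : ℕ
  X : Fin N₁ → VF m M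
  ξ : Fin N₁ → VF m M →ₗ[Smooth m M] Smooth m M
  sum_eq : ∀ Y, ∑ i, ξ i Y • X i = Y
  Z : Fin N₂ → S.H
  span_eq : Submodule.span (Smooth m M) (Set.range Z) = ⊤

/-- The `C^l` norm of a smooth function, through derivatives of order `≤ l` along `X`. -/
def cNorm {N : ℕ} (X : Fin N → VF m M) : ℕ → Smooth m M → ℝ
  | 0, a => ⨆ x : M, ‖a x‖
  | l + 1, a => (⨆ x : M, ‖a x‖) + ∑ i, cNorm X l (X i a)

/-- The `C^l` norm of `Φ`, i.e. of its coefficients. -/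
def Frames.normΦ {S : CRStructure m M d} (F : Frames S) (l : ℕ)
    (Φ : S.H →ₗ[Smooth m M] conjSub S.H) : ℝ :=
  ∑ i, ∑ j, cNorm F.X l (F.ξ i (Φ (F.Z j)))

end Forms

/-! ### Function spaces -/

section Spaces

variable {m : ℕ} {M : Type*} [TopologicalSpace M] [ChartedSpace (EuclideanSpace ℝ (Fin m)) M]
  [MeasurableSpace M] [BorelSpace M] {μ : Measure M}

/-- A smooth function as an almost everywhere class. -/
def toAE (μ : Measure M) (a : Smooth m M) : M →ₘ[μ] ℂ :=
  AEEqFun.mk a a.contMDiff.continuous.aestronglyMeasurable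

/-- Multiplication of measurable functions by smooth functions. -/
instance instModuleSmooth : Module (Smooth m M) (M →ₘ[μ] ℂ) where
  smul a f := toAE μ a * f
  one_smul f := AEEqFun.induction_on f fun f hf => by
    change toAE μ 1 * _ = _
    rw [toAE, AEEqFun.mk_mul_mk]; congr 1; ext x; simp
  mul_smul a b f := AEEqFun.induction_on f fun f hf => by
    change toAE μ (a * b) * _ = toAE μ a * (toAE μ b * _)
    simp only [toAE, AEEqFun.mk_mul_mk]; congr 1; ext x; simp [mul_assoc]
  smul_zero a := by
    change toAE μ a * AEEqFun.mk _ _ = AEEqFun.mk _ _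
    simp only [toAE, AEEqFun.mk_mul_mk]; congr 1; ext x; simp
  smul_add a f g := AEEqFun.induction_on₂ f g fun f hf g hg => by
    change toAE μ a * (_ + _) = toAE μ a * _ + toAE μ a * _
    simp only [toAE, AEEqFun.mk_mul_mk, AEEqFun.mk_add_mk]; congr 1; ext x; simp [mul_add]
  add_smul a b f := AEEqFun.induction_on f fun f hf => by
    change toAE μ (a + b) * _ = toAE μ a * _ + toAE μ b * _
    simp only [toAE, AEEqFun.mk_mul_mk, AEEqFun.mk_add_mk]; congr 1; ext x; simp [add_mul]
  zero_smul f := AEEqFun.induction_on f fun f hf => by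
    change toAE μ 0 * _ = AEEqFun.mk _ _
    simp only [toAE, AEEqFun.mk_mul_mk]; congr 1; ext x; simp

instance instSMulCommSmooth : SMulCommClass (Smooth m M) ℂ (M →ₘ[μ] ℂ) where
  smul_comm a c f := AEEqFun.induction_on f fun f hf => by
    change toAE μ a * (c • _) = c • (toAE μ a * _)
    simp only [toAE, AEEqFun.mk_mul_mk, AEEqFun.smul_mk]; congr 1; ext x
    simp [mul_left_comm]

/-- `δ` is the divergence of `Y` with respect to `μ`. -/
def IsDivergence (μ : Measure M) (Y : VF m M) (δ : Smooth m M) : Prop :=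
  ∀ φ : Smooth m M, ∫ x, Y φ x ∂μ = - ∫ x, δ x * φ x ∂μ

/-- Every vector field has a smooth divergence. For a finite measure that is positive on
nonempty open sets, this means that `μ` has a smooth positive density in every chart. -/
def HasSmoothDivergence (m : ℕ) {M : Type*} [TopologicalSpace M]
    [ChartedSpace (EuclideanSpace ℝ (Fin m)) M] [MeasurableSpace M] (μ : Measure M) : Prop :=
  ∀ Y : VF m M, ∃ δ : Smooth m M, IsDivergence μ Y δ

/-- `Y f = g` in the weak sense, for integrable `f` and `g`. -/
def IsWeakDeriv (Y : VF m M) (f g : M →ₘ[μ] ℂ) : Prop :=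
  Integrable f μ ∧ Integrable g μ ∧ ∃ δ : Smooth m M, IsDivergence μ Y δ ∧
    ∀ φ : Smooth m M, ∫ x, g x * φ x ∂μ = - ∫ x, f x * (Y φ x + δ x * φ x) ∂μ

open Classical in
/-- The weak derivative `Y f` (zero if there is none). -/
def weakDeriv (Y : VF m M) (f : M →ₘ[μ] ℂ) : M →ₘ[μ] ℂ :=
  if h : ∃ g, IsWeakDeriv Y f g then h.choose else 0

/-- A Banach space of (classes of) integrable functions on `M`, with continuous inclusion in
`L¹`. The value of `nrm` matters only on `carrier`. -/
structure BanachFunctionSpace (μ : Measure M) where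
  carrier : Submodule ℂ (M →ₘ[μ] ℂ)
  nrm : (M →ₘ[μ] ℂ) → ℝ
  nrm_add_le : ∀ f ∈ carrier, ∀ g ∈ carrier, nrm (f + g) ≤ nrm f + nrm g
  nrm_smul : ∀ (c : ℂ), ∀ f ∈ carrier, nrm (c • f) = ‖c‖ * nrm f
  integrable : ∀ f ∈ carrier, Integrable f μ
  exists_integral_le : ∃ C : ℝ, ∀ f ∈ carrier, ∫ x, ‖f x‖ ∂μ ≤ C * nrm f
  complete : ∀ u : ℕ → (M →ₘ[μ] ℂ), (∀ i, u i ∈ carrier) →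
    (∀ ε > 0, ∃ N, ∀ i ≥ N, ∀ j ≥ N, nrm (u i - u j) < ε) →
    ∃ f ∈ carrier, ∀ ε > 0, ∃ N, ∀ i ≥ N, nrm (u i - f) < ε

variable {d : ℕ}

/-- A sequence of anisotropic Banach spaces `B^l(M)`: derivatives along sections of
`HM = H_{1,0}M ⊕ H_{0,1}M` map `B^{l+1}` to `B^l`, and `C^{θ(l)}` functions multiply `B^l`. -/
structure AnisotropicSpaces (S : CRStructure m M d) (μ : Measure M) where
  B : ℕ → BanachFunctionSpace μ
  θ : ℕ → ℕ
  antitone_B : ∀ l, (B (l + 1)).carrier ≤ (B l).carrier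
  monotone_θ : Monotone θ
  exists_weakDeriv : ∀ l, ∀ f ∈ (B (l + 1)).carrier, ∀ Y ∈ S.H ⊔ conjSub S.H,
    ∃ g ∈ (B l).carrier, IsWeakDeriv Y f g
  mul_mem : ∀ l, ∀ f ∈ (B l).carrier, ∀ g : C(M, ℂ), ContMDiff (𝓡 m) 𝓘(ℝ, ℂ) (θ l) g →
    g.toAEEqFun μ * f ∈ (B l).carrier

namespace AnisotropicSpaces

variable {S : CRStructure m M d}

/-- `⋂_l B^l(M) = C^∞(M)`. -/
def InterEqSmooth (B : AnisotropicSpaces S μ) : Prop :=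
  ∀ f : M →ₘ[μ] ℂ, (∀ l, f ∈ (B.B l).carrier) ↔ ∃ a : Smooth m M, f = toAE μ a

/-- `B^l_{p,r}(M)`: the `(p,r)`-forms with coefficients in `B^l(M)`. -/
def forms (B : AnisotropicSpaces S μ) (l p r : ℕ) : Submodule ℂ (Form S p r (M →ₘ[μ] ℂ)) where
  carrier := {f | ∀ Z X, f.ev Z X ∈ (B.B l).carrier}
  add_mem' := fun hf hg Z X => (B.B l).carrier.add_mem (hf Z X) (hg Z X)
  zero_mem' := fun _ _ => (B.B l).carrier.zero_mem
  smul_mem' := fun c _ hf Z X => (B.B l).carrier.smul_mem c (hf Z X)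

/-- The norm of `B^l_{p,r}(M)`, through the coefficients with respect to frames. -/
def formNorm (B : AnisotropicSpaces S μ) (F : Frames S) (l : ℕ) {p r : ℕ}
    (f : Form S p r (M →ₘ[μ] ℂ)) : ℝ :=
  ∑ J : Fin r → Fin F.N₂, ∑ I : Fin p → Fin F.N₁,
    (B.B l).nrm (f.ev (fun i => F.Z (J i)) (fun i => F.X (I i)))

/-- A linear operator `B^0_{p,r} → B^0_{p,s}` that is continuous from `B^l_{p,r}` to `B^{l+1}_{p,s}`
for every `l`. -/
def GainsOne (B : AnisotropicSpaces S μ) (F : Frames S) {p r s : ℕ}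
    (A : B.forms 0 p r →ₗ[ℂ] B.forms 0 p s) : Prop :=
  ∀ l, (∀ f, f.1 ∈ B.forms l p r → (A f).1 ∈ B.forms (l + 1) p s) ∧
    ∃ C : ℝ, ∀ f, f.1 ∈ B.forms l p r → B.formNorm F (l + 1) (A f).1 ≤ C * B.formNorm F l f.1

/-- The spaces are adapted to the `∂̄_b`-equation in degree `r ≥ 1` (no condition for `r = 0`):
whenever `H^{p,r}(M) = 0`, there are operators `A_r` and `A_{r+1}` that gain one order, with
`f = ∂̄_b A_r f + A_{r+1} ∂̄_b f` for `f ∈ B^l_{p,r}`, `l ≥ 1`. -/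
def IsAdapted (B : AnisotropicSpaces S μ) (F : Frames S) : ℕ → Prop
  | 0 => True
  | r + 1 => ∀ p, CohomologyVanishes S p (r + 1) →
      ∃ (A₁ : B.forms 0 p (r + 1) →ₗ[ℂ] B.forms 0 p r)
        (A₂ : B.forms 0 p (r + 2) →ₗ[ℂ] B.forms 0 p (r + 1)),
        B.GainsOne F A₁ ∧ B.GainsOne F A₂ ∧
        ∀ (f : B.forms 0 p (r + 1)) (g : B.forms 0 p (r + 2)), f.1 ∈ B.forms 1 p (r + 1) →
          (∀ Z X, g.1.ev Z X = dbar weakDeriv f.1 Z X) →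
          ∀ Z X, f.1.ev Z X = dbar weakDeriv (A₁ f).1 Z X + (A₂ g).1.ev Z X

end AnisotropicSpaces

end Spaces

end CR

end

/-! Write `d` for the tangential operator of `M` and `ψ = 1 - Φ`, with `Φ` extended to all vector
fields by a projection to `H_{0,1}M` that kills `H_{1,0}M`. Then `Φ² = 0`, so `ψ` is invertible, and
it carries `H_{0,1}M` onto the graph. Transport by `ψ` identifies the `(p,r)`-forms of the two
structures, for the same `p` and `r`, and turns the operator of the perturbed structure into an
operator `D` with `D² = 0` on the forms of `M`.

The difference `D - d` (`pertOp`) has two kinds of terms. In the first-order terms the form is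
differentiated along `ψZ - Z = -Φ(Z)`, which is a section of `H_{1,0}M`; this is where horizontality
enters, since the spaces `B^l` only control derivatives along `HM`. The zero-order terms have
coefficients made from `Φ` and its derivatives. Hence `D - d` maps `B^{l+1}` to `B^l`, with norm
tending to zero with `Φ` (`exists_pertOp_bound`). The homotopy operators gain this order back, so
for small `Φ` the operators `(D - d)A` have norm at most `1/2`, in each `B^l` when `A = A_r`, and in
`B^0` when `A = A_{r+1}`.

The rest is algebra and a Neumann series on smooth forms, which are complete for the family of all
the `B^l` norms (`IsCompleteNorms.exists_primitive`). If `Df = 0`, solve `g + (D - d)A_r g = f`. The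
homotopy formula turns this into `f = D A_r g + A_{r+1} dg`, so `D A_{r+1} dg = 0`; since `dg = d
A_{r+1} dg`, the form `dg` is `(d - D)A_{r+1} dg`, of norm at most half its own. So `dg = 0` and `f
= D A_r g`.

Two points need analysis. The axioms for `B^l` are purely qualitative, so every bound comes from the
closed graph theorem, the pairings with smooth functions separating points (`exists_deriv_bound`,
`exists_mul_bound`). And derivatives of `Φ` of any order are controlled by the `C^{θ(l)}` norms
because `θ` is unbounded: otherwise some `C^k` function that is not smooth would lie in all `B^l`
(`exists_le_theta`). The `δ_l` come from a diagonal choice over countably many smallness conditions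
(`exists_delta`). -/

open MeasureTheory Filter Topology
open scoped Manifold ContDiff

noncomputable section

namespace CR

/-! ### Cartan calculus and the Chevalley-Eilenberg complex of a Lie-Rinehart algebra. -/

section LieRinehart

/-- Additive endomorphisms of `Q` and `N` that are derivations over the same map `D` of the base
ring. -/
structure LieData (R Q N : Type*) [CommRing R] [AddCommGroup Q] [Module R Q] [AddCommGroup N]
    [Module R N] where
  D : R → R
  τ : Q →+ Q
  σ : N →+ N
  τ_smul : ∀ a q, τ (a • q) = a • τ q + D a • q
  σ_smul : ∀ a w, σ (a • w) = a • σ w + D a • w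

variable {R Q N : Type*} [CommRing R] [AddCommGroup Q] [Module R Q] [AddCommGroup N] [Module R N]

/-- Isolates the dependence of the sum on the entry in slot `i`, so that linearity of the Lie
derivative in that slot can be read off. -/
theorem sum_update_update {r : ℕ} (τ : Q → Q) (f : Q [⋀^Fin r]→ₗ[R] N) (v : Fin r → Q) (i : Fin r)
    (z : Q) :
    ∑ j, f (Function.update (Function.update v i z) j (τ (Function.update v i z j)))
      = f (Function.update v i (τ z)) +
        ∑ j ∈ Finset.univ.erase i, f (Function.update (Function.update v j (τ (v j))) i z) := by
  rw [← Finset.add_sum_erase _ _ (Finset.mem_univ i)]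
  congr 1
  · simp
  · refine Finset.sum_congr rfl fun j hj => ?_
    have hj' := Finset.ne_of_mem_erase hj
    rw [Function.update_of_ne hj', Function.update_comm hj']

/-- The Lie derivative of an alternating map. -/
def LieData.lie (T : LieData R Q N) {r : ℕ} (f : Q [⋀^Fin r]→ₗ[R] N) : Q [⋀^Fin r]→ₗ[R] N where
  toFun v := T.σ (f v) - ∑ j, f (Function.update v j (T.τ (v j)))
  map_update_add' {inst} v i x y := by
    obtain rfl : inst = instDecidableEqFin r := Subsingleton.elim _ _
    have key := sum_update_update T.τ f v i
    rw [key, key, key]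
    simp only [map_add, f.map_update_add, Finset.sum_add_distrib]
    abel
  -- The term `D c • f` produced by `σ` cancels the one produced by `τ` in slot `i`; so the Lie
  -- derivative is linear over `R` in each slot.
  map_update_smul' {inst} v i c x := by
    obtain rfl : inst = instDecidableEqFin r := Subsingleton.elim _ _
    have key := sum_update_update T.τ f v i
    rw [key, key]
    simp only [T.τ_smul, T.σ_smul, f.map_update_add, f.map_update_smul, smul_sub, smul_add,
      Finset.smul_sum]
    abel
  map_eq_zero_of_eq' v i j hv hij := by
    rw [f.map_eq_zero_of_eq v hv hij, map_zero, zero_sub, neg_eq_zero]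
    rw [← Finset.add_sum_erase _ _ (Finset.mem_univ i),
      ← Finset.add_sum_erase _ _ (Finset.mem_erase.2 ⟨hij.symm, Finset.mem_univ j⟩), ← add_assoc]
    -- These two terms differ by the transposition of `i` and `j`; every other term still has two
    -- equal entries.
    have h1 : f (Function.update v i (T.τ (v i))) + f (Function.update v j (T.τ (v j))) = 0 := by
      rw [← hv]
      have := f.map_update_update v hij (T.τ (v i))
      have h2 : Function.update v i (T.τ (v i)) ∘ Equiv.swap i j
          = Function.update v j (T.τ (v i)) := by
        ext k
        rcases eq_or_ne k i with rfl | hki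
        · simp [Function.update_of_ne hij, Function.update_of_ne hij.symm, hv]
        · rcases eq_or_ne k j with rfl | hkj
          · simp
          · simp [Equiv.swap_apply_of_ne_of_ne hki hkj, hki, hkj]
      rw [← h2, f.map_swap _ hij, add_neg_cancel]
    rw [h1, zero_add]
    refine Finset.sum_eq_zero fun k hk => ?_
    have hkj := Finset.ne_of_mem_erase hk
    have hki := Finset.ne_of_mem_erase (Finset.mem_of_mem_erase hk)
    exact f.map_eq_zero_of_eq _ (by simp [hkj.symm, hki.symm, hv]) hij

theorem LieData.lie_apply (T : LieData R Q N) {r : ℕ} (f : Q [⋀^Fin r]→ₗ[R] N) (v : Fin r → Q) :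
    T.lie f v = T.σ (f v) - ∑ j, f (Function.update v j (T.τ (v j))) := rfl

theorem LieData.lie_add (T : LieData R Q N) {r : ℕ} (f g : Q [⋀^Fin r]→ₗ[R] N) :
    T.lie (f + g) = T.lie f + T.lie g := by
  ext v
  simp only [lie_apply, AlternatingMap.add_apply, map_add, Finset.sum_add_distrib]
  abel

theorem LieData.lie_smul (T : LieData R Q N) {r : ℕ} (a : R) (f : Q [⋀^Fin r]→ₗ[R] N) :
    T.lie (a • f) = a • T.lie f + T.D a • f := by
  ext v
  simp only [lie_apply, AlternatingMap.add_apply, AlternatingMap.smul_apply, T.σ_smul, smul_sub,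
    Finset.smul_sum]
  abel

/-- The Lie derivative as an additive map. -/
def LieData.lieHom (T : LieData R Q N) (r : ℕ) :
    (Q [⋀^Fin r]→ₗ[R] N) →+ (Q [⋀^Fin r]→ₗ[R] N) :=
  AddMonoidHom.mk' T.lie T.lie_add

theorem LieData.lie_sub (T : LieData R Q N) {r : ℕ} (f g : Q [⋀^Fin r]→ₗ[R] N) :
    T.lie (f - g) = T.lie f - T.lie g := map_sub (T.lieHom r) f g

/-- Cartan's relation between Lie derivative and contraction. It drives the inductions on the degree
below. -/
theorem LieData.curryLeft_lie (T : LieData R Q N) {r : ℕ} (f : Q [⋀^Fin (r + 1)]→ₗ[R] N) (q : Q) :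
    (T.lie f).curryLeft q = T.lie (f.curryLeft q) - f.curryLeft (T.τ q) := by
  ext v
  simp only [AlternatingMap.curryLeft_apply_apply, AlternatingMap.sub_apply, lie_apply,
    Fin.sum_univ_succ, Matrix.cons_val_zero, Matrix.cons_val_succ]
  have h0 : Function.update (Matrix.vecCons q v) 0 (T.τ q) = Matrix.vecCons (T.τ q) v :=
    Fin.update_cons_zero _ _ _
  have hs : ∀ j, Function.update (Matrix.vecCons q v) (Fin.succ j) (T.τ (v j))
      = Matrix.vecCons q (Function.update v j (T.τ (v j))) := fun j =>
    (Fin.cons_update (α := fun _ => Q) q v j (T.τ (v j))).symm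
  rw [h0]
  simp only [hs]
  abel

theorem ext_curryLeft {r : ℕ} {f g : Q [⋀^Fin (r + 1)]→ₗ[R] N}
    (h : ∀ q, f.curryLeft q = g.curryLeft q) : f = g := by
  ext v
  have := DFunLike.congr_fun (h (v 0)) (Fin.tail v)
  simpa [Matrix.vecCons, Fin.cons_self_tail] using this

theorem LieData.lie_commutator (T₁ T₂ T : LieData R Q N)
    (hτ : ∀ q, T.τ q = T₁.τ (T₂.τ q) - T₂.τ (T₁.τ q))
    (hσ : ∀ w, T.σ w = T₁.σ (T₂.σ w) - T₂.σ (T₁.σ w)) {r : ℕ} (f : Q [⋀^Fin r]→ₗ[R] N) :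
    T.lie f = T₁.lie (T₂.lie f) - T₂.lie (T₁.lie f) := by
  induction r with
  | zero =>
    ext v
    simp [lie_apply, hσ]
  | succ r ih =>
    refine ext_curryLeft fun q => ?_
    rw [curryLeft_lie, ih, hτ]
    have h : ∀ (f g : Q [⋀^Fin (r + 1)]→ₗ[R] N),
      (f - g).curryLeft q = f.curryLeft q - g.curryLeft q := fun f g => rfl
    rw [h]
    simp only [curryLeft_lie, lie_sub, map_sub]
    abel

/-- A Lie-Rinehart algebra `Q` over `R` together with a flat module `N`. -/
structure LieRinehart (R Q N : Type*) [CommRing R] [AddCommGroup Q] [Module R Q] [AddCommGroup N]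
    [Module R N] where
  T : Q → LieData R Q N
  τ_add : ∀ Z W q, (T (Z + W)).τ q = (T Z).τ q + (T W).τ q
  σ_add : ∀ Z W w, (T (Z + W)).σ w = (T Z).σ w + (T W).σ w
  σ_smul_left : ∀ (a : R) Z w, (T (a • Z)).σ w = a • (T Z).σ w
  τ_self : ∀ Z, (T Z).τ Z = 0
  τ_τ : ∀ Z W q, (T ((T Z).τ W)).τ q = (T Z).τ ((T W).τ q) - (T W).τ ((T Z).τ q)
  σ_τ : ∀ Z W w, (T ((T Z).τ W)).σ w = (T Z).σ ((T W).σ w) - (T W).σ ((T Z).σ w)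

namespace LieRinehart

variable (A : LieRinehart R Q N) {r : ℕ}

/-- The values of the Chevalley-Eilenberg differential. -/
def dVal (f : Q [⋀^Fin r]→ₗ[R] N) (Z : Fin (r + 1) → Q) : N :=
  ∑ i : Fin (r + 1), (-1 : ℤ) ^ (i : ℕ) •
    ((A.T (Z i)).σ (f (i.removeNth Z))
      - ∑ j : Fin r, if i ≤ j.castSucc then
          f (Function.update (i.removeNth Z) j ((A.T (Z i)).τ (i.removeNth Z j))) else 0)

theorem dVal_zero (f : Q [⋀^Fin 0]→ₗ[R] N) (Z : Fin 1 → Q) :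
    A.dVal f Z = (A.T (Z 0)).lie f (Fin.tail Z) := by
  simp only [dVal, LieData.lie_apply, Finset.univ_eq_empty, Finset.sum_empty]
  simp [Subsingleton.elim (Fin.removeNth 0 Z) (Fin.tail Z)]

/-- Cartan's magic formula, at the level of values. The term `i = 0` is the Lie derivative, and the
other terms form the differential of the contraction with shifted sign. -/
theorem dVal_cons (f : Q [⋀^Fin (r + 1)]→ₗ[R] N) (Z : Q) (Zs : Fin (r + 1) → Q) :
    A.dVal f (Matrix.vecCons Z Zs) = (A.T Z).lie f Zs - A.dVal (f.curryLeft Z) Zs := by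
  have h0 : (0 : Fin (r + 2)).removeNth (Matrix.vecCons Z Zs) = Zs := by
    simp [Matrix.vecCons]
  have hs : ∀ i : Fin (r + 1), i.succ.removeNth (Matrix.vecCons Z Zs)
      = Matrix.vecCons Z (i.removeNth Zs) := by
    intro i
    ext j
    refine Fin.cases ?_ (fun j => ?_) j
    · simp [Fin.removeNth]
    · simp [Fin.removeNth]
  rw [dVal, Fin.sum_univ_succ, sub_eq_add_neg ((A.T Z).lie f Zs)]
  congr 1
  · simp only [h0, LieData.lie_apply]
    simp
  · rw [dVal, ← Finset.sum_neg_distrib]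
    refine Finset.sum_congr rfl fun i _ => ?_
    rw [hs i, Fin.val_succ, pow_succ, mul_neg_one, neg_smul, Fin.sum_univ_succ]
    have hu : ∀ (v : Fin r → Q) j x, Function.update (Matrix.vecCons Z v) (Fin.succ j) x
      = Matrix.vecCons Z (Function.update v j x) := fun v j x =>
        (Fin.cons_update (α := fun _ => Q) Z v j x).symm
    simp only [Matrix.cons_val_succ, hu, AlternatingMap.curryLeft_apply_apply,
      Fin.castSucc_zero, Fin.castSucc_succ, Fin.succ_le_succ_iff]
    simp

theorem lie_add_left (Z W : Q) (f : Q [⋀^Fin r]→ₗ[R] N) :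
    (A.T (Z + W)).lie f = (A.T Z).lie f + (A.T W).lie f := by
  ext v
  simp only [LieData.lie_apply, A.τ_add, A.σ_add, AlternatingMap.add_apply, f.map_update_add,
    Finset.sum_add_distrib]
  abel

theorem dVal_add (f g : Q [⋀^Fin r]→ₗ[R] N) (Z : Fin (r + 1) → Q) :
    A.dVal (f + g) Z = A.dVal f Z + A.dVal g Z := by
  simp only [dVal, ← Finset.sum_add_distrib, ← smul_add]
  refine Finset.sum_congr rfl fun i _ => ?_
  congr 1
  simp only [AlternatingMap.add_apply, map_add]
  have : ∀ j, (if i ≤ Fin.castSucc j then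
      f (Function.update (i.removeNth Z) j ((A.T (Z i)).τ (i.removeNth Z j))) +
      g (Function.update (i.removeNth Z) j ((A.T (Z i)).τ (i.removeNth Z j))) else 0) =
      (if i ≤ Fin.castSucc j then
      f (Function.update (i.removeNth Z) j ((A.T (Z i)).τ (i.removeNth Z j))) else 0) +
      (if i ≤ Fin.castSucc j then
      g (Function.update (i.removeNth Z) j ((A.T (Z i)).τ (i.removeNth Z j))) else 0) := by
    intro j; split_ifs <;> simp
  simp only [this, Finset.sum_add_distrib]
  abel

/-- An alternating map from its curried form. -/
def uncurryAlt (T : Q →ₗ[R] (Q [⋀^Fin r]→ₗ[R] N))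
    (hT : ∀ Z v, (∃ i, v i = Z) → T Z v = 0) : Q [⋀^Fin (r + 1)]→ₗ[R] N where
  toFun v := T (v 0) (Fin.tail v)
  map_update_add' {inst} v i x y := by
    obtain rfl : inst = instDecidableEqFin _ := Subsingleton.elim _ _
    have h0 : ∀ (i : Fin r) z, Function.update v i.succ z 0 = v 0 := fun i z =>
      Function.update_of_ne (Fin.succ_ne_zero i).symm _ _
    refine Fin.cases ?_ (fun i => ?_) i <;> simp [h0]
  map_update_smul' {inst} v i c x := by
    obtain rfl : inst = instDecidableEqFin _ := Subsingleton.elim _ _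
    have h0 : ∀ (i : Fin r) z, Function.update v i.succ z 0 = v 0 := fun i z =>
      Function.update_of_ne (Fin.succ_ne_zero i).symm _ _
    refine Fin.cases ?_ (fun i => ?_) i <;> simp [h0]
  map_eq_zero_of_eq' v i j hv hij := by
    revert hv hij
    refine Fin.cases ?_ (fun i => ?_) i <;> refine Fin.cases ?_ (fun j => ?_) j
    · intro _ h; exact absurd rfl h
    · intro hv _; exact hT _ _ ⟨j, hv.symm⟩
    · intro hv _; exact hT _ _ ⟨i, hv⟩
    · intro hv hij
      exact (T (v 0)).map_eq_zero_of_eq _ hv fun h => hij (by rw [h])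

/-- Multilinearity of the explicit formula is proved by induction on the degree through Cartan's
formula, which avoids any manipulation of double sums. -/
theorem exists_d (f : Q [⋀^Fin r]→ₗ[R] N) :
    ∃ g : Q [⋀^Fin (r + 1)]→ₗ[R] N, ∀ Z, g Z = A.dVal f Z := by
  induction r with
  | zero =>
    let T : Q →ₗ[R] (Q [⋀^Fin 0]→ₗ[R] N) :=
      { toFun := fun Z => (A.T Z).lie f
        map_add' := fun Z W => A.lie_add_left Z W f
        map_smul' := fun a Z => by
          ext v; simp [LieData.lie_apply, A.σ_smul_left] }
    exact ⟨uncurryAlt T fun _ _ ⟨i, _⟩ => i.elim0, fun Z => (A.dVal_zero f Z).symm⟩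
  | succ r ih =>
    choose d hd using ih
    have d_add : ∀ f g, d (f + g) = d f + d g := fun f g => by
      ext v; simp [hd, A.dVal_add]
    let T₀ : Q → (Q [⋀^Fin (r + 1)]→ₗ[R] N) := fun Z => (A.T Z).lie f - d (f.curryLeft Z)
    have T₀_add : ∀ Z W, T₀ (Z + W) = T₀ Z + T₀ W := fun Z W => by
      simp only [T₀, A.lie_add_left, map_add, d_add]; abel
    have d_zero : d 0 = 0 := by simpa using d_add 0 0
    have d_cons : ∀ (g : Q [⋀^Fin r]→ₗ[R] N) Z (Zs : Fin r → Q), r = 0 →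
      d g (Matrix.vecCons Z Zs) = (A.T Z).lie g Zs := by
      rintro g Z Zs rfl
      rw [hd, A.dVal_zero]; rfl
    -- Contracting `L_Z f - d(i_Z f)` with `Z` gives `L_Z i_Z f - L_Z i_Z f + d(i_Z i_Z f)`, because
    -- `[Z, Z] = 0`; the last term vanishes too.
    have T₀_self : ∀ Z (v : Fin r → Q), T₀ Z (Matrix.vecCons Z v) = 0 := by
      intro Z v
      have h1 := DFunLike.congr_fun ((A.T Z).curryLeft_lie f Z) v
      rw [AlternatingMap.curryLeft_apply_apply] at h1
      simp only [T₀, AlternatingMap.sub_apply, h1, A.τ_self, map_zero, sub_zero]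
      cases r with
      | zero => rw [d_cons _ _ _ rfl, sub_self]
      | succ r =>
        rw [hd, A.dVal_cons, AlternatingMap.curryLeft_same]
        have : A.dVal (0 : Q [⋀^Fin r]→ₗ[R] N) v = 0 := by simpa using A.dVal_add 0 0 v
        rw [this]; simp
    have T₀_swap : ∀ Z W (v : Fin r → Q), T₀ Z (Matrix.vecCons W v) = - T₀ W (Matrix.vecCons Z v) := by
      intro Z W v
      have h := T₀_self (Z + W) v
      rw [T₀_add, AlternatingMap.add_apply, AlternatingMap.map_vecCons_add,
        AlternatingMap.map_vecCons_add, T₀_self, T₀_self] at h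
      rw [eq_neg_iff_add_eq_zero]
      simpa using h
    let T : Q →ₗ[R] (Q [⋀^Fin (r + 1)]→ₗ[R] N) :=
      { toFun := T₀
        map_add' := T₀_add
        -- The Lie derivative is not linear over `R` in `Z`. Skew-symmetry moves `Z` to the second
        -- slot, where linearity is known.
        map_smul' := fun a Z => ext_curryLeft fun W => by
          ext v
          simp only [AlternatingMap.curryLeft_apply_apply, RingHom.id_apply,
            AlternatingMap.smul_apply]
          rw [T₀_swap, AlternatingMap.map_vecCons_smul, T₀_swap Z, smul_neg] }
    have hT : ∀ Z v, (∃ i, v i = Z) → T Z v = 0 := by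
      rintro Z v ⟨i, hi⟩
      have h0 : (v ∘ Equiv.swap 0 i) = Matrix.vecCons Z (Fin.tail (v ∘ Equiv.swap 0 i)) := by
        rw [← hi]
        have := (Fin.cons_self_tail (v ∘ Equiv.swap 0 i)).symm
        rwa [Function.comp_apply, Equiv.swap_apply_left] at this
      rcases eq_or_ne 0 i with rfl | h
      · have : v = Matrix.vecCons Z (Fin.tail v) := by
          rw [← hi]; exact (Fin.cons_self_tail v).symm
        rw [this]; exact T₀_self _ _
      · have := (T Z).map_swap v h
        rw [h0] at this
        rw [← neg_eq_zero, ← this]; exact T₀_self _ _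
    refine ⟨uncurryAlt T hT, fun Z => ?_⟩
    have : Z = Matrix.vecCons (Z 0) (Fin.tail Z) := (Fin.cons_self_tail Z).symm
    rw [this, A.dVal_cons]
    change ((A.T _).lie f - d (f.curryLeft _)) _ = _
    rw [AlternatingMap.sub_apply, hd]; rfl

/-- The Chevalley-Eilenberg differential. -/
def d (f : Q [⋀^Fin r]→ₗ[R] N) : Q [⋀^Fin (r + 1)]→ₗ[R] N := (A.exists_d f).choose

theorem d_apply (f : Q [⋀^Fin r]→ₗ[R] N) (Z : Fin (r + 1) → Q) : A.d f Z = A.dVal f Z :=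
  (A.exists_d f).choose_spec Z

theorem d_add (f g : Q [⋀^Fin r]→ₗ[R] N) : A.d (f + g) = A.d f + A.d g := by
  ext v; simp [d_apply, A.dVal_add]

/-- The differential as an additive map. -/
def dHom (r : ℕ) : (Q [⋀^Fin r]→ₗ[R] N) →+ (Q [⋀^Fin (r + 1)]→ₗ[R] N) :=
  AddMonoidHom.mk' A.d A.d_add

theorem d_sub (f g : Q [⋀^Fin r]→ₗ[R] N) : A.d (f - g) = A.d f - A.d g :=
  map_sub (A.dHom r) f g

theorem curryLeft_d_zero (f : Q [⋀^Fin 0]→ₗ[R] N) (Z : Q) :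
    (A.d f).curryLeft Z = (A.T Z).lie f := by
  ext v
  rw [AlternatingMap.curryLeft_apply_apply, d_apply, dVal_zero]; rfl

theorem curryLeft_d (f : Q [⋀^Fin (r + 1)]→ₗ[R] N) (Z : Q) :
    (A.d f).curryLeft Z = (A.T Z).lie f - A.d (f.curryLeft Z) := by
  ext v
  rw [AlternatingMap.curryLeft_apply_apply, d_apply, dVal_cons, AlternatingMap.sub_apply, d_apply]

/-- Contract with `W`: Cartan's formula and `L_{[Z,W]} = [L_Z, L_W]`, which needs flatness of the
module, reduce the degree by one. -/
theorem lie_d (f : Q [⋀^Fin r]→ₗ[R] N) (Z : Q) : (A.T Z).lie (A.d f) = A.d ((A.T Z).lie f) := by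
  have hc := fun (W : Q) {s : ℕ} (f : Q [⋀^Fin s]→ₗ[R] N) =>
    LieData.lie_commutator (A.T Z) (A.T W) (A.T ((A.T Z).τ W)) (A.τ_τ Z W) (A.σ_τ Z W) f
  induction r with
  | zero =>
    refine ext_curryLeft fun W => ?_
    rw [LieData.curryLeft_lie, curryLeft_d_zero, curryLeft_d_zero, curryLeft_d_zero, hc]
    abel
  | succ r ih =>
    refine ext_curryLeft fun W => ?_
    rw [LieData.curryLeft_lie, curryLeft_d, curryLeft_d, curryLeft_d, hc, LieData.lie_sub, ih,
      LieData.curryLeft_lie, d_sub]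
    abel

/-- Contraction with `W` gives `L_W d f - d L_W f + d d (i_W f)`, and the degree drops. -/
theorem d_d (f : Q [⋀^Fin r]→ₗ[R] N) : A.d (A.d f) = 0 := by
  induction r with
  | zero =>
    refine ext_curryLeft fun W => ?_
    rw [curryLeft_d, curryLeft_d_zero, lie_d]; simp
  | succ r ih =>
    refine ext_curryLeft fun W => ?_
    rw [curryLeft_d, curryLeft_d, d_sub, ih, lie_d]; simp

end LieRinehart

end LieRinehart

theorem alternatingMap_sum_apply {R Q N ι κ : Type*} [CommRing R] [AddCommGroup Q] [Module R Q]
    [AddCommGroup N] [Module R N] (s : Finset κ) (f : κ → Q [⋀^ι]→ₗ[R] N) (v : ι → Q) :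
    (∑ i ∈ s, f i) v = ∑ i ∈ s, f i v :=
  map_sum (AddMonoidHom.mk' (fun f : Q [⋀^ι]→ₗ[R] N => f v) fun _ _ => rfl) f s

/-! ### The tangential Cauchy-Riemann complex as a Chevalley-Eilenberg complex. -/

section TangentialComplex

variable {m : ℕ} {M : Type*} [TopologicalSpace M] [ChartedSpace (EuclideanSpace ℝ (Fin m)) M]
  {d : ℕ}

theorem VF.lie_smul (Y X : VF m M) (a : Smooth m M) : ⁅Y, a • X⁆ = a • ⁅Y, X⁆ + Y a • X := by
  ext1 b
  simp only [Derivation.commutator_apply, Derivation.add_apply, Derivation.smul_apply,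
    Derivation.leibniz, smul_eq_mul]
  ring

theorem VF.smul_lie (Y X : VF m M) (a : Smooth m M) : ⁅a • Y, X⁆ = a • ⁅Y, X⁆ - X a • Y := by
  ext1 b
  simp only [Derivation.commutator_apply, Derivation.sub_apply, Derivation.smul_apply,
    Derivation.leibniz, smul_eq_mul]
  ring

theorem VF.lie_add (Y X X' : VF m M) : ⁅Y, X + X'⁆ = ⁅Y, X⁆ + ⁅Y, X'⁆ := by
  ext1 b
  simp only [Derivation.commutator_apply, Derivation.add_apply, map_add]
  ring

theorem VF.add_lie (Y Y' X : VF m M) : ⁅Y + Y', X⁆ = ⁅Y, X⁆ + ⁅Y', X⁆ := by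
  ext1 b
  simp only [Derivation.commutator_apply, Derivation.add_apply, map_add]
  ring

theorem VF.lie_self (Y : VF m M) : ⁅Y, Y⁆ = 0 := by
  ext1 b
  simp only [Derivation.commutator_apply, Derivation.zero_apply, sub_self]

theorem VF.lie_skew (Y X : VF m M) : -⁅Y, X⁆ = ⁅X, Y⁆ := by
  ext1 b
  simp only [Derivation.commutator_apply, Derivation.neg_apply]
  ring

theorem VF.lie_sum {ι : Type*} (Y : VF m M) (s : Finset ι) (X : ι → VF m M) :
    ⁅Y, ∑ i ∈ s, X i⁆ = ∑ i ∈ s, ⁅Y, X i⁆ :=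
  map_sum (AddMonoidHom.mk' (fun X : VF m M => ⁅Y, X⁆) fun _ _ => VF.lie_add _ _ _) X s

theorem VF.lie_lie (Y X W : VF m M) : ⁅⁅Y, X⁆, W⁆ = ⁅Y, ⁅X, W⁆⁆ - ⁅X, ⁅Y, W⁆⁆ := by
  ext1 b
  simp only [Derivation.commutator_apply, Derivation.sub_apply, map_sub]
  ring

namespace CRStructure

variable (S : CRStructure m M d)

/-- The action of `H_{0,1}M` on `T_ℂM / H_{0,1}M` by brackets. -/
def lieQ (Z : S.H) : VF m M ⧸ S.H →+ VF m M ⧸ S.H :=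
  QuotientAddGroup.map S.H.toAddSubgroup S.H.toAddSubgroup
    (AddMonoidHom.mk' (fun X : VF m M => ⁅(Z : VF m M), X⁆) fun X Y => VF.lie_add _ X Y)
    fun X hX => S.lie_mem Z Z.2 X hX

theorem lieQ_mkQ (Z : S.H) (X : VF m M) : S.lieQ Z (S.H.mkQ X) = S.H.mkQ ⁅(Z : VF m M), X⁆ := rfl

/-- The Lie derivative along `Z` on the forms on `T_ℂM / H_{0,1}M`. -/
def lieDataQ (Z : S.H) : LieData (Smooth m M) (VF m M ⧸ S.H) (Smooth m M) where
  D := (Z : VF m M)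
  τ := S.lieQ Z
  σ := AddMonoidHom.mk' (Z : VF m M) fun a b => map_add _ a b
  τ_smul a q := by
    obtain ⟨X, rfl⟩ := S.H.mkQ_surjective q
    rw [← map_smul, lieQ_mkQ, VF.lie_smul, map_add, map_smul, map_smul, lieQ_mkQ]
  σ_smul a b := by
    change (Z : VF m M) (a * b) = _
    rw [Derivation.leibniz]
    simp [smul_eq_mul, mul_comm]

theorem br_add_left (Z W X : S.H) : S.br (Z + W) X = S.br Z X + S.br W X :=
  Subtype.ext (VF.add_lie _ _ _)

/-- The Lie derivative along `Z` on `(p,r)`-forms. -/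
def lieDataH (p : ℕ) (Z : S.H) :
    LieData (Smooth m M) S.H ((VF m M ⧸ S.H) [⋀^Fin p]→ₗ[Smooth m M] Smooth m M) where
  D := (Z : VF m M)
  τ := AddMonoidHom.mk' (S.br Z) fun _ _ => Subtype.ext (VF.lie_add _ _ _)
  σ := (S.lieDataQ Z).lieHom p
  τ_smul _ _ := Subtype.ext (VF.lie_smul _ _ _)
  σ_smul a w := (S.lieDataQ Z).lie_smul a w

/-- The Lie-Rinehart algebra of `H_{0,1}M` acting on the forms on `T_ℂM / H_{0,1}M`. -/
def lieRinehart (p : ℕ) :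
    LieRinehart (Smooth m M) S.H ((VF m M ⧸ S.H) [⋀^Fin p]→ₗ[Smooth m M] Smooth m M) where
  T := S.lieDataH p
  τ_add Z W q := S.br_add_left Z W q
  σ_add Z W w := by
    have h : ∀ q, S.lieQ (Z + W) q = S.lieQ Z q + S.lieQ W q := fun q => by
      obtain ⟨X, rfl⟩ := S.H.mkQ_surjective q
      simp only [lieQ_mkQ, ← map_add, ← VF.add_lie]; rfl
    ext1 v
    change (Z + W : VF m M) (w v) - ∑ j, w (Function.update v j (S.lieQ (Z + W) (v j)))
      = ((Z : VF m M) (w v) - ∑ j, w (Function.update v j (S.lieQ Z (v j))))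
        + ((W : VF m M) (w v) - ∑ j, w (Function.update v j (S.lieQ W (v j))))
    simp only [h, w.map_update_add, Finset.sum_add_distrib, Derivation.add_apply]
    ring
  -- `⁅a • Z, X⁆` and `a • ⁅Z, X⁆` differ by a multiple of `Z`, which dies modulo `H_{0,1}M`: the
  -- brackets define a flat partial connection on the quotient.
  σ_smul_left a Z w := by
    have h : ∀ q, S.lieQ (a • Z) q = a • S.lieQ Z q := fun q => by
      obtain ⟨X, rfl⟩ := S.H.mkQ_surjective q
      simp only [lieQ_mkQ, ← map_smul]
      rw [← sub_eq_zero, ← map_sub, Submodule.mkQ_apply, Submodule.Quotient.mk_eq_zero]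
      change ⁅a • (Z : VF m M), X⁆ - a • ⁅(Z : VF m M), X⁆ ∈ S.H
      rw [VF.smul_lie, sub_sub_cancel_left]
      exact S.H.neg_mem (S.H.smul_mem _ Z.2)
    ext1 v
    change (a • Z : VF m M) (w v) - ∑ j, w (Function.update v j (S.lieQ (a • Z) (v j)))
      = a • ((Z : VF m M) (w v) - ∑ j, w (Function.update v j (S.lieQ Z (v j))))
    simp only [h, w.map_update_smul, smul_sub, Finset.smul_sum, Derivation.smul_apply]
  τ_self Z := Subtype.ext (VF.lie_self _)
  τ_τ Z W q := Subtype.ext (VF.lie_lie _ _ _)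
  σ_τ Z W w := by
    refine LieData.lie_commutator (S.lieDataQ Z) (S.lieDataQ W) (S.lieDataQ (S.br Z W)) ?_ ?_ w
    · intro q
      obtain ⟨X, rfl⟩ := S.H.mkQ_surjective q
      change S.lieQ _ _ = S.lieQ _ (S.lieQ _ _) - S.lieQ _ (S.lieQ _ _)
      simp only [lieQ_mkQ, ← map_sub]
      exact congrArg _ (VF.lie_lie _ _ _)
    · intro a
      exact Derivation.commutator_apply _

/-- The tangential Cauchy-Riemann operator on smooth forms. -/
def dForm {p r : ℕ} (f : Form S p r (Smooth m M)) : Form S p (r + 1) (Smooth m M) :=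
  (S.lieRinehart p).d f

theorem dForm_ev {p r : ℕ} (f : Form S p r (Smooth m M)) (Z : Fin (r + 1) → S.H)
    (X : Fin p → VF m M) : (S.dForm f).ev Z X = dbar (fun Y a => Y a) f Z X := by
  rw [Form.ev, dForm, LieRinehart.d_apply, LieRinehart.dVal, dbar, alternatingMap_sum_apply]
  refine Finset.sum_congr rfl fun i _ => ?_
  rw [AlternatingMap.smul_apply, AlternatingMap.sub_apply, alternatingMap_sum_apply]
  congr 1
  have h1 : ((S.lieRinehart p).T (Z i)).σ (f (i.removeNth Z)) (fun j => S.H.mkQ (X j))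
      = (Z i : VF m M) (f.ev (i.removeNth Z) X)
        - ∑ j : Fin p, f.ev (i.removeNth Z) (Function.update X j ⁅(Z i : VF m M), X j⁆) := by
    change (Z i : VF m M) (f (i.removeNth Z) _) - ∑ j, f (i.removeNth Z) (Function.update _ j _)
      = _
    congr 1
    refine Finset.sum_congr rfl fun j _ => ?_
    rw [Form.ev]
    congr 1
    ext1 k
    rcases eq_or_ne k j with rfl | h
    · simp only [Function.update_self]; rfl
    · simp only [Function.update_of_ne h]
  rw [h1, sub_right_comm]
  congr 2
  refine Finset.sum_congr rfl fun j _ => ?_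
  split_ifs
  · rfl
  · rfl

theorem dForm_dForm {p r : ℕ} (f : Form S p r (Smooth m M)) : S.dForm (S.dForm f) = 0 :=
  (S.lieRinehart p).d_d f

theorem dForm_add {p r : ℕ} (f g : Form S p r (Smooth m M)) :
    S.dForm (f + g) = S.dForm f + S.dForm g := (S.lieRinehart p).d_add f g

end CRStructure

theorem Form.ext_ev {S : CRStructure m M d} {p r : ℕ} {N : Type*} [AddCommGroup N]
    [Module (Smooth m M) N] {f g : Form S p r N} (h : ∀ Z X, f.ev Z X = g.ev Z X) : f = g := by
  refine AlternatingMap.ext fun Z => AlternatingMap.ext fun X => ?_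
  choose Y hY using fun j => S.H.mkQ_surjective (X j)
  obtain rfl : (fun j => S.H.mkQ (Y j)) = X := funext hY
  exact h Z Y

theorem isClosedForm_iff {S : CRStructure m M d} {p r : ℕ} (f : Form S p r (Smooth m M)) :
    IsClosedForm f ↔ S.dForm f = 0 := by
  refine ⟨fun h => Form.ext_ev fun Z X => ?_, fun h Z X => ?_⟩
  · rw [S.dForm_ev, h Z X]; rfl
  · rw [← S.dForm_ev, h]; rfl

theorem cohomologyVanishes_succ_iff (S : CRStructure m M d) (p r : ℕ) :
    CohomologyVanishes S p (r + 1) ↔ ∀ f : Form S p (r + 1) (Smooth m M), S.dForm f = 0 →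
      ∃ u : Form S p r (Smooth m M), S.dForm u = f := by
  simp only [CohomologyVanishes, isClosedForm_iff]
  refine forall₂_congr fun f _ => exists_congr fun u => ⟨fun h => Form.ext_ev fun Z X => ?_, ?_⟩
  · rw [S.dForm_ev, h]
  · rintro rfl Z X; rw [S.dForm_ev]

end TangentialComplex

/-! ### Transport of the perturbed complex to the forms of the original structure. -/

section Pullback

variable {m : ℕ} {M : Type*} [TopologicalSpace M] [ChartedSpace (EuclideanSpace ℝ (Fin m)) M]
  {d : ℕ}

/-- Transport of forms along a linear automorphism of the vector fields which maps one CR structure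
to another. -/
def Form.transport {S S' : CRStructure m M d} (ψ : VF m M ≃ₗ[Smooth m M] VF m M)
    (h : S.H.map (ψ : VF m M →ₗ[Smooth m M] VF m M) = S'.H) (p r : ℕ) :
    Form S p r (Smooth m M) ≃ₗ[Smooth m M] Form S' p r (Smooth m M) where
  toFun f := ((AlternatingMap.domLCongr (Smooth m M) (Smooth m M) (Fin p) (Smooth m M)
    (Submodule.Quotient.equiv S.H S'.H ψ h)).toLinearMap.compAlternatingMap f).compLinearMap
      (ψ.ofSubmodules S.H S'.H h).symm
  invFun f := ((AlternatingMap.domLCongr (Smooth m M) (Smooth m M) (Fin p) (Smooth m M)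
    (Submodule.Quotient.equiv S.H S'.H ψ h)).symm.toLinearMap.compAlternatingMap f).compLinearMap
      (ψ.ofSubmodules S.H S'.H h)
  left_inv f := AlternatingMap.ext fun Z =>
    (LinearEquiv.symm_apply_apply (AlternatingMap.domLCongr (Smooth m M) (Smooth m M) (Fin p)
      (Smooth m M) (Submodule.Quotient.equiv S.H S'.H ψ h)) _).trans (congrArg f
        (funext fun _ => LinearEquiv.symm_apply_apply _ _))
  right_inv f := AlternatingMap.ext fun Z =>
    (LinearEquiv.apply_symm_apply (AlternatingMap.domLCongr (Smooth m M) (Smooth m M) (Fin p)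
      (Smooth m M) (Submodule.Quotient.equiv S.H S'.H ψ h)) _).trans (congrArg f
        (funext fun _ => LinearEquiv.apply_symm_apply _ _))
  map_add' f g := AlternatingMap.ext fun Z => by simp
  map_smul' a f := AlternatingMap.ext fun Z => by simp

theorem Form.transport_symm_ev {S S' : CRStructure m M d} (ψ : VF m M ≃ₗ[Smooth m M] VF m M)
    (h : S.H.map (ψ : VF m M →ₗ[Smooth m M] VF m M) = S'.H) {p r : ℕ}
    (f : Form S' p r (Smooth m M)) (Z : Fin r → S.H) (X : Fin p → VF m M) :
    Form.ev ((Form.transport ψ h p r).symm f) Z X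
      = f.ev (fun i => ψ.ofSubmodules S.H S'.H h (Z i)) (fun j => ψ (X j)) := rfl

theorem Form.transport_ev {S S' : CRStructure m M d} (ψ : VF m M ≃ₗ[Smooth m M] VF m M)
    (h : S.H.map (ψ : VF m M →ₗ[Smooth m M] VF m M) = S'.H) {p r : ℕ}
    (f : Form S p r (Smooth m M)) (Z : Fin r → S'.H) (X : Fin p → VF m M) :
    Form.ev (Form.transport ψ h p r f) Z X
      = f.ev (fun i => (ψ.ofSubmodules S.H S'.H h).symm (Z i)) (fun j => ψ.symm (X j)) := rfl

variable {S S' : CRStructure m M d} (ψ : VF m M ≃ₗ[Smooth m M] VF m M)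
    (h : S.H.map (ψ : VF m M →ₗ[Smooth m M] VF m M) = S'.H) {p r : ℕ}

/-- The tangential Cauchy-Riemann operator of `S'` acting on forms of `S`. -/
def pulledD (f : Form S p r (Smooth m M)) : Form S p (r + 1) (Smooth m M) :=
  (Form.transport ψ h p (r + 1)).symm (S'.dForm (Form.transport ψ h p r f))

theorem pulledD_pulledD (f : Form S p r (Smooth m M)) : pulledD ψ h (pulledD ψ h f) = 0 := by
  simp only [pulledD, LinearEquiv.apply_symm_apply, S'.dForm_dForm, map_zero]

theorem pulledD_add (f g : Form S p r (Smooth m M)) :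
    pulledD ψ h (f + g) = pulledD ψ h f + pulledD ψ h g := by
  simp only [pulledD, map_add, S'.dForm_add]

/-- The difference of the two tangential Cauchy-Riemann operators. -/
def pertOp (f : Form S p r (Smooth m M)) : Form S p (r + 1) (Smooth m M) :=
  pulledD ψ h f - S.dForm f

/-- The change of the bracket under `ψ`. -/
def brDiff (Z X : VF m M) : VF m M := ψ.symm ⁅ψ Z, ψ X⁆ - ⁅Z, X⁆

-- Both structures are closed under brackets, so the change of the bracket can be inserted in the
-- `H_{0,1}M` slots of a form.
include h in
theorem brDiff_mem (Z W : S.H) : brDiff ψ Z W ∈ S.H := by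
  refine S.H.sub_mem ?_ (S.lie_mem _ Z.2 _ W.2)
  have key : ∀ V ∈ S'.H, ψ.symm V ∈ S.H := by
    rw [← h]
    rintro _ ⟨V, hV, rfl⟩
    simpa using hV
  exact key _ (S'.lie_mem _ (h ▸ Submodule.mem_map_of_mem Z.2) _
    (h ▸ Submodule.mem_map_of_mem W.2))

theorem Form.ev_update_left_add {N : Type*} [AddCommGroup N] [Module (Smooth m M) N]
    (f : Form S p r N) (Z : Fin r → S.H) (X : Fin p → VF m M) (j : Fin r) (V W : S.H) :
    f.ev (Function.update Z j (V + W)) X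
      = f.ev (Function.update Z j V) X + f.ev (Function.update Z j W) X := by
  simp only [Form.ev, f.map_update_add, AlternatingMap.add_apply]

theorem mkQ_update (X : Fin p → VF m M) (j : Fin p) (V : VF m M) :
    (fun i => S.H.mkQ (Function.update X j V i))
      = Function.update (fun i => S.H.mkQ (X i)) j (S.H.mkQ V) := by
  ext1 k
  rcases eq_or_ne k j with rfl | h
  · simp only [Function.update_self]
  · simp only [Function.update_of_ne h]

theorem Form.ev_update_right_add {N : Type*} [AddCommGroup N] [Module (Smooth m M) N]
    (f : Form S p r N) (Z : Fin r → S.H) (X : Fin p → VF m M) (j : Fin p) (V W : VF m M) :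
    f.ev Z (Function.update X j (V + W))
      = f.ev Z (Function.update X j V) + f.ev Z (Function.update X j W) := by
  simp only [Form.ev, mkQ_update, map_add, (f Z).map_update_add]

/-- Separates the only term that differentiates `f`, along `ψ Z - Z`, from the terms of order zero,
in which only brackets change. The two kinds are estimated differently. -/
theorem pertOp_ev (f : Form S p r (Smooth m M)) (Z : Fin (r + 1) → S.H) (X : Fin p → VF m M) :
    (pertOp ψ h f).ev Z X = ∑ i : Fin (r + 1), (-1 : ℤ) ^ (i : ℕ) •
    ((ψ (Z i) - Z i) (f.ev (i.removeNth Z) X)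
      - (∑ j : Fin r, if i ≤ j.castSucc then
          f.ev (Function.update (i.removeNth Z) j
            ⟨brDiff ψ (Z i) (i.removeNth Z j), brDiff_mem ψ h _ _⟩) X else 0)
      - ∑ j : Fin p, f.ev (i.removeNth Z) (Function.update X j (brDiff ψ (Z i) (X j)))) := by
  have h1 : (pertOp ψ h f).ev Z X = (pulledD ψ h f).ev Z X - (S.dForm f).ev Z X := rfl
  rw [h1, pulledD, Form.transport_symm_ev, S'.dForm_ev, S.dForm_ev, dbar, dbar,
    ← Finset.sum_sub_distrib]
  refine Finset.sum_congr rfl fun i _ => ?_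
  rw [← smul_sub]
  congr 1
  set e := ψ.ofSubmodules S.H S'.H h with he
  have a1 : (Form.transport ψ h p r f).ev (i.removeNth fun i => e (Z i)) (fun j => ψ (X j))
      = f.ev (i.removeNth Z) X := by
    rw [Form.transport_ev]
    congr 1
    · ext1 k; exact e.symm_apply_apply _
    · ext1 k; exact ψ.symm_apply_apply _
  have a2 : ∀ j V, (Form.transport ψ h p r f).ev
      (Function.update (i.removeNth fun i => e (Z i)) j V) (fun j => ψ (X j))
      = f.ev (Function.update (i.removeNth Z) j (e.symm V)) X := by
    intro j V
    rw [Form.transport_ev]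
    congr 1
    · ext1 k
      rcases eq_or_ne k j with rfl | hk
      · simp only [Function.update_self]; rfl
      · simp only [Function.update_of_ne hk]; exact e.symm_apply_apply _
    · ext1 k; exact ψ.symm_apply_apply _
  have a3 : ∀ j V, (Form.transport ψ h p r f).ev (i.removeNth fun i => e (Z i))
      (Function.update (fun j => ψ (X j)) j V)
      = f.ev (i.removeNth Z) (Function.update X j (ψ.symm V)) := by
    intro j V
    rw [Form.transport_ev]
    congr 1
    · ext1 k; exact e.symm_apply_apply _
    · ext1 k
      rcases eq_or_ne k j with rfl | hk
      · simp only [Function.update_self]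
      · simp only [Function.update_of_ne hk]; exact ψ.symm_apply_apply _
  rw [a1]
  simp only [a2, a3]
  have b2 : ∀ j, f.ev (Function.update (i.removeNth Z) j
        (e.symm (S'.br (e (Z i)) ((i.removeNth fun i => e (Z i)) j)))) X
      = f.ev (Function.update (i.removeNth Z) j (S.br (Z i) (i.removeNth Z j))) X
      + f.ev (Function.update (i.removeNth Z) j
          ⟨brDiff ψ (Z i) (i.removeNth Z j), brDiff_mem ψ h _ _⟩) X := by
    intro j
    rw [← Form.ev_update_left_add]
    congr 2
    refine Subtype.ext ?_
    change ψ.symm ⁅ψ (Z i), ψ _⁆ = ⁅(Z i : VF m M), _⁆ + (ψ.symm ⁅ψ (Z i), ψ _⁆ - ⁅(Z i : VF m M), _⁆)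
    exact (add_sub_cancel _ _).symm
  have b3 : ∀ j, f.ev (i.removeNth Z) (Function.update X j (ψ.symm ⁅(e (Z i) : VF m M), ψ (X j)⁆))
      = f.ev (i.removeNth Z) (Function.update X j ⁅(Z i : VF m M), X j⁆)
      + f.ev (i.removeNth Z) (Function.update X j (brDiff ψ (Z i) (X j))) := by
    intro j
    rw [← Form.ev_update_right_add]
    congr 2
    exact (add_sub_cancel _ _).symm
  simp only [b2, b3, Finset.sum_add_distrib, Derivation.sub_apply]
  have c2 : ∀ (P : Prop) [Decidable P] (x y : Smooth m M),
      (if P then x + y else 0) = (if P then x else 0) + (if P then y else 0) := by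
    intro P _ x y; split_ifs <;> simp
  simp only [c2, Finset.sum_add_distrib]
  have : (e (Z i) : VF m M) = ψ (Z i) := rfl
  rw [this]
  abel

end Pullback

/-! ### The automorphism attached to a horizontal perturbation. -/

section Horizontal

variable {m : ℕ} {M : Type*} [TopologicalSpace M] [ChartedSpace (EuclideanSpace ℝ (Fin m)) M]
  {d : ℕ} (S : CRStructure m M d)

/-- Project along `H_{1,0}M ⊕ K`. Vanishing on `H_{1,0}M` is what makes the extension of `Φ` square
to zero. -/
theorem CRStructure.exists_projH : ∃ π : VF m M →ₗ[Smooth m M] S.H,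
    (∀ Z : S.H, π Z = Z) ∧ ∀ W ∈ conjSub S.H, π W = 0 := by
  obtain ⟨K, hK⟩ := S.exists_isCompl
  have h := S.disjoint_conj.isCompl_sup_right_of_isCompl_sup_left hK
  refine ⟨Submodule.projectionOnto _ _ h, fun Z => Submodule.projectionOnto_apply_left h Z,
    fun W hW => ?_⟩
  exact (Submodule.projectionOnto_apply_eq_zero_iff h).2 (le_sup_left (a := conjSub S.H) hW)

theorem CRStructure.exists_projBar : ∃ π : VF m M →ₗ[Smooth m M] conjSub S.H,
    ∀ W : conjSub S.H, π W = W := by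
  obtain ⟨K, hK⟩ := S.exists_isCompl
  rw [sup_comm] at hK
  have h := S.disjoint_conj.symm.isCompl_sup_right_of_isCompl_sup_left hK
  exact ⟨Submodule.projectionOnto _ _ h, fun Z => Submodule.projectionOnto_apply_left h Z⟩

/-- A projection of the vector fields to `H_{0,1}M`, zero on `H_{1,0}M`. -/
def CRStructure.projH : VF m M →ₗ[Smooth m M] S.H := S.exists_projH.choose

theorem CRStructure.projH_coe (Z : S.H) : S.projH Z = Z := S.exists_projH.choose_spec.1 Z

theorem CRStructure.projH_bar (W : conjSub S.H) : S.projH W = 0 :=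
  S.exists_projH.choose_spec.2 W W.2

/-- A projection of the vector fields to `H_{1,0}M`. -/
def CRStructure.projBar : VF m M →ₗ[Smooth m M] conjSub S.H := S.exists_projBar.choose

theorem CRStructure.projBar_coe (W : conjSub S.H) : S.projBar W = W := S.exists_projBar.choose_spec W

variable {S}

/-- The extension of `Φ` to all vector fields. -/
def extΦ (Φ : S.H →ₗ[Smooth m M] conjSub S.H) : VF m M →ₗ[Smooth m M] VF m M :=
  (conjSub S.H).subtype ∘ₗ Φ ∘ₗ S.projH

theorem extΦ_apply (Φ : S.H →ₗ[Smooth m M] conjSub S.H) (X : VF m M) :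
    extΦ Φ X = Φ (S.projH X) := rfl

theorem extΦ_extΦ (Φ : S.H →ₗ[Smooth m M] conjSub S.H) (X : VF m M) : extΦ Φ (extΦ Φ X) = 0 := by
  rw [extΦ_apply, extΦ_apply, S.projH_bar, map_zero]; rfl

/-- The automorphism `X ↦ X - Φ X` of the vector fields. -/
def autΦ (Φ : S.H →ₗ[Smooth m M] conjSub S.H) : VF m M ≃ₗ[Smooth m M] VF m M where
  toLinearMap := LinearMap.id - extΦ Φ
  invFun X := X + extΦ Φ X
  left_inv X := by
    change X - extΦ Φ X + extΦ Φ (X - extΦ Φ X) = X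
    rw [map_sub, extΦ_extΦ]; abel
  right_inv X := by
    change X + extΦ Φ X - extΦ Φ (X + extΦ Φ X) = X
    rw [map_add, extΦ_extΦ]; abel

theorem autΦ_apply (Φ : S.H →ₗ[Smooth m M] conjSub S.H) (X : VF m M) :
    autΦ Φ X = X - extΦ Φ X := rfl

theorem autΦ_symm_apply (Φ : S.H →ₗ[Smooth m M] conjSub S.H) (X : VF m M) :
    (autΦ Φ).symm X = X + extΦ Φ X := rfl

theorem map_autΦ (Φ : S.H →ₗ[Smooth m M] conjSub S.H) :
    S.H.map (autΦ Φ : VF m M →ₗ[Smooth m M] VF m M) = graph S Φ := by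
  have key : ∀ Z : S.H, autΦ Φ Z = (S.H.subtype - (conjSub S.H).subtype ∘ₗ Φ) Z := fun Z => by
    rw [autΦ_apply, extΦ_apply, S.projH_coe]; rfl
  ext X
  constructor
  · rintro ⟨Z, hZ, rfl⟩
    exact ⟨⟨Z, hZ⟩, (key _).symm⟩
  · rintro ⟨Z, rfl⟩
    exact ⟨Z, Z.2, key Z⟩

/-- Since the inverse of `1 - Φ` is `1 + Φ`, the term `⁅Z, X⁆` cancels and every remaining term
contains `Φ`; this is why the change of the bracket is small with `Φ`. -/
theorem brDiff_autΦ (Φ : S.H →ₗ[Smooth m M] conjSub S.H) (Z X : VF m M) :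
    brDiff (autΦ Φ) Z X = (extΦ Φ ⁅Z, X⁆ - ⁅Z, extΦ Φ X⁆ - ⁅extΦ Φ Z, X⁆ + ⁅extΦ Φ Z, extΦ Φ X⁆)
      + extΦ Φ (⁅extΦ Φ Z, extΦ Φ X⁆ - ⁅Z, extΦ Φ X⁆ - ⁅extΦ Φ Z, X⁆) := by
  have h : ∀ N N' : VF m M, ⁅Z - N, X - N'⁆ = ⁅Z, X⁆ - ⁅Z, N'⁆ - ⁅N, X⁆ + ⁅N, N'⁆ := by
    intro N N'
    ext1 b
    simp only [Derivation.commutator_apply, Derivation.sub_apply, Derivation.add_apply, map_sub]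
    ring
  rw [brDiff, autΦ_symm_apply, autΦ_apply, autΦ_apply, h]
  simp only [map_add, map_sub]
  abel

end Horizontal

/-! ### Smooth functions as continuous functions and as almost everywhere classes; weak derivatives.
-/

section SmoothToContinuous

variable {m : ℕ} {M : Type*} [TopologicalSpace M] [ChartedSpace (EuclideanSpace ℝ (Fin m)) M]

/-- A smooth function as a continuous function. -/
def Smooth.toC (a : Smooth m M) : C(M, ℂ) := ⟨a, a.contMDiff.continuous⟩

@[simp]
theorem Smooth.toC_apply (a : Smooth m M) (x : M) : a.toC x = a x := rfl

theorem Smooth.toC_sum {ι : Type*} (s : Finset ι) (a : ι → Smooth m M) :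
    (∑ i ∈ s, a i).toC = ∑ i ∈ s, (a i).toC :=
  map_sum (AddMonoidHom.mk' (Smooth.toC : Smooth m M → C(M, ℂ)) fun _ _ => rfl) a s

theorem VF.sum_apply {ι : Type*} (s : Finset ι) (Y : ι → VF m M) (a : Smooth m M) :
    (∑ i ∈ s, Y i) a = ∑ i ∈ s, Y i a :=
  map_sum (AddMonoidHom.mk' (fun Y : VF m M => Y a) fun _ _ => rfl) Y s

end SmoothToContinuous

section SmoothClasses

variable {m : ℕ} {M : Type*} [TopologicalSpace M] [ChartedSpace (EuclideanSpace ℝ (Fin m)) M]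
  [MeasurableSpace M] [BorelSpace M] {μ : Measure M}

theorem toAE_add (a b : Smooth m M) : toAE μ (a + b) = toAE μ a + toAE μ b := by
  simp only [toAE, AEEqFun.mk_add_mk]; congr 1

theorem smul_toAE (a b : Smooth m M) : a • toAE μ b = toAE μ (a * b) := by
  change toAE μ a * toAE μ b = _
  simp only [toAE, AEEqFun.mk_mul_mk]; congr 1

/-- Smooth functions as almost everywhere classes, as a linear map. -/
def toAELin (μ : Measure M) : Smooth m M →ₗ[Smooth m M] (M →ₘ[μ] ℂ) where
  toFun := toAE μ
  map_add' := toAE_add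
  map_smul' a b := (smul_toAE a b).symm

theorem toAE_sub (a b : Smooth m M) : toAE μ (a - b) = toAE μ a - toAE μ b :=
  map_sub (toAELin μ) a b

theorem toAE_zero : toAE μ (0 : Smooth m M) = 0 := map_zero (toAELin μ)

theorem coeFn_toAE (a : Smooth m M) : toAE μ a =ᵐ[μ] a := AEEqFun.coeFn_mk _ _

theorem toAE_injective [μ.IsOpenPosMeasure] {a b : Smooth m M} (h : toAE μ a = toAE μ b) : a = b := by
  have h' : (a : M → ℂ) =ᵐ[μ] b := AEEqFun.mk_eq_mk.1 h
  ext x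
  exact congrFun ((a.contMDiff.continuous.ae_eq_iff_eq μ b.contMDiff.continuous).1 h') x

variable [CompactSpace M]

theorem integrable_mul_continuous {f : M → ℂ} (hf : Integrable f μ) (φ : C(M, ℂ)) :
    Integrable (fun x => f x * φ x) μ :=
  hf.mul_bdd (c := ‖φ‖) φ.continuous.aestronglyMeasurable
    (Filter.Eventually.of_forall fun x => φ.norm_coe_le_norm x)

theorem integrable_toAE [IsFiniteMeasure μ] (a : Smooth m M) : Integrable (toAE μ a) μ := by
  refine Integrable.congr ?_ (coeFn_toAE a).symm
  have := integrable_mul_continuous (μ := μ) (integrable_const (1 : ℂ)) a.toC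
  simpa using this

theorem norm_integral_mul_le {f : M → ℂ} (hf : Integrable f μ) (φ : C(M, ℂ)) :
    ‖∫ x, f x * φ x ∂μ‖ ≤ ‖φ‖ * ∫ x, ‖f x‖ ∂μ := by
  rw [← integral_const_mul]
  refine norm_integral_le_of_norm_le (hf.norm.const_mul _) (Filter.Eventually.of_forall fun x => ?_)
  rw [norm_mul, mul_comm]
  exact mul_le_mul_of_nonneg_right (φ.norm_coe_le_norm x) (norm_nonneg _)

variable [IsManifold (𝓡 m) ∞ M] [T2Space M]

theorem ae_eq_of_integral_smooth {f g : M → ℂ} (hf : Integrable f μ) (hg : Integrable g μ)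
    (h : ∀ φ : Smooth m M, ∫ x, f x * φ x ∂μ = ∫ x, g x * φ x ∂μ) : f =ᵐ[μ] g := by
  refine ae_eq_of_integral_contMDiff_smul_eq (𝓡 m) hf.locallyIntegrable hg.locallyIntegrable ?_
  intro φ hφ _
  let φ' : Smooth m M := ⟨fun x => (φ x : ℂ), Complex.ofRealCLM.contDiff.contMDiff.comp hφ⟩
  have e : ∀ x, φ' x = (φ x : ℂ) := fun x => rfl
  simpa only [e, mul_comm, Complex.real_smul] using h φ'

/-- `IsWeakDeriv` carries its own divergence. Uniqueness lets two weak derivatives be compared or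
added. -/
theorem IsDivergence.eq [IsFiniteMeasure μ] [μ.IsOpenPosMeasure] {Y : VF m M} {δ δ' : Smooth m M}
    (h : IsDivergence μ Y δ) (h' : IsDivergence μ Y δ') : δ = δ' := by
  refine toAE_injective (μ := μ) (AEEqFun.ext ?_)
  have : ∀ a φ : Smooth m M, ∫ x, toAE μ a x * φ x ∂μ = ∫ x, a x * φ x ∂μ := fun a φ =>
    integral_congr_ae ((coeFn_toAE a).mono fun x hx => by simp only [hx])
  refine ae_eq_of_integral_smooth (m := m) (integrable_toAE _) (integrable_toAE _) fun φ => ?_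
  rw [this, this]
  have := (h φ).symm.trans (h' φ)
  exact neg_injective this

theorem IsWeakDeriv.eq [IsFiniteMeasure μ] [μ.IsOpenPosMeasure] {Y : VF m M} {f g g' : M →ₘ[μ] ℂ}
    (h : IsWeakDeriv Y f g) (h' : IsWeakDeriv Y f g') : g = g' := by
  obtain ⟨-, hg, δ, hδ, H⟩ := h
  obtain ⟨-, hg', δ', hδ', H'⟩ := h'
  obtain rfl := hδ.eq hδ'
  exact AEEqFun.ext (ae_eq_of_integral_smooth hg hg' fun φ => by rw [H, H'])

theorem isWeakDeriv_toAE [IsFiniteMeasure μ] (hμ : HasSmoothDivergence m μ) (Y : VF m M)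
    (a : Smooth m M) : IsWeakDeriv Y (toAE μ a) (toAE μ (Y a)) := by
  obtain ⟨δ, hδ⟩ := hμ Y
  refine ⟨integrable_toAE _, integrable_toAE _, δ, hδ, fun φ => ?_⟩
  have e1 : ∫ x, toAE μ (Y a) x * φ x ∂μ = ∫ x, Y a x * φ x ∂μ :=
    integral_congr_ae ((coeFn_toAE (Y a)).mono fun x hx => by simp only [hx])
  have e2 : ∫ x, toAE μ a x * (Y φ x + δ x * φ x) ∂μ = ∫ x, a x * (Y φ x + δ x * φ x) ∂μ :=
    integral_congr_ae ((coeFn_toAE a).mono fun x hx => by simp only [hx])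
  have int : ∀ b : Smooth m M, Integrable (fun x => b x) μ := fun b =>
    (integrable_toAE b).congr (coeFn_toAE b)
  -- Integration by parts: the divergence identity for the product, expanded by the Leibniz rule.
  have h := hδ (a * φ)
  have i1 : Integrable (fun x => Y a x * φ x) μ := int (Y a * φ)
  have i2 : Integrable (fun x => a x * (Y φ x + δ x * φ x)) μ := int (a * (Y φ + δ * φ))
  have i3 : Integrable (fun x => δ x * (a * φ) x) μ := int (δ * (a * φ))
  rw [eq_neg_iff_add_eq_zero, ← integral_add (int (Y (a * φ))) i3] at h
  rw [e1, e2, eq_neg_iff_add_eq_zero, ← integral_add i1 i2, ← h]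
  congr 1
  ext x
  simp only [Derivation.leibniz, smul_eq_mul, ContMDiffMap.coe_add, ContMDiffMap.coe_mul,
    Pi.add_apply, Pi.mul_apply]
  ring

theorem weakDeriv_eq [IsFiniteMeasure μ] [μ.IsOpenPosMeasure] {Y : VF m M} {f g : M →ₘ[μ] ℂ}
    (h : IsWeakDeriv Y f g) : weakDeriv Y f = g := by
  have hex : ∃ g, IsWeakDeriv Y f g := ⟨g, h⟩
  rw [weakDeriv, dif_pos hex]
  exact hex.choose_spec.eq h

theorem weakDeriv_toAE [IsFiniteMeasure μ] [μ.IsOpenPosMeasure] (hμ : HasSmoothDivergence m μ)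
    (Y : VF m M) (a : Smooth m M) : weakDeriv Y (toAE μ a) = toAE μ (Y a) :=
  weakDeriv_eq (isWeakDeriv_toAE hμ Y a)

end SmoothClasses

/-! ### Banach function spaces as normed spaces, and the closed graph theorem. -/

namespace BanachFunctionSpace

variable {M : Type*} [MeasurableSpace M] {μ : Measure M} (B : BanachFunctionSpace μ)

theorem nrm_zero : B.nrm 0 = 0 := by
  have h : (0 : ℂ) • (0 : M →ₘ[μ] ℂ) = 0 := zero_smul ℂ (0 : M →ₘ[μ] ℂ)
  have := B.nrm_smul 0 0 B.carrier.zero_mem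
  rwa [h, norm_zero, zero_mul] at this

theorem nrm_neg {f : M →ₘ[μ] ℂ} (hf : f ∈ B.carrier) : B.nrm (-f) = B.nrm f := by
  have h : (-1 : ℂ) • f = -f := neg_one_smul ℂ f
  have := B.nrm_smul (-1) f hf
  rwa [h, norm_neg, norm_one, one_mul] at this

theorem nrm_nonneg {f : M →ₘ[μ] ℂ} (hf : f ∈ B.carrier) : 0 ≤ B.nrm f := by
  have := B.nrm_add_le f hf (-f) (B.carrier.neg_mem hf)
  rw [add_neg_cancel, B.nrm_zero, B.nrm_neg hf] at this
  linarith

theorem eq_zero_of_nrm {f : M →ₘ[μ] ℂ} (hf : f ∈ B.carrier) (h : B.nrm f = 0) : f = 0 := by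
  obtain ⟨C, hC⟩ := B.exists_integral_le
  have h1 : ∫ x, ‖f x‖ ∂μ = 0 := le_antisymm (by simpa [h] using hC f hf)
    (integral_nonneg fun x => norm_nonneg _)
  rw [integral_eq_zero_iff_of_nonneg (fun x => norm_nonneg _) (B.integrable f hf).norm] at h1
  refine AEEqFun.ext ?_
  filter_upwards [h1, AEEqFun.coeFn_zero (β := ℂ) (μ := μ)] with x hx h0
  rw [h0]; simpa using hx

theorem nrm_sum_le {ι : Type*} (s : Finset ι) (f : ι → M →ₘ[μ] ℂ) (hf : ∀ i ∈ s, f i ∈ B.carrier) :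
    B.nrm (∑ i ∈ s, f i) ≤ ∑ i ∈ s, B.nrm (f i) := by
  classical
  induction s using Finset.induction_on with
  | empty => simp [B.nrm_zero]
  | insert i s hi ih =>
    rw [Finset.sum_insert hi, Finset.sum_insert hi]
    have h1 : ∀ j ∈ s, f j ∈ B.carrier := fun j hj => hf j (Finset.mem_insert_of_mem hj)
    have h2 := B.nrm_add_le (f i) (hf i (Finset.mem_insert_self i s)) _ (B.carrier.sum_mem h1)
    have h3 := ih h1
    linarith

theorem aeEqFun_mul_add (u f f' : M →ₘ[μ] ℂ) : u * (f + f') = u * f + u * f' :=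
  AEEqFun.induction_on₃ u f f' fun u _ f _ f' _ => by
    simp only [AEEqFun.mk_mul_mk, AEEqFun.mk_add_mk]; congr 1; ext x; simp [mul_add]

theorem aeEqFun_mul_smul (c : ℂ) (u f : M →ₘ[μ] ℂ) : u * (c • f) = c • (u * f) :=
  AEEqFun.induction_on₂ u f fun u _ f _ => by
    simp only [AEEqFun.mk_mul_mk, AEEqFun.smul_mk]; congr 1; ext x; simp [mul_left_comm]

/-- The Banach space of a Banach function space. -/
def Space : Type _ := B.carrier

instance : AddCommGroup B.Space := inferInstanceAs (AddCommGroup B.carrier)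

instance : Module ℂ B.Space := inferInstanceAs (Module ℂ B.carrier)

/-- The class of an element. -/
def Space.val {B : BanachFunctionSpace μ} : B.Space →ₗ[ℂ] (M →ₘ[μ] ℂ) := B.carrier.subtype

/-- The element of the Banach space given by a class in the carrier. -/
def mkSpace (f : M →ₘ[μ] ℂ) (hf : f ∈ B.carrier) : B.Space := ⟨f, hf⟩

variable {B} in
theorem Space.mem (f : B.Space) : Space.val f ∈ B.carrier := Subtype.property f

variable {B} in
theorem Space.val_injective : Function.Injective (Space.val : B.Space →ₗ[ℂ] (M →ₘ[μ] ℂ)) :=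
  Subtype.val_injective

instance : Norm B.Space := ⟨fun f => B.nrm (Space.val f)⟩

theorem norm_def (f : B.Space) : ‖f‖ = B.nrm (Space.val f) := rfl

theorem core : NormedSpace.Core ℂ B.Space where
  norm_nonneg f := B.nrm_nonneg f.mem
  norm_smul c f := by rw [norm_def, map_smul]; exact B.nrm_smul c _ f.mem
  norm_triangle f g := by rw [norm_def, map_add]; exact B.nrm_add_le _ f.mem _ g.mem
  norm_eq_zero_iff f := by
    constructor
    · intro h
      exact Space.val_injective ((B.eq_zero_of_nrm f.mem h).trans (map_zero _).symm)
    · rintro rfl; rw [norm_def, map_zero, B.nrm_zero]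

instance : NormedAddCommGroup B.Space := NormedAddCommGroup.ofCore B.core

instance : NormedSpace ℂ B.Space := NormedSpace.ofCore B.core

instance : CompleteSpace B.Space := by
  refine Metric.complete_of_cauchySeq_tendsto fun u hu => ?_
  rw [Metric.cauchySeq_iff] at hu
  obtain ⟨f, hf, H⟩ := B.complete (fun i => Space.val (u i)) (fun i => (u i).mem) fun ε hε => by
    obtain ⟨N, hN⟩ := hu ε hε
    refine ⟨N, fun i hi j hj => ?_⟩
    have := hN i hi j hj
    rwa [dist_eq_norm, norm_def, map_sub] at this
  refine ⟨B.mkSpace f hf, Metric.tendsto_atTop.2 fun ε hε => ?_⟩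
  obtain ⟨N, hN⟩ := H ε hε
  refine ⟨N, fun i hi => ?_⟩
  rw [dist_eq_norm, norm_def, map_sub]
  exact hN i hi

variable [TopologicalSpace M] [BorelSpace M] [CompactSpace M]

/-- Integration against a continuous function. -/
def pair (φ : C(M, ℂ)) : B.Space →L[ℂ] ℂ :=
  LinearMap.mkContinuousOfExistsBound
    { toFun := fun f => ∫ x, Space.val f x * φ x ∂μ
      map_add' := fun f g => by
        rw [← integral_add (integrable_mul_continuous (B.integrable _ f.mem) φ)
          (integrable_mul_continuous (B.integrable _ g.mem) φ), map_add]
        refine integral_congr_ae ((AEEqFun.coeFn_add (Space.val f) (Space.val g)).mono fun x hx => ?_)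
        simp only [hx, Pi.add_apply, add_mul]
      map_smul' := fun c f => by
        rw [map_smul, RingHom.id_apply, smul_eq_mul, ← integral_const_mul]
        refine integral_congr_ae ((AEEqFun.coeFn_smul c (Space.val f)).mono fun x hx => ?_)
        simp only [hx, Pi.smul_apply, smul_eq_mul, mul_assoc] } <| by
    obtain ⟨C, hC⟩ := B.exists_integral_le
    refine ⟨‖φ‖ * C, fun f => (norm_integral_mul_le (B.integrable _ f.mem) φ).trans ?_⟩
    rw [mul_assoc]
    exact mul_le_mul_of_nonneg_left (hC _ f.mem) (norm_nonneg _)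

theorem pair_apply (φ : C(M, ℂ)) (f : B.Space) : B.pair φ f = ∫ x, Space.val f x * φ x ∂μ := rfl

variable {m : ℕ} [ChartedSpace (EuclideanSpace ℝ (Fin m)) M] [IsManifold (𝓡 m) ∞ M] [T2Space M]

variable {B} in
theorem Space.ext_pair (m : ℕ) [ChartedSpace (EuclideanSpace ℝ (Fin m)) M]
    [IsManifold (𝓡 m) ∞ M] {f g : B.Space}
    (h : ∀ φ : Smooth m M, B.pair φ.toC f = B.pair φ.toC g) : f = g :=
  Space.val_injective (AEEqFun.ext
    (ae_eq_of_integral_smooth (B.integrable _ f.mem) (B.integrable _ g.mem) h))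

/-- A linear map into a Banach function space whose pairings with smooth functions are continuous
is continuous. -/
theorem continuous_of_pair (m : ℕ) [ChartedSpace (EuclideanSpace ℝ (Fin m)) M]
    [IsManifold (𝓡 m) ∞ M] {E : Type*} [NormedAddCommGroup E] [NormedSpace ℂ E] [CompleteSpace E]
    (T : E →ₗ[ℂ] B.Space) (hT : ∀ φ : Smooth m M, Continuous fun f => B.pair φ.toC (T f)) :
    Continuous T := by
  -- The limit `y` of the images and `T x` have the same pairings with smooth functions, and these
  -- separate points; so the graph is closed.
  refine T.continuous_of_seq_closed_graph fun u x y hu hy => Space.ext_pair m fun φ => ?_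
  have h1 := ((hT φ).tendsto x).comp hu
  have h2 := ((B.pair φ.toC).continuous.tendsto y).comp hy
  exact tendsto_nhds_unique h2 h1

/-- A continuous linear map is bounded. -/
theorem exists_nrm_le {B B' : BanachFunctionSpace μ} (T : B.Space →ₗ[ℂ] B'.Space)
    (hT : Continuous T) :
    ∃ C : ℝ, 0 ≤ C ∧ ∀ f : B.Space, B'.nrm (Space.val (T f)) ≤ C * B.nrm (Space.val f) :=
  ⟨‖(⟨T, hT⟩ : B.Space →L[ℂ] B'.Space)‖, norm_nonneg _,
    fun f => (⟨T, hT⟩ : B.Space →L[ℂ] B'.Space).le_opNorm f⟩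

/-- The pairing with a fixed element as a functional on continuous functions. -/
def pairLeft (f : B.Space) : C(M, ℂ) →L[ℂ] ℂ :=
  LinearMap.mkContinuous
    { toFun := fun φ => B.pair φ f
      map_add' := fun φ ψ => by
        simp only [pair_apply]
        rw [← integral_add (integrable_mul_continuous (B.integrable _ f.mem) φ)
          (integrable_mul_continuous (B.integrable _ f.mem) ψ)]
        simp only [ContinuousMap.add_apply, mul_add]
      map_smul' := fun c φ => by
        simp only [pair_apply, RingHom.id_apply, smul_eq_mul]
        rw [← integral_const_mul]
        simp only [ContinuousMap.smul_apply, smul_eq_mul, mul_left_comm] }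
    (∫ x, ‖Space.val f x‖ ∂μ) fun φ => by
      rw [mul_comm]
      exact norm_integral_mul_le (B.integrable _ f.mem) φ

end BanachFunctionSpace

/-! ### Global vector fields that represent coordinate derivatives, and `C^k` limits. -/

section Coordinates

variable {m : ℕ} {M : Type*} [TopologicalSpace M] [ChartedSpace (EuclideanSpace ℝ (Fin m)) M]
  [IsManifold (𝓡 m) ∞ M]

theorem contDiffOn_comp_symm {n : ℕ∞ω} (hn : n ≤ ∞) {f : M → ℂ}
    (hf : ContMDiff (𝓡 m) 𝓘(ℝ, ℂ) n f) (x₀ : M) :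
    ContDiffOn ℝ n (f ∘ (extChartAt (𝓡 m) x₀).symm) (extChartAt (𝓡 m) x₀).target := by
  have : IsManifold (𝓡 m) n M := IsManifold.of_le hn
  rw [← contMDiffOn_iff_contDiffOn]
  exact hf.comp_contMDiffOn (contMDiffOn_extChartAt_symm x₀)

variable [T2Space M] {x₀ : M}

/-- The derivation `χ ∂_v`, for a bump function `χ` in a chart and a constant vector `v`. -/
def coordVF (χ : SmoothBumpFunction (𝓡 m) x₀) (v : EuclideanSpace ℝ (Fin m)) : VF m M :=
  have key : ∀ (a : Smooth m M) (x : M), x ∈ (chartAt (EuclideanSpace ℝ (Fin m)) x₀).source →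
      DifferentiableAt ℝ (a ∘ (extChartAt (𝓡 m) x₀).symm) (extChartAt (𝓡 m) x₀ x) := by
    intro a x hx
    have hx' : extChartAt (𝓡 m) x₀ x ∈ (extChartAt (𝓡 m) x₀).target :=
      (extChartAt (𝓡 m) x₀).map_source (by rwa [extChartAt_source])
    exact ((contDiffOn_comp_symm le_rfl a.contMDiff x₀).contDiffAt
      ((isOpen_extChartAt_target x₀).mem_nhds hx')).differentiableAt (by simp)
  have off : ∀ x : M, x ∉ (chartAt (EuclideanSpace ℝ (Fin m)) x₀).source → χ x = 0 := by
    intro x hx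
    by_contra h
    exact hx (χ.support_subset_source h)
  Derivation.mk'
    { toFun := fun a => ⟨fun x => χ x • fderiv ℝ (a ∘ (extChartAt (𝓡 m) x₀).symm)
          (extChartAt (𝓡 m) x₀ x) v, χ.contMDiff_smul (by
        have h := ((contDiffOn_comp_symm le_rfl a.contMDiff x₀).fderiv_of_isOpen
          (isOpen_extChartAt_target x₀) (m := ∞) (by simp)).clm_apply
            (contDiffOn_const (c := v))
        rw [← contMDiffOn_iff_contDiffOn] at h
        refine h.comp contMDiffOn_extChartAt fun x hx => ?_
        exact (extChartAt (𝓡 m) x₀).map_source (by rwa [extChartAt_source]))⟩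
      map_add' := fun a b => by
        ext x
        by_cases hx : x ∈ (chartAt (EuclideanSpace ℝ (Fin m)) x₀).source
        · change χ x • fderiv ℝ ((a ∘ (extChartAt (𝓡 m) x₀).symm) +
            (b ∘ (extChartAt (𝓡 m) x₀).symm)) (extChartAt (𝓡 m) x₀ x) v = χ x • _ + χ x • _
          rw [fderiv_add (key a x hx) (key b x hx), ← smul_add]; rfl
        · change χ x • (_ : ℂ) = χ x • (_ : ℂ) + χ x • (_ : ℂ)
          simp [off x hx]
      map_smul' := fun c a => by
        ext x
        by_cases hx : x ∈ (chartAt (EuclideanSpace ℝ (Fin m)) x₀).source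
        · change χ x • fderiv ℝ (c • (a ∘ (extChartAt (𝓡 m) x₀).symm)) (extChartAt (𝓡 m) x₀ x) v
            = c • (χ x • _)
          rw [fderiv_const_smul (key a x hx), smul_comm]; rfl
        · change χ x • (_ : ℂ) = c • (χ x • (_ : ℂ))
          simp [off x hx] }
    (fun a b => by
      ext x
      by_cases hx : x ∈ (chartAt (EuclideanSpace ℝ (Fin m)) x₀).source
      · have ha : a x = (a ∘ (extChartAt (𝓡 m) x₀).symm) (extChartAt (𝓡 m) x₀ x) := by
          rw [Function.comp_apply, (extChartAt (𝓡 m) x₀).left_inv (by rwa [extChartAt_source])]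
        have hb : b x = (b ∘ (extChartAt (𝓡 m) x₀).symm) (extChartAt (𝓡 m) x₀ x) := by
          rw [Function.comp_apply, (extChartAt (𝓡 m) x₀).left_inv (by rwa [extChartAt_source])]
        change χ x • fderiv ℝ ((a ∘ (extChartAt (𝓡 m) x₀).symm) *
          (b ∘ (extChartAt (𝓡 m) x₀).symm)) (extChartAt (𝓡 m) x₀ x) v
            = a x * (χ x • _) + b x * (χ x • _)
        rw [fderiv_mul (key a x hx) (key b x hx), ha, hb]
        simp only [add_apply, smul_apply, smul_eq_mul,
          Complex.real_smul]
        ring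
      · change χ x • _ = a x * (χ x • _) + b x * (χ x • _)
        simp [off x hx])

theorem coordVF_apply (χ : SmoothBumpFunction (𝓡 m) x₀) (v : EuclideanSpace ℝ (Fin m))
    (a : Smooth m M) (x : M) : coordVF χ v a x = χ x • fderiv ℝ (a ∘ (extChartAt (𝓡 m) x₀).symm)
      (extChartAt (𝓡 m) x₀ x) v := rfl

variable (x₀) in
/-- Near any point, the coordinate derivatives of smooth functions are given by global
derivations. -/
theorem exists_coordinate_frame : ∃ (U : Set (EuclideanSpace ℝ (Fin m))) (Y : Fin m → VF m M),
    IsOpen U ∧ extChartAt (𝓡 m) x₀ x₀ ∈ U ∧ U ⊆ (extChartAt (𝓡 m) x₀).target ∧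
    ∀ y ∈ U, ∀ a : Smooth m M, HasFDerivAt (a ∘ (extChartAt (𝓡 m) x₀).symm)
      (∑ j, (EuclideanSpace.proj j : EuclideanSpace ℝ (Fin m) →L[ℝ] ℝ).smulRight
        (Y j a ((extChartAt (𝓡 m) x₀).symm y))) y := by
  obtain ⟨χ⟩ : Nonempty (SmoothBumpFunction (𝓡 m) x₀) := inferInstance
  -- Where the cutoff equals `1`, the global field `χ ∂_j` is the coordinate derivative itself.
  have h1 : ∀ᶠ y in nhds (extChartAt (𝓡 m) x₀ x₀), χ ((extChartAt (𝓡 m) x₀).symm y) = 1 := by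
    have hc : Filter.Tendsto (extChartAt (𝓡 m) x₀).symm (nhds (extChartAt (𝓡 m) x₀ x₀))
        (nhds x₀) := by
      have := (continuousAt_extChartAt_symm (I := 𝓡 m) x₀).tendsto
      rwa [extChartAt_to_inv] at this
    exact hc.eventually χ.eventuallyEq_one
  have h2 : ∀ᶠ y in nhds (extChartAt (𝓡 m) x₀ x₀), y ∈ (extChartAt (𝓡 m) x₀).target :=
    (isOpen_extChartAt_target x₀).mem_nhds (mem_extChartAt_target x₀)
  obtain ⟨U, hU, hUo, hx⟩ := eventually_nhds_iff.1 (h1.and h2)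
  refine ⟨U, fun j => coordVF χ (EuclideanSpace.single j 1), hUo, hx, fun y hy => (hU y hy).2,
    fun y hy a => ?_⟩
  obtain ⟨hy1, hy2⟩ := hU y hy
  have hd : DifferentiableAt ℝ (a ∘ (extChartAt (𝓡 m) x₀).symm) y :=
    ((contDiffOn_comp_symm le_rfl a.contMDiff x₀).contDiffAt
      ((isOpen_extChartAt_target x₀).mem_nhds hy2)).differentiableAt (by simp)
  convert hd.hasFDerivAt using 1
  refine ContinuousLinearMap.ext fun v => ?_
  have hv : v = ∑ j, v j • (EuclideanSpace.single j (1 : ℝ)) := by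
    have := (EuclideanSpace.basisFun (Fin m) ℝ).sum_repr v
    simpa using this.symm
  conv_rhs => rw [hv, map_sum]
  rw [sum_apply]
  refine Finset.sum_congr rfl fun j _ => ?_
  rw [coordVF_apply, hy1, one_smul, (extChartAt (𝓡 m) x₀).right_inv hy2, map_smul]
  rfl

/-- The iterated derivative of a smooth function along a word in the fields `X`. -/
def wordAct {N : ℕ} (X : Fin N → VF m M) : List (Fin N) → Smooth m M → Smooth m M
  | [], a => a
  | i :: w, a => wordAct X w (X i a)

/-- Near each point the coordinate derivatives are combinations of the `X i` with smooth
coefficients. They therefore converge uniformly, the limit is differentiable, and its derivatives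
are `C^k` by induction. -/
theorem contMDiff_of_tendsto [CompactSpace M] {N : ℕ} (X : Fin N → VF m M)
    (ξ : Fin N → VF m M →ₗ[Smooth m M] Smooth m M) (hX : ∀ Y, ∑ i, ξ i Y • X i = Y) (k : ℕ)
    (a : ℕ → Smooth m M) (g : List (Fin N) → C(M, ℂ))
    (h : ∀ w : List (Fin N), w.length ≤ k →
      Filter.Tendsto (fun n => (wordAct X w (a n)).toC) Filter.atTop (nhds (g w))) :
    ContMDiff (𝓡 m) 𝓘(ℝ, ℂ) k (g []) := by
  induction k generalizing a g with
  | zero =>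
    have := (g []).continuous
    rwa [Nat.cast_zero, contMDiff_zero_iff]
  | succ k ih =>
    have hg : ∀ i, ContMDiff (𝓡 m) 𝓘(ℝ, ℂ) k (g [i]) := fun i =>
      ih (fun n => X i (a n)) (fun w => g (i :: w)) fun w hw => h (i :: w) (by simpa using hw)
    intro x₀
    obtain ⟨U, Y, hUo, hxU, hUt, hY⟩ := exists_coordinate_frame (m := m) x₀
    set φ := extChartAt (𝓡 m) x₀
    -- The candidate for the `j`-th coordinate derivative of the limit near `x₀`.
    let c : Fin m → C(M, ℂ) := fun j => ∑ i, (ξ i (Y j)).toC * g [i]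
    have hYa : ∀ j n, (Y j (a n)).toC = ∑ i, (ξ i (Y j)).toC * (X i (a n)).toC := by
      intro j n
      ext x
      conv_lhs => rw [← hX (Y j)]
      rw [VF.sum_apply, Smooth.toC_sum]
      simp
    have hlim : ∀ j, Filter.Tendsto (fun n => (Y j (a n)).toC) Filter.atTop (nhds (c j)) := by
      intro j
      simp only [hYa]
      exact tendsto_finsetSum _ fun i _ => tendsto_const_nhds.mul (h [i] (by simp))
    let f' : EuclideanSpace ℝ (Fin m) → EuclideanSpace ℝ (Fin m) →L[ℝ] ℂ := fun y =>
      ∑ j, (EuclideanSpace.proj j : EuclideanSpace ℝ (Fin m) →L[ℝ] ℝ).smulRight (c j (φ.symm y))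
    have hder : ∀ y ∈ U, HasFDerivAt (g [] ∘ φ.symm) (f' y) y := by
      intro y hy
      refine hasFDerivAt_of_tendstoUniformlyOn hUo (l := Filter.atTop)
        (f := fun n => a n ∘ φ.symm) (f' := fun n y => ∑ j,
          (EuclideanSpace.proj j : EuclideanSpace ℝ (Fin m) →L[ℝ] ℝ).smulRight
            (Y j (a n) (φ.symm y))) ?_ (fun n y hy => hY y hy (a n)) ?_ hy
      · have hb : Filter.Tendsto (fun n => ∑ j, ‖(EuclideanSpace.proj j :
            EuclideanSpace ℝ (Fin m) →L[ℝ] ℝ)‖ * ‖c j - (Y j (a n)).toC‖) Filter.atTop (nhds 0) := by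
          have : (0 : ℝ) = ∑ j : Fin m, ‖(EuclideanSpace.proj j :
            EuclideanSpace ℝ (Fin m) →L[ℝ] ℝ)‖ * 0 := by simp
          rw [this]
          refine tendsto_finsetSum _ fun j _ => tendsto_const_nhds.mul ?_
          have := (tendsto_const_nhds (x := c j)).sub (hlim j)
          simpa using this.norm
        rw [Metric.tendstoUniformlyOn_iff]
        intro ε hε
        filter_upwards [hb.eventually_lt_const hε] with n hn y _
        refine lt_of_le_of_lt ?_ hn
        rw [dist_eq_norm, ← Finset.sum_sub_distrib]
        refine (norm_sum_le _ _).trans (Finset.sum_le_sum fun j _ => ?_)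
        have : (EuclideanSpace.proj j : EuclideanSpace ℝ (Fin m) →L[ℝ] ℝ).smulRight
            (c j (φ.symm y)) - (EuclideanSpace.proj j :
              EuclideanSpace ℝ (Fin m) →L[ℝ] ℝ).smulRight (Y j (a n) (φ.symm y))
            = (EuclideanSpace.proj j : EuclideanSpace ℝ (Fin m) →L[ℝ] ℝ).smulRight
              ((c j - (Y j (a n)).toC) (φ.symm y)) := by
          ext v; simp [mul_sub]
        rw [this, ContinuousLinearMap.norm_smulRight_apply]
        exact mul_le_mul_of_nonneg_left ((c j - (Y j (a n)).toC).norm_coe_le_norm _)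
          (norm_nonneg _)
      · intro y _
        have := (h [] (by simp))
        exact ((continuous_eval_const (F := C(M, ℂ)) (φ.symm y)).tendsto _).comp this
    have hc : ∀ j, ContMDiff (𝓡 m) 𝓘(ℝ, ℂ) k (c j) := by
      intro j
      have : (c j : M → ℂ) = fun x => ∑ i, (ξ i (Y j)) x * g [i] x := by
        ext x; simp [c]
      rw [this]
      refine contMDiff_finsetSum fun i _ => ?_
      have h1 : ContMDiff (𝓡 m) 𝓘(ℝ, ℂ) k (ξ i (Y j)) :=
        (ξ i (Y j)).contMDiff.of_le (by exact_mod_cast le_top)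
      have h2 : ContDiff ℝ k (fun z : ℂ × ℂ => z.1 * z.2) := contDiff_fst.mul contDiff_snd
      exact h2.contMDiff.comp (h1.prodMk_space (hg i))
    have hf' : ContDiffOn ℝ k f' U := by
      refine ContDiffOn.sum fun j _ => ?_
      exact (ContinuousLinearMap.smulRightL ℝ _ ℂ (EuclideanSpace.proj j)).contDiff.comp_contDiffOn
        ((contDiffOn_comp_symm (by exact_mod_cast le_top) (hc j) x₀).mono hUt)
    have hG : ContDiffOn ℝ (k + 1) (g [] ∘ φ.symm) U := by
      rw [contDiffOn_succ_iff_fderiv_of_isOpen hUo]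
      refine ⟨fun y hy => (hder y hy).differentiableAt.differentiableWithinAt, by simp, ?_⟩
      exact hf'.congr fun y hy => (hder y hy).fderiv
    rw [contMDiffAt_iff]
    refine ⟨(g []).continuous.continuousAt, ?_⟩
    have := (hG.contDiffAt (hUo.mem_nhds hxU)).contDiffWithinAt (s := Set.range (𝓡 m))
    rw [extChartAt_model_space_eq_id]
    exact this

end Coordinates

/-! ### The `C^k` norms and the Banach space of jets. -/

section CNorm

variable {m : ℕ} {M : Type*} [TopologicalSpace M] [ChartedSpace (EuclideanSpace ℝ (Fin m)) M]
  {N : ℕ} (X : Fin N → VF m M)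

theorem cNorm_nonneg (k : ℕ) (a : Smooth m M) : 0 ≤ cNorm X k a := by
  induction k generalizing a with
  | zero => exact Real.iSup_nonneg fun x => norm_nonneg _
  | succ k ih =>
    exact add_nonneg (Real.iSup_nonneg fun x => norm_nonneg _) (Finset.sum_nonneg fun i _ => ih _)

theorem cNorm_le_succ (k : ℕ) (a : Smooth m M) : cNorm X k a ≤ cNorm X (k + 1) a := by
  induction k generalizing a with
  | zero => exact le_add_of_nonneg_right (Finset.sum_nonneg fun i _ => cNorm_nonneg X 0 _)
  | succ k ih => exact add_le_add le_rfl (Finset.sum_le_sum fun i _ => ih _)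

theorem cNorm_mono (a : Smooth m M) : Monotone fun k => cNorm X k a :=
  monotone_nat_of_le_succ fun k => cNorm_le_succ X k a

theorem cNorm_deriv_le (k : ℕ) (a : Smooth m M) (i : Fin N) :
    cNorm X k (X i a) ≤ cNorm X (k + 1) a := by
  refine le_trans ?_ (le_add_of_nonneg_left (Real.iSup_nonneg fun x => norm_nonneg _))
  exact Finset.single_le_sum (f := fun i => cNorm X k (X i a))
    (fun i _ => cNorm_nonneg X k _) (Finset.mem_univ i)

variable [CompactSpace M]

theorem cNorm_zero_eq (a : Smooth m M) : cNorm X 0 a = ‖a.toC‖ :=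
  (ContinuousMap.norm_eq_iSup_norm a.toC).symm

theorem cNorm_succ_eq (k : ℕ) (a : Smooth m M) :
    cNorm X (k + 1) a = ‖a.toC‖ + ∑ i, cNorm X k (X i a) :=
  congrArg (· + ∑ i, cNorm X k (X i a)) (ContinuousMap.norm_eq_iSup_norm a.toC).symm

theorem norm_wordAct_le (k : ℕ) (w : List (Fin N)) (hw : w.length ≤ k) (a : Smooth m M) :
    ‖(wordAct X w a).toC‖ ≤ cNorm X k a := by
  induction w generalizing k a with
  | nil =>
    rw [← cNorm_zero_eq X]
    exact cNorm_mono X a (Nat.zero_le k)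
  | cons i w ih =>
    obtain ⟨k, rfl⟩ : ∃ k', k = k' + 1 := ⟨k - 1, by simp at hw; omega⟩
    exact (ih k (by simpa using hw) (X i a)).trans (cNorm_deriv_le X k a i)

/-- The words of length at most `k`. -/
abbrev Words (N k : ℕ) : Type := {w : List (Fin N) // w.length ≤ k}

instance (N k : ℕ) : Finite (Words N k) := List.finite_length_le (Fin N) k

instance (N k : ℕ) : Fintype (Words N k) := Fintype.ofFinite _

omit [CompactSpace M] in
theorem wordAct_add (w : List (Fin N)) (a b : Smooth m M) :
    wordAct X w (a + b) = wordAct X w a + wordAct X w b := by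
  induction w generalizing a b with
  | nil => rfl
  | cons i w ih => simp only [wordAct, map_add, ih]

omit [CompactSpace M] in
theorem wordAct_smul (w : List (Fin N)) (c : ℝ) (a : Smooth m M) :
    wordAct X w (c • a) = c • wordAct X w a := by
  induction w generalizing a with
  | nil => rfl
  | cons i w ih => simp only [wordAct, Derivation.map_smul, ih]

/-- The `k`-jet of a smooth function with respect to the fields `X`. -/
def jet (k : ℕ) : Smooth m M →ₗ[ℝ] (Words N k → C(M, ℂ)) where
  toFun a w := (wordAct X w a).toC
  map_add' a b := by ext1 w; rw [wordAct_add]; rfl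
  map_smul' c a := by ext1 w; rw [wordAct_smul]; rfl

theorem norm_jet_le (k : ℕ) (a : Smooth m M) : ‖jet X k a‖ ≤ cNorm X k a :=
  (pi_norm_le_iff_of_nonneg (cNorm_nonneg X k a)).2 fun w => norm_wordAct_le X k w w.2 a

/-- The closure of the jets of smooth functions. -/
abbrev JetSpace (k : ℕ) : Submodule ℝ (Words N k → C(M, ℂ)) :=
  (LinearMap.range (jet X k)).topologicalClosure

/-- The function underlying a jet. -/
def JetSpace.base {k : ℕ} : JetSpace X k →L[ℝ] C(M, ℂ) :=
  (ContinuousLinearMap.proj (⟨[], Nat.zero_le k⟩ : Words N k)).comp (JetSpace X k).subtypeL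

/-- The closure of the jets is taken to have a complete space of multipliers. Its elements are still
jets of `C^k` functions, so the multiplication axiom applies to them. -/
theorem JetSpace.contMDiff_base [IsManifold (𝓡 m) ∞ M] [T2Space M] {X : Fin N → VF m M}
    (ξ : Fin N → VF m M →ₗ[Smooth m M] Smooth m M) (hX : ∀ Y, ∑ i, ξ i Y • X i = Y) {k : ℕ}
    (e : JetSpace X k) : ContMDiff (𝓡 m) 𝓘(ℝ, ℂ) k (JetSpace.base X e) := by
  classical
  have he : (e : Words N k → C(M, ℂ)) ∈ closure (Set.range (jet X k)) := by
    have := e.2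
    rwa [← SetLike.mem_coe, Submodule.topologicalClosure_coe, LinearMap.coe_range] at this
  obtain ⟨u, hu, hlim⟩ := mem_closure_iff_seq_limit.1 he
  choose a ha using hu
  let g : List (Fin N) → C(M, ℂ) := fun w => if h : w.length ≤ k then e.1 ⟨w, h⟩ else 0
  have := contMDiff_of_tendsto X ξ hX k a g fun w hw => by
    have h1 := (tendsto_pi_nhds.1 hlim) ⟨w, hw⟩
    simp only [g, dif_pos hw]
    simp only [← ha] at h1
    exact h1
  have hg : g [] = JetSpace.base X e := by
    simp only [g, List.length_nil, Nat.zero_le, dif_pos]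
    rfl
  rwa [hg] at this

end CNorm

/-! ### Quantitative forms of the axioms for the spaces `B^l`. -/

namespace AnisotropicSpaces

variable {m : ℕ} {M : Type*} [TopologicalSpace M] [ChartedSpace (EuclideanSpace ℝ (Fin m)) M]
  [MeasurableSpace M] [BorelSpace M] {μ : Measure M} {d : ℕ} {S : CRStructure m M d}
  [IsManifold (𝓡 m) ∞ M] [CompactSpace M] [T2Space M] (B : AnisotropicSpaces S μ)

open BanachFunctionSpace

theorem exists_incl_bound (l : ℕ) : ∃ C : ℝ, 0 ≤ C ∧ ∀ f ∈ (B.B (l + 1)).carrier,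
    (B.B l).nrm f ≤ C * (B.B (l + 1)).nrm f := by
  let T : (B.B (l + 1)).Space →ₗ[ℂ] (B.B l).Space :=
    { toFun := fun f => (B.B l).mkSpace (Space.val f) (B.antitone_B l f.mem)
      map_add' := fun f g => rfl
      map_smul' := fun c f => rfl }
  obtain ⟨C, hC, h⟩ := exists_nrm_le T
    ((B.B l).continuous_of_pair m T fun φ => ((B.B (l + 1)).pair φ.toC).continuous)
  exact ⟨C, hC, fun f hf => h (mkSpace _ f hf)⟩

theorem _root_.CR.IsWeakDeriv.add {Y : VF m M} [IsFiniteMeasure μ] [μ.IsOpenPosMeasure]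
    {f f' g g' : M →ₘ[μ] ℂ}
    (h : IsWeakDeriv Y f g) (h' : IsWeakDeriv Y f' g') : IsWeakDeriv Y (f + f') (g + g') := by
  obtain ⟨hf, hg, δ, hδ, H⟩ := h
  obtain ⟨hf', hg', δ', hδ', H'⟩ := h'
  obtain rfl := hδ.eq hδ'
  refine ⟨(hf.add hf').congr (AEEqFun.coeFn_add f f').symm,
    (hg.add hg').congr (AEEqFun.coeFn_add g g').symm, δ, hδ, fun φ => ?_⟩
  have e1 : ∫ x, (g + g' : M →ₘ[μ] ℂ) x * φ x ∂μ
      = ∫ x, g x * φ x ∂μ + ∫ x, g' x * φ x ∂μ := by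
    have i1 : Integrable (fun x => g x * φ x) μ := integrable_mul_continuous hg φ.toC
    have i2 : Integrable (fun x => g' x * φ x) μ := integrable_mul_continuous hg' φ.toC
    rw [← integral_add i1 i2]
    refine integral_congr_ae ((AEEqFun.coeFn_add g g').mono fun x hx => ?_)
    simp only [hx, Pi.add_apply, add_mul]
  have e2 : ∫ x, (f + f' : M →ₘ[μ] ℂ) x * (Y φ x + δ x * φ x) ∂μ
      = ∫ x, f x * (Y φ x + δ x * φ x) ∂μ + ∫ x, f' x * (Y φ x + δ x * φ x) ∂μ := by
    have i1 : Integrable (fun x => f x * (Y φ x + δ x * φ x)) μ :=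
      integrable_mul_continuous hf (Y φ + δ * φ).toC
    have i2 : Integrable (fun x => f' x * (Y φ x + δ x * φ x)) μ :=
      integrable_mul_continuous hf' (Y φ + δ * φ).toC
    rw [← integral_add i1 i2]
    refine integral_congr_ae ((AEEqFun.coeFn_add f f').mono fun x hx => ?_)
    simp only [hx, Pi.add_apply, add_mul]
  rw [e1, e2, H, H']
  ring

theorem _root_.CR.IsWeakDeriv.smul {Y : VF m M} {f g : M →ₘ[μ] ℂ}
    (h : IsWeakDeriv Y f g) (c : ℂ) : IsWeakDeriv Y (c • f) (c • g) := by
  obtain ⟨hf, hg, δ, hδ, H⟩ := h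
  refine ⟨(hf.smul c).congr (AEEqFun.coeFn_smul c f).symm,
    (hg.smul c).congr (AEEqFun.coeFn_smul c g).symm, δ, hδ, fun φ => ?_⟩
  have e : ∀ (u : M →ₘ[μ] ℂ) (ψ : M → ℂ), ∫ x, (c • u : M →ₘ[μ] ℂ) x * ψ x ∂μ
      = c * ∫ x, u x * ψ x ∂μ := by
    intro u ψ
    rw [← integral_const_mul]
    refine integral_congr_ae ((AEEqFun.coeFn_smul c u).mono fun x hx => ?_)
    simp only [hx, Pi.smul_apply, smul_eq_mul, mul_assoc]
  rw [e, e, H, mul_neg]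

theorem exists_deriv_bound [IsFiniteMeasure μ] [μ.IsOpenPosMeasure] (l : ℕ) {Y : VF m M}
    (hY : Y ∈ S.H ⊔ conjSub S.H) : ∃ C : ℝ, 0 ≤ C ∧ ∀ f ∈ (B.B (l + 1)).carrier,
      weakDeriv Y f ∈ (B.B l).carrier ∧
      (B.B l).nrm (weakDeriv Y f) ≤ C * (B.B (l + 1)).nrm f := by
  have key : ∀ f : (B.B (l + 1)).Space, IsWeakDeriv Y (Space.val f) (weakDeriv Y (Space.val f)) ∧
      weakDeriv Y (Space.val f) ∈ (B.B l).carrier := fun f => by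
    obtain ⟨g, hg, h⟩ := B.exists_weakDeriv l _ f.mem Y hY
    rw [weakDeriv_eq h]
    exact ⟨h, hg⟩
  let T : (B.B (l + 1)).Space →ₗ[ℂ] (B.B l).Space :=
    { toFun := fun f => (B.B l).mkSpace (weakDeriv Y (Space.val f)) (key f).2
      map_add' := fun f g => Space.val_injective
        (weakDeriv_eq ((key f).1.add (key g).1))
      map_smul' := fun c f => Space.val_injective (weakDeriv_eq ((key f).1.smul c)) }
  obtain ⟨C, hC, h⟩ := exists_nrm_le T ((B.B l).continuous_of_pair m T fun φ => by
    by_cases hne : ∃ δ : Smooth m M, IsDivergence μ Y δ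
    · obtain ⟨δ, hδ⟩ := hne
      -- Integration by parts moves `Y` to the test function, so the pairing is continuous in `f`
      -- and the closed graph criterion applies.
      have : (fun f => (B.B l).pair φ.toC (T f))
          = fun f => - (B.B (l + 1)).pair (Y φ + δ * φ).toC f := by
        ext f
        obtain ⟨-, -, δ', hδ', H⟩ := (key f).1
        obtain rfl := hδ.eq hδ'
        exact H φ
      rw [this]
      exact ((B.B (l + 1)).pair _).continuous.neg
    · obtain ⟨-, -, δ', hδ', H⟩ := (key 0).1
      exact absurd ⟨δ', hδ'⟩ hne)
  exact ⟨C, hC, fun f hf => ⟨(key (mkSpace _ f hf)).2, h (mkSpace _ f hf)⟩⟩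

/-- Multiplication by a function of class `C^{θ(l)}` on `B^l`. -/
def mulLin (l : ℕ) (g : C(M, ℂ)) (hg : ContMDiff (𝓡 m) 𝓘(ℝ, ℂ) (B.θ l) g) :
    (B.B l).Space →ₗ[ℂ] (B.B l).Space where
  toFun f := (B.B l).mkSpace (g.toAEEqFun μ * Space.val f) (B.mul_mem l _ f.mem g hg)
  map_add' _ _ := Space.val_injective (aeEqFun_mul_add _ _ _)
  map_smul' c _ := Space.val_injective (aeEqFun_mul_smul c _ _)

theorem pair_mulLin (l : ℕ) (g : C(M, ℂ)) (hg : ContMDiff (𝓡 m) 𝓘(ℝ, ℂ) (B.θ l) g) (φ : C(M, ℂ))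
    (f : (B.B l).Space) : (B.B l).pair φ (B.mulLin l g hg f) = (B.B l).pair (g * φ) f := by
  refine integral_congr_ae ?_
  filter_upwards [AEEqFun.coeFn_mul (g.toAEEqFun μ) (Space.val f),
    g.coeFn_toAEEqFun μ] with x hx hx'
  change (g.toAEEqFun μ * Space.val f : M →ₘ[μ] ℂ) x * φ x = Space.val f x * (g x * φ x)
  rw [hx, Pi.mul_apply, hx']
  ring

theorem continuous_mulLin (l : ℕ) (g : C(M, ℂ)) (hg : ContMDiff (𝓡 m) 𝓘(ℝ, ℂ) (B.θ l) g) :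
    Continuous (B.mulLin l g hg) :=
  (B.B l).continuous_of_pair m _ fun φ => by
    simp only [pair_mulLin]
    exact ((B.B l).pair _).continuous

/-- The closed graph theorem is used twice: each multiplier acts continuously, and the resulting
linear map from jets of order `θ(l)` to operators is itself continuous. Its norm is the constant
`C`. -/
theorem exists_mul_bound (F : Frames S) (l : ℕ) : ∃ C : ℝ, 0 ≤ C ∧ ∀ (a : Smooth m M),
    ∀ f ∈ (B.B l).carrier, a • f ∈ (B.B l).carrier ∧
      (B.B l).nrm (a • f) ≤ C * cNorm F.X (B.θ l) a * (B.B l).nrm f := by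
  let X := F.X
  let T₀ : JetSpace X (B.θ l) → ((B.B l).Space →L[ℂ] (B.B l).Space) := fun e =>
    ⟨B.mulLin l (JetSpace.base X e) (JetSpace.contMDiff_base F.ξ F.sum_eq e),
      B.continuous_mulLin l _ _⟩
  have h3 : ∀ e f φ, (B.B l).pair φ (T₀ e f) = (B.B l).pairLeft f (JetSpace.base X e * φ) :=
    fun e f φ => B.pair_mulLin l _ (JetSpace.contMDiff_base F.ξ F.sum_eq e) _ _
  let T : JetSpace X (B.θ l) →ₗ[ℝ] ((B.B l).Space →L[ℂ] (B.B l).Space) :=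
    { toFun := T₀
      map_add' := fun e e' => ContinuousLinearMap.ext fun f => Space.ext_pair m fun φ => by
        rw [add_apply, map_add, h3, h3, h3, map_add, add_mul, map_add]
      map_smul' := fun c e => ContinuousLinearMap.ext fun f => Space.ext_pair m fun φ => by
        have h4 : (B.B l).pair φ.toC ((c • T₀ e) f) = c • (B.B l).pair φ.toC (T₀ e f) :=
          ((B.B l).pair φ.toC).map_smul_of_tower c (T₀ e f)
        rw [RingHom.id_apply, h4, h3, h3, map_smul, smul_mul_assoc,
          ((B.B l).pairLeft f).map_smul_of_tower] }
  have hT : Continuous T := by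
    refine T.continuous_of_seq_closed_graph fun u x y hu hy =>
      ContinuousLinearMap.ext fun f => Space.ext_pair m fun φ => ?_
    have h1 : Filter.Tendsto (fun n => (B.B l).pair φ.toC (T (u n) f)) Filter.atTop
        (nhds ((B.B l).pair φ.toC (y f))) :=
      ((B.B l).pair φ.toC).continuous.continuousAt.tendsto.comp
        (((ContinuousLinearMap.apply ℂ (B.B l).Space f).continuous.tendsto y).comp hy)
    have h2 : Filter.Tendsto (fun n => (B.B l).pairLeft f (JetSpace.base X (u n) * φ.toC))
        Filter.atTop (nhds ((B.B l).pairLeft f (JetSpace.base X x * φ.toC))) :=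
      (((B.B l).pairLeft f).continuous.tendsto _).comp
        ((((JetSpace.base X).continuous.tendsto x).comp hu).mul tendsto_const_nhds)
    refine (tendsto_nhds_unique h1 ?_).trans (h3 x f φ.toC).symm
    exact h2.congr fun n => (h3 (u n) f φ.toC).symm
  let T' : JetSpace X (B.θ l) →L[ℝ] ((B.B l).Space →L[ℂ] (B.B l).Space) := ⟨T, hT⟩
  refine ⟨‖T'‖, T'.opNorm_nonneg, fun a f hf => ?_⟩
  have hmem : a • f ∈ (B.B l).carrier :=
    B.mul_mem l f hf a.toC (a.contMDiff.of_le (by exact_mod_cast le_top))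
  refine ⟨hmem, ?_⟩
  let e : JetSpace X (B.θ l) := ⟨jet X _ a, Submodule.le_topologicalClosure _ ⟨a, rfl⟩⟩
  have h1 : (B.B l).nrm (a • f) = ‖T' e (mkSpace _ f hf)‖ := rfl
  rw [h1]
  refine ((T' e).le_opNorm _).trans ?_
  refine mul_le_mul ((T'.le_opNorm e).trans ?_) le_rfl (norm_nonneg _)
    (mul_nonneg T'.opNorm_nonneg (cNorm_nonneg _ _ _))
  exact mul_le_mul_of_nonneg_left (norm_jet_le X _ a) T'.opNorm_nonneg

end AnisotropicSpaces

/-! ### Unboundedness of `θ`. -/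

/-- After `k` derivatives a nonzero multiple of `t^(-1/2)` is left, which is unbounded at the
origin. -/
theorem not_contDiffAt_rpow (k : ℕ) (f : ℝ → ℝ) (c : ℝ) (hc : c ≠ 0)
    (hf : ∀ᶠ t in nhdsWithin (0 : ℝ) (Set.Ioi 0), f t = c * t ^ ((k : ℝ) - 1 / 2)) :
    ¬ ContDiffAt ℝ k f 0 := by
  induction k generalizing f c with
  | zero =>
    intro h
    have h1 : Filter.Tendsto f (nhdsWithin 0 (Set.Ioi 0)) (nhds (f 0)) :=
      h.continuousAt.tendsto.mono_left nhdsWithin_le_nhds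
    have h2 : Filter.Tendsto (fun t : ℝ => f t / c) (nhdsWithin 0 (Set.Ioi 0)) Filter.atTop := by
      refine (tendsto_rpow_neg_nhdsGT_zero (y := -(1 / 2 : ℝ)) (by norm_num)).congr' ?_
      filter_upwards [hf] with t ht
      rw [ht, mul_div_cancel_left₀ _ hc]
      norm_num
    exact not_tendsto_nhds_of_tendsto_atTop h2 _ (h1.div_const c)
  | succ k ih =>
    intro h
    have h1 : ContDiffAt ℝ k (deriv f) 0 :=
      (h.fderiv_right (m := k) (by norm_cast)).clm_apply contDiffAt_const
    refine ih (deriv f) (c * ((k : ℝ) + 1 / 2)) (mul_ne_zero hc (by positivity)) ?_ h1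
    rw [eventually_nhdsWithin_iff] at hf ⊢
    filter_upwards [eventually_eventually_nhds.2 hf] with t ht ht0
    have ht0' : (0 : ℝ) < t := ht0
    have hd : HasDerivAt (fun t : ℝ => c * t ^ (((k + 1 : ℕ) : ℝ) - 1 / 2))
        (c * ((((k + 1 : ℕ) : ℝ) - 1 / 2) * t ^ ((((k + 1 : ℕ) : ℝ) - 1 / 2) - 1))) t :=
      (Real.hasDerivAt_rpow_const (Or.inl ht0'.ne')).const_mul c
    have he : f =ᶠ[nhds t] fun t : ℝ => c * t ^ (((k + 1 : ℕ) : ℝ) - 1 / 2) := by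
      filter_upwards [ht, lt_mem_nhds ht0'] with s hs hs0 using hs hs0
    rw [he.deriv_eq, hd.deriv]
    push_cast
    rw [show (k : ℝ) + 1 - 1 / 2 - 1 = k - 1 / 2 by ring,
      show (k : ℝ) + 1 - 1 / 2 = k + 1 / 2 by ring]
    ring

section NonSmooth

variable {m : ℕ} {M : Type*} [TopologicalSpace M] [ChartedSpace (EuclideanSpace ℝ (Fin m)) M]
  [IsManifold (𝓡 m) ∞ M] [T2Space M]

/-- On a manifold of positive dimension there are `C^k` functions that are not smooth. -/
theorem exists_contMDiff_not_smooth [Nonempty M] (hm : 0 < m) (k : ℕ) :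
    ∃ g : C(M, ℂ), ContMDiff (𝓡 m) 𝓘(ℝ, ℂ) k g ∧ ¬ ContMDiff (𝓡 m) 𝓘(ℝ, ℂ) ∞ g := by
  obtain ⟨x₀⟩ := ‹Nonempty M›
  obtain ⟨χ⟩ : Nonempty (SmoothBumpFunction (𝓡 m) x₀) := inferInstance
  set φ := extChartAt (𝓡 m) x₀ with hφ
  let j : Fin m := ⟨0, hm⟩
  -- The exponent `k + 1/2` gives a function of class `C^k` that is not `C^(k+1)` at the origin. It
  -- is used in one coordinate and cut off in the chart.
  let h : ℝ → ℝ := fun t => t ^ (((k + 1 : ℕ) : ℝ) - 1 / 2)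
  have hh : ContDiff ℝ k h := Real.contDiff_rpow_const_of_le (by push_cast; linarith)
  let G : M → ℂ := fun x => ((h (φ x j - φ x₀ j) : ℝ) : ℂ)
  have hG : ContMDiffOn (𝓡 m) 𝓘(ℝ, ℂ) k G (chartAt (EuclideanSpace ℝ (Fin m)) x₀).source := by
    have : IsManifold (𝓡 m) k M := IsManifold.of_le (n := ∞) (by exact_mod_cast le_top)
    have h1 : ContDiff ℝ k fun y : EuclideanSpace ℝ (Fin m) => ((h (y j - φ x₀ j) : ℝ) : ℂ) :=
      Complex.ofRealCLM.contDiff.comp (hh.comp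
        (((EuclideanSpace.proj j : EuclideanSpace ℝ (Fin m) →L[ℝ] ℝ).contDiff).sub contDiff_const))
    exact h1.contMDiff.comp_contMDiffOn contMDiffOn_extChartAt
  have hg : ContMDiff (𝓡 m) 𝓘(ℝ, ℂ) k fun x => χ x • G x := by
    refine contMDiff_of_tsupport fun x hx => ?_
    have hx' : x ∈ (chartAt (EuclideanSpace ℝ (Fin m)) x₀).source :=
      χ.tsupport_subset_chartAt_source (tsupport_smul_subset_left _ _ hx)
    exact (χ.contMDiffAt.of_le (by exact_mod_cast le_top)).smul
      ((hG _ hx').contMDiffAt ((chartAt _ _).open_source.mem_nhds hx'))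
  refine ⟨⟨fun x => χ x • G x, hg.continuous⟩, hg, fun hs => ?_⟩
  -- On this coordinate line through `x₀` the function is `h` near `t = 0`.
  let γ : ℝ → EuclideanSpace ℝ (Fin m) := fun t => φ x₀ + t • EuclideanSpace.single j (1 : ℝ)
  have hγ : ContDiff ℝ ∞ γ := contDiff_const.add (contDiff_id.smul contDiff_const)
  have hγ0 : γ 0 = φ x₀ := by simp [γ]
  have hsmooth : ContDiffAt ℝ ∞ (fun t => (χ (φ.symm (γ t)) • G (φ.symm (γ t))).re) 0 := by
    have h1 := (contDiffOn_comp_symm le_rfl hs x₀).contDiffAt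
      ((isOpen_extChartAt_target x₀).mem_nhds (mem_extChartAt_target x₀))
    rw [← hφ, ← hγ0] at h1
    exact Complex.reCLM.contDiff.contDiffAt.comp 0 (h1.comp 0 hγ.contDiffAt)
  have hev : (fun t => (χ (φ.symm (γ t)) • G (φ.symm (γ t))).re) =ᶠ[nhds 0] h := by
    have h2 : Filter.Tendsto γ (nhds 0) (nhds (φ x₀)) := by
      rw [← hγ0]; exact hγ.continuous.continuousAt
    have h3 : Filter.Tendsto (fun t => φ.symm (γ t)) (nhds 0) (nhds x₀) := by
      have := (continuousAt_extChartAt_symm (I := 𝓡 m) x₀).tendsto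
      rw [extChartAt_to_inv] at this
      exact this.comp h2
    filter_upwards [h3.eventually χ.eventuallyEq_one, h2.eventually
      ((isOpen_extChartAt_target x₀).mem_nhds (mem_extChartAt_target x₀))] with t ht1 ht2
    have e1 : χ (φ.symm (γ t)) = 1 := ht1
    have e2 : φ (φ.symm (γ t)) = γ t := φ.right_inv ht2
    simp only [e1, one_smul, G, e2, Complex.ofReal_re]
    simp [γ]
  refine not_contDiffAt_rpow (k + 1) h 1 one_ne_zero ?_
    ((hsmooth.congr_of_eventuallyEq hev.symm).of_le (by exact_mod_cast le_top))
  exact Filter.Eventually.of_forall fun t => (one_mul _).symm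

end NonSmooth

namespace AnisotropicSpaces

variable {m : ℕ} {M : Type*} [TopologicalSpace M] [ChartedSpace (EuclideanSpace ℝ (Fin m)) M]
  [MeasurableSpace M] [BorelSpace M] {μ : Measure M} {d : ℕ} {S : CRStructure m M d}
  [IsManifold (𝓡 m) ∞ M] [T2Space M]

/-- If `θ < k` throughout, multiplying the constant `1` puts every `C^k` function in all `B^l`,
hence in `C^∞`, which is false in positive dimension. -/
theorem exists_le_theta [Nonempty M] [μ.IsOpenPosMeasure] (B : AnisotropicSpaces S μ)
    (hB : B.InterEqSmooth) (hm : 0 < m) (k : ℕ) : ∃ l, k ≤ B.θ l := by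
  by_contra! hlt
  obtain ⟨g, hg, hg'⟩ := exists_contMDiff_not_smooth (M := M) hm k
  have h1 : ∀ l, g.toAEEqFun μ ∈ (B.B l).carrier := fun l => by
    have := B.mul_mem l _ ((hB _).2 ⟨1, rfl⟩ l) g (hg.of_le (by exact_mod_cast (hlt l).le))
    have e : g.toAEEqFun μ * toAE μ (1 : Smooth m M) = g.toAEEqFun μ := by
      simp only [toAE, ContinuousMap.toAEEqFun, AEEqFun.mk_mul_mk]; congr 1; ext x; simp
    rwa [e] at this
  obtain ⟨a, ha⟩ := (hB _).1 h1
  have h2 : (g : M → ℂ) =ᵐ[μ] a := AEEqFun.mk_eq_mk.1 ha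
  have h3 := (g.continuous.ae_eq_iff_eq μ a.contMDiff.continuous).1 h2
  exact hg' (h3 ▸ a.contMDiff)

end AnisotropicSpaces

/-! ### Families of functions and vector fields that tend to zero in every `C^k` norm. -/

section Small

variable {m : ℕ} {M : Type*} [TopologicalSpace M] [ChartedSpace (EuclideanSpace ℝ (Fin m)) M]
  [CompactSpace M] {A : Type*}

theorem cNorm_add_le {N : ℕ} (X : Fin N → VF m M) (k : ℕ) (a b : Smooth m M) :
    cNorm X k (a + b) ≤ cNorm X k a + cNorm X k b := by
  induction k generalizing a b with
  | zero =>
    simp only [cNorm_zero_eq]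
    exact norm_add_le a.toC b.toC
  | succ k ih =>
    simp only [cNorm_succ_eq, map_add]
    have h1 := norm_add_le a.toC b.toC
    have h2 := Finset.sum_le_sum fun i (_ : i ∈ Finset.univ) => ih (X i a) (X i b)
    rw [Finset.sum_add_distrib] at h2
    have h3 : (a + b).toC = a.toC + b.toC := rfl
    rw [h3]
    linarith

theorem cNorm_neg {N : ℕ} (X : Fin N → VF m M) (k : ℕ) (a : Smooth m M) :
    cNorm X k (-a) = cNorm X k a := by
  induction k generalizing a with
  | zero =>
    simp only [cNorm_zero_eq]
    exact norm_neg a.toC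
  | succ k ih =>
    have h3 : (-a).toC = -a.toC := rfl
    simp only [cNorm_succ_eq, map_neg, ih, h3, norm_neg]

theorem cNorm_zero {N : ℕ} (X : Fin N → VF m M) (k : ℕ) : cNorm X k (0 : Smooth m M) = 0 := by
  induction k with
  | zero => rw [cNorm_zero_eq]; exact norm_zero
  | succ k ih =>
    have h3 : (0 : Smooth m M).toC = 0 := rfl
    simp only [cNorm_succ_eq, map_zero, ih, h3, norm_zero, Finset.sum_const_zero, add_zero]

/-- A family of functions tends to zero in the `C^k` norm along the filter `𝓕`. -/
def SmallAt {N : ℕ} (X : Fin N → VF m M) (𝓕 : Filter A) (k : ℕ) (a : A → Smooth m M) : Prop :=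
  Tendsto (fun s => cNorm X k (a s)) 𝓕 (𝓝 0)

/-- A family of functions tends to zero in all `C^k` norms along the filter `𝓕`. -/
def Small {N : ℕ} (X : Fin N → VF m M) (𝓕 : Filter A) (a : A → Smooth m M) : Prop :=
  ∀ k, SmallAt X 𝓕 k a

variable {N : ℕ} {X : Fin N → VF m M} {𝓕 : Filter A} {k : ℕ} {a b : A → Smooth m M}

theorem SmallAt.of_le {b : A → ℝ} (hb : Tendsto b 𝓕 (𝓝 0)) (h : ∀ s, cNorm X k (a s) ≤ b s) :
    SmallAt X 𝓕 k a :=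
  tendsto_of_tendsto_of_tendsto_of_le_of_le tendsto_const_nhds hb
    (fun s => cNorm_nonneg X k (a s)) h

theorem SmallAt.add (ha : SmallAt X 𝓕 k a) (hb : SmallAt X 𝓕 k b) :
    SmallAt X 𝓕 k fun s => a s + b s :=
  .of_le (by simpa using Tendsto.add ha hb) fun s => cNorm_add_le X k (a s) (b s)

theorem SmallAt.zero : SmallAt X 𝓕 k fun _ => 0 := by
  simp only [SmallAt, cNorm_zero, tendsto_const_nhds]

theorem SmallAt.sum {ι : Type*} (s : Finset ι) {a : ι → A → Smooth m M}
    (h : ∀ i ∈ s, SmallAt X 𝓕 k (a i)) : SmallAt X 𝓕 k fun t => ∑ i ∈ s, a i t := by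
  classical
  induction s using Finset.induction_on with
  | empty => simpa using SmallAt.zero
  | insert i s hi ih =>
    simp only [Finset.sum_insert hi]
    exact (h i (Finset.mem_insert_self i s)).add
      (ih fun j hj => h j (Finset.mem_insert_of_mem hj))

theorem SmallAt.neg (ha : SmallAt X 𝓕 k a) : SmallAt X 𝓕 k fun s => -a s := by
  simpa only [SmallAt, cNorm_neg] using ha

theorem SmallAt.pred (ha : SmallAt X 𝓕 (k + 1) a) : SmallAt X 𝓕 k a :=
  .of_le ha fun s => cNorm_le_succ X k (a s)

theorem SmallAt.deriv (ha : SmallAt X 𝓕 (k + 1) a) (i : Fin N) :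
    SmallAt X 𝓕 k fun s => X i (a s) :=
  .of_le ha fun s => cNorm_deriv_le X k (a s) i

theorem SmallAt.tendsto_norm (ha : SmallAt X 𝓕 k a) :
    Tendsto (fun s => ‖(a s).toC‖) 𝓕 (𝓝 0) := by
  have h : SmallAt X 𝓕 0 a := .of_le ha fun s => cNorm_mono X (a s) (Nat.zero_le k)
  simpa only [SmallAt, cNorm_zero_eq] using h

theorem SmallAt.succ (h : Tendsto (fun s => ‖(a s).toC‖) 𝓕 (𝓝 0))
    (h' : ∀ i, SmallAt X 𝓕 k fun s => X i (a s)) : SmallAt X 𝓕 (k + 1) a := by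
  simp only [SmallAt, cNorm_succ_eq]
  have := h.add (tendsto_finsetSum Finset.univ fun i _ => h' i)
  simpa using this

theorem SmallAt.const_mul (ha : SmallAt X 𝓕 k a) (c : Smooth m M) :
    SmallAt X 𝓕 k fun s => c * a s := by
  have h0 : Tendsto (fun s => ‖(c * a s).toC‖) 𝓕 (𝓝 0) := by
    refine squeeze_zero (fun s => norm_nonneg _) (fun s => norm_mul_le c.toC (a s).toC) ?_
    simpa using ha.tendsto_norm.const_mul ‖c.toC‖
  induction k generalizing c a with
  | zero => simpa only [SmallAt, cNorm_zero_eq] using h0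
  | succ k ih =>
    have h1 : ∀ (c : Smooth m M) {a : A → Smooth m M}, SmallAt X 𝓕 k a →
        Tendsto (fun s => ‖(c * a s).toC‖) 𝓕 (𝓝 0) := fun c a ha => by
      refine squeeze_zero (fun s => norm_nonneg _) (fun s => norm_mul_le c.toC (a s).toC) ?_
      simpa using ha.tendsto_norm.const_mul ‖c.toC‖
    refine .succ h0 fun i => ?_
    simp only [Derivation.leibniz, smul_eq_mul]
    refine (ih (ha.deriv i) c (h1 _ (ha.deriv i))).add ?_
    simp only [mul_comm (a _)]
    exact ih ha.pred _ (h1 _ ha.pred)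

theorem SmallAt.mul (ha : SmallAt X 𝓕 k a) (hb : SmallAt X 𝓕 k b) :
    SmallAt X 𝓕 k fun s => a s * b s := by
  have h1 : ∀ {k : ℕ} {a b : A → Smooth m M}, SmallAt X 𝓕 k a → SmallAt X 𝓕 k b →
      Tendsto (fun s => ‖(a s * b s).toC‖) 𝓕 (𝓝 0) := fun {k a b} ha hb => by
    refine squeeze_zero (fun s => norm_nonneg _) (fun s => norm_mul_le (a s).toC (b s).toC) ?_
    simpa using ha.tendsto_norm.mul hb.tendsto_norm
  induction k generalizing a b with
  | zero => simpa only [SmallAt, cNorm_zero_eq] using h1 ha hb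
  | succ k ih =>
    refine .succ (h1 ha hb) fun i => ?_
    simp only [Derivation.leibniz, smul_eq_mul]
    exact (ih ha.pred (hb.deriv i)).add (ih hb.pred (ha.deriv i))

variable {d : ℕ} {S : CRStructure m M d} (F : Frames S)

/-- One order of differentiability is lost; `Small` asks for all orders so that it is stable under
derivatives and brackets. -/
theorem Small.deriv (ha : Small F.X 𝓕 a) (Y : VF m M) : Small F.X 𝓕 fun s => Y (a s) := by
  intro k
  have : ∀ s, Y (a s) = ∑ i, F.ξ i Y * F.X i (a s) := fun s => by
    conv_lhs => rw [← F.sum_eq Y, VF.sum_apply]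
    rfl
  simp only [this]
  exact SmallAt.sum _ fun i _ => ((ha (k + 1)).deriv i).const_mul _

/-- A family of vector fields whose coefficients tend to zero in all `C^k` norms. -/
def SmallVF (𝓕 : Filter A) (Y : A → VF m M) : Prop := ∀ i, Small F.X 𝓕 fun s => F.ξ i (Y s)

variable {F} {Y Y' : A → VF m M}

theorem SmallVF.add (h : SmallVF F 𝓕 Y) (h' : SmallVF F 𝓕 Y') :
    SmallVF F 𝓕 fun s => Y s + Y' s := fun i k => by
  simpa only [map_add] using (h i k).add (h' i k)

theorem SmallVF.neg (h : SmallVF F 𝓕 Y) : SmallVF F 𝓕 fun s => -Y s := fun i k => by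
  simpa only [map_neg] using (h i k).neg

theorem SmallVF.sub (h : SmallVF F 𝓕 Y) (h' : SmallVF F 𝓕 Y') :
    SmallVF F 𝓕 fun s => Y s - Y' s := by
  simpa only [sub_eq_add_neg] using h.add h'.neg

theorem SmallVF.sum {ι : Type*} (s : Finset ι) {Y : ι → A → VF m M}
    (h : ∀ i ∈ s, SmallVF F 𝓕 (Y i)) : SmallVF F 𝓕 fun t => ∑ i ∈ s, Y i t := fun i k => by
  simpa only [map_sum] using SmallAt.sum s fun j hj => h j hj i k

theorem Small.smul_const (h : Small F.X 𝓕 a) (W : VF m M) : SmallVF F 𝓕 fun s => a s • W :=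
  fun i k => by
    simpa only [map_smul, smul_eq_mul, mul_comm] using (h k).const_mul (F.ξ i W)

theorem Small.smul (h : Small F.X 𝓕 a) (h' : SmallVF F 𝓕 Y) : SmallVF F 𝓕 fun s => a s • Y s :=
  fun i k => by
    simpa only [map_smul, smul_eq_mul] using (h k).mul (h' i k)

theorem SmallVF.lie_const (h : SmallVF F 𝓕 Y) (W : VF m M) : SmallVF F 𝓕 fun s => ⁅W, Y s⁆ := by
  have : ∀ s, ⁅W, Y s⁆ = ∑ i, (F.ξ i (Y s) • ⁅W, F.X i⁆ + W (F.ξ i (Y s)) • F.X i) := fun s => by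
    conv_lhs => rw [← F.sum_eq (Y s)]
    rw [VF.lie_sum]
    simp only [VF.lie_smul]
  simp only [this]
  exact SmallVF.sum _ fun i _ => ((h i).smul_const _).add (((h i).deriv F W).smul_const _)

theorem SmallVF.const_lie (h : SmallVF F 𝓕 Y) (W : VF m M) : SmallVF F 𝓕 fun s => ⁅Y s, W⁆ := by
  simpa only [VF.lie_skew] using (h.lie_const W).neg

theorem SmallVF.apply (h : SmallVF F 𝓕 Y) (ha : Small F.X 𝓕 a) :
    Small F.X 𝓕 fun s => Y s (a s) := by
  intro k
  have : ∀ s, Y s (a s) = ∑ i, F.ξ i (Y s) * F.X i (a s) := fun s => by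
    conv_lhs => rw [← F.sum_eq (Y s), VF.sum_apply]
    rfl
  simp only [this]
  exact SmallAt.sum _ fun i _ => (h i k).mul ((ha (k + 1)).deriv i)

theorem SmallVF.lie (h : SmallVF F 𝓕 Y) (h' : SmallVF F 𝓕 Y') :
    SmallVF F 𝓕 fun s => ⁅Y s, Y' s⁆ := by
  have : ∀ s, ⁅Y s, Y' s⁆ = ∑ i, (F.ξ i (Y' s) • ⁅Y s, F.X i⁆ + Y s (F.ξ i (Y' s)) • F.X i) :=
    fun s => by
      conv_lhs => rw [← F.sum_eq (Y' s)]
      rw [VF.lie_sum]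
      simp only [VF.lie_smul]
  simp only [this]
  exact SmallVF.sum _ fun i _ => ((h' i).smul (h.const_lie _)).add ((h.apply (h' i)).smul_const _)

/-- Every section of `H_{0,1}M` is a combination of the generators. -/
theorem Frames.exists_coeff (F : Frames S) (Z : S.H) : ∃ c : Fin F.N₂ → Smooth m M,
    ∑ j, c j • F.Z j = Z :=
  (Submodule.mem_span_range_iff_exists_fun _).1 (F.span_eq ▸ Submodule.mem_top)

variable {𝓕 : Filter (S.H →ₗ[Smooth m M] conjSub S.H)}
  (h𝓕 : ∀ k, Tendsto (F.normΦ k) 𝓕 (𝓝 0))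

include h𝓕 in
theorem smallVF_extΦ (X : VF m M) : SmallVF F 𝓕 fun Φ => extΦ Φ X := by
  obtain ⟨c, hc⟩ := F.exists_coeff (S.projH X)
  intro i k
  have : ∀ Φ, F.ξ i (extΦ Φ X) = ∑ j, c j * F.ξ i (Φ (F.Z j)) := fun Φ => by
    rw [extΦ_apply, ← hc, map_sum, ← Submodule.subtype_apply, map_sum, map_sum]
    refine Finset.sum_congr rfl fun j _ => ?_
    rw [map_smul, map_smul, map_smul]; rfl
  simp only [this]
  refine SmallAt.sum _ fun j _ => SmallAt.const_mul (.of_le (h𝓕 k) fun Φ => ?_) _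
  refine le_trans ?_ (Finset.single_le_sum (f := fun i => ∑ j, cNorm F.X k (F.ξ i (Φ (F.Z j))))
    (fun i _ => Finset.sum_nonneg fun j _ => cNorm_nonneg _ _ _) (Finset.mem_univ i))
  exact Finset.single_le_sum (f := fun j => cNorm F.X k (F.ξ i (Φ (F.Z j))))
    (fun j _ => cNorm_nonneg _ _ _) (Finset.mem_univ j)

include h𝓕 in
theorem SmallVF.extΦ {Y : (S.H →ₗ[Smooth m M] conjSub S.H) → VF m M} (h : SmallVF F 𝓕 Y) :
    SmallVF F 𝓕 fun Φ => CR.extΦ Φ (Y Φ) := by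
  have : ∀ Φ, CR.extΦ Φ (Y Φ) = ∑ i, F.ξ i (Y Φ) • CR.extΦ Φ (F.X i) := fun Φ => by
    conv_lhs => rw [← F.sum_eq (Y Φ), map_sum]
    simp only [map_smul]
  simp only [this]
  exact SmallVF.sum _ fun i _ => (h i).smul (smallVF_extΦ h𝓕 _)

include h𝓕 in
theorem smallVF_brDiff (Z X : VF m M) : SmallVF F 𝓕 fun Φ => brDiff (autΦ Φ) Z X := by
  simp only [brDiff_autΦ]
  have hN := smallVF_extΦ (F := F) h𝓕
  have h1 := (hN X).lie_const Z
  have h2 := (hN Z).const_lie X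
  have h3 := (hN Z).lie (hN X)
  exact ((((hN _).sub h1).sub h2).add h3).add (((h3.sub h1).sub h2).extΦ h𝓕)

end Small

/-! ### Expansion of forms in the chosen generators. -/

section Expansion

variable {m : ℕ} {M : Type*} [TopologicalSpace M] [ChartedSpace (EuclideanSpace ℝ (Fin m)) M]
  {d : ℕ} {S : CRStructure m M d} {p r : ℕ}

theorem Form.ev_sum_smul (u : Form S p r (Smooth m M)) {κ₁ κ₂ : Type*} [Fintype κ₁] [Fintype κ₂]
    (c : Fin r → κ₁ → Smooth m M) (Z : κ₁ → S.H) (e : Fin p → κ₂ → Smooth m M) (X : κ₂ → VF m M) :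
    u.ev (fun i => ∑ j, c i j • Z j) (fun i => ∑ j, e i j • X j)
      = ∑ J : Fin r → κ₁, ∑ I : Fin p → κ₂, ((∏ i, c i (J i)) * ∏ i, e i (I i)) *
          u.ev (fun i => Z (J i)) (fun i => X (I i)) := by
  classical
  have h1 : u (fun i => ∑ j, c i j • Z j)
      = ∑ J : Fin r → κ₁, (∏ i, c i (J i)) • u (fun i => Z (J i)) := by
    rw [← AlternatingMap.coe_multilinearMap, MultilinearMap.map_sum]
    exact Finset.sum_congr rfl fun J _ => MultilinearMap.map_smul_univ _ _ _
  have h2 : ∀ w : (VF m M ⧸ S.H) [⋀^Fin p]→ₗ[Smooth m M] Smooth m M,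
      w (fun i => S.H.mkQ (∑ j, e i j • X j))
      = ∑ I : Fin p → κ₂, (∏ i, e i (I i)) • w (fun i => S.H.mkQ (X (I i))) := by
    intro w
    simp only [map_sum, map_smul]
    rw [← AlternatingMap.coe_multilinearMap, MultilinearMap.map_sum]
    exact Finset.sum_congr rfl fun J _ => MultilinearMap.map_smul_univ _ _ _
  rw [Form.ev, h1, alternatingMap_sum_apply]
  refine Finset.sum_congr rfl fun J _ => ?_
  rw [AlternatingMap.smul_apply, h2, Finset.smul_sum]
  refine Finset.sum_congr rfl fun I _ => ?_
  rw [smul_smul]; rfl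

theorem Form.ev_update_left_sum_smul (u : Form S p r (Smooth m M)) (Z : Fin r → S.H)
    (X : Fin p → VF m M) (j : Fin r) {κ : Type*} [Fintype κ] (c : κ → Smooth m M) (W : κ → S.H) :
    u.ev (Function.update Z j (∑ k, c k • W k)) X
      = ∑ k, c k * u.ev (Function.update Z j (W k)) X := by
  rw [Form.ev, u.map_update_sum, alternatingMap_sum_apply]
  refine Finset.sum_congr rfl fun k _ => ?_
  rw [u.map_update_smul]; rfl

theorem Form.ev_update_right_sum_smul (u : Form S p r (Smooth m M)) (Z : Fin r → S.H)
    (X : Fin p → VF m M) (j : Fin p) {κ : Type*} [Fintype κ] (c : κ → Smooth m M)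
    (W : κ → VF m M) : u.ev Z (Function.update X j (∑ k, c k • W k))
      = ∑ k, c k * u.ev Z (Function.update X j (W k)) := by
  simp only [Form.ev, mkQ_update, map_sum, map_smul]
  rw [(u Z).map_update_sum]
  refine Finset.sum_congr rfl fun k _ => ?_
  rw [(u Z).map_update_smul]; rfl

/-- The coefficients do not depend on `u`, so the values on generators control all other values of a
form with uniform constants. -/
theorem Form.exists_expansion (F : Frames S) (Z : Fin r → S.H) (X : Fin p → VF m M) :
    ∃ c : (Fin r → Fin F.N₂) → (Fin p → Fin F.N₁) → Smooth m M,
      ∀ u : Form S p r (Smooth m M), u.ev Z X = ∑ J : Fin r → Fin F.N₂, ∑ I : Fin p → Fin F.N₁,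
        c J I * u.ev (fun i => F.Z (J i)) (fun i => F.X (I i)) := by
  choose z hz using fun i =>
    (Submodule.mem_span_range_iff_exists_fun (Smooth m M) (v := F.Z) (x := Z i)).1
      (F.span_eq ▸ Submodule.mem_top)
  refine ⟨fun J I => (∏ i, z i (J i)) * ∏ i, F.ξ (I i) (X i), fun u => ?_⟩
  rw [← u.ev_sum_smul z F.Z (fun i j => F.ξ j (X i)) F.X]
  simp only [hz, F.sum_eq]

end Expansion

/-! ### The `B^l` norms of smooth functions and forms. -/

namespace AnisotropicSpaces

variable {m : ℕ} {M : Type*} [TopologicalSpace M] [ChartedSpace (EuclideanSpace ℝ (Fin m)) M]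
  [MeasurableSpace M] [BorelSpace M] {μ : Measure M} {d : ℕ} {S : CRStructure m M d}
  (B : AnisotropicSpaces S μ)

/-- The norm of a smooth function in `B^l`. -/
def sn (l : ℕ) (a : Smooth m M) : ℝ := (B.B l).nrm (toAE μ a)

variable {B} (hB : B.InterEqSmooth)

include hB

theorem InterEqSmooth.mem (l : ℕ) (a : Smooth m M) : toAE μ a ∈ (B.B l).carrier :=
  (hB _).2 ⟨a, rfl⟩ l

theorem sn_nonneg (l : ℕ) (a : Smooth m M) : 0 ≤ B.sn l a := (B.B l).nrm_nonneg (hB.mem l a)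

theorem sn_add_le (l : ℕ) (a b : Smooth m M) : B.sn l (a + b) ≤ B.sn l a + B.sn l b := by
  rw [sn, toAE_add]
  exact (B.B l).nrm_add_le _ (hB.mem l a) _ (hB.mem l b)

theorem sn_neg (l : ℕ) (a : Smooth m M) : B.sn l (-a) = B.sn l a := by
  have : toAE μ (-a) = -toAE μ a := map_neg (toAELin μ) a
  rw [sn, this]
  exact (B.B l).nrm_neg (hB.mem l a)

omit hB in
theorem sn_zero (l : ℕ) : B.sn l 0 = 0 := by rw [sn, toAE_zero, (B.B l).nrm_zero]

theorem sn_sub_le (l : ℕ) (a b : Smooth m M) : B.sn l (a - b) ≤ B.sn l a + B.sn l b := by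
  rw [sub_eq_add_neg, ← sn_neg hB l b]
  exact sn_add_le hB l a _

theorem sn_sum_le {ι : Type*} (l : ℕ) (s : Finset ι) (a : ι → Smooth m M) :
    B.sn l (∑ i ∈ s, a i) ≤ ∑ i ∈ s, B.sn l (a i) := by
  have : toAE μ (∑ i ∈ s, a i) = ∑ i ∈ s, toAE μ (a i) := map_sum (toAELin μ) a s
  rw [sn, this]
  exact (B.B l).nrm_sum_le s _ fun i _ => hB.mem l (a i)

theorem eq_zero_of_sn [μ.IsOpenPosMeasure] {l : ℕ} {a : Smooth m M} (h : B.sn l a = 0) : a = 0 :=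
  toAE_injective (((B.B l).eq_zero_of_nrm (hB.mem l a) h).trans toAE_zero.symm)

/-- The norm of a smooth form in `B^l`. -/
def _root_.CR.AnisotropicSpaces.sNorm (B : AnisotropicSpaces S μ) (F : Frames S) (l : ℕ) {p r : ℕ}
    (u : Form S p r (Smooth m M)) : ℝ :=
  ∑ J : Fin r → Fin F.N₂, ∑ I : Fin p → Fin F.N₁,
    B.sn l (u.ev (fun i => F.Z (J i)) (fun i => F.X (I i)))

variable (F : Frames S) {p r : ℕ}

theorem sNorm_nonneg (l : ℕ) (u : Form S p r (Smooth m M)) : 0 ≤ B.sNorm F l u :=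
  Finset.sum_nonneg fun _ _ => Finset.sum_nonneg fun _ _ => sn_nonneg hB l _

theorem sn_ev_frame_le (l : ℕ) (u : Form S p r (Smooth m M)) (J : Fin r → Fin F.N₂)
    (I : Fin p → Fin F.N₁) :
    B.sn l (u.ev (fun i => F.Z (J i)) (fun i => F.X (I i))) ≤ B.sNorm F l u := by
  refine le_trans ?_ (Finset.single_le_sum (f := fun J : Fin r → Fin F.N₂ =>
    ∑ I : Fin p → Fin F.N₁, B.sn l (u.ev (fun i => F.Z (J i)) (fun i => F.X (I i))))
    (fun _ _ => Finset.sum_nonneg fun _ _ => sn_nonneg hB l _) (Finset.mem_univ J))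
  exact Finset.single_le_sum (f := fun I : Fin p → Fin F.N₁ =>
    B.sn l (u.ev (fun i => F.Z (J i)) (fun i => F.X (I i))))
    (fun _ _ => sn_nonneg hB l _) (Finset.mem_univ I)

theorem sNorm_add_le (l : ℕ) (u v : Form S p r (Smooth m M)) :
    B.sNorm F l (u + v) ≤ B.sNorm F l u + B.sNorm F l v := by
  simp only [sNorm, ← Finset.sum_add_distrib]
  exact Finset.sum_le_sum fun _ _ => Finset.sum_le_sum fun _ _ => sn_add_le hB l _ _

theorem sNorm_neg (l : ℕ) (u : Form S p r (Smooth m M)) : B.sNorm F l (-u) = B.sNorm F l u :=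
  Finset.sum_congr rfl fun _ _ => Finset.sum_congr rfl fun _ _ => sn_neg hB l _

theorem eq_zero_of_sNorm [μ.IsOpenPosMeasure] {l : ℕ} {u : Form S p r (Smooth m M)}
    (h : B.sNorm F l u ≤ 0) : u = 0 := by
  refine Form.ext_ev fun Z X => ?_
  obtain ⟨c, hc⟩ := Form.exists_expansion F Z X
  rw [hc]
  refine Finset.sum_eq_zero fun J _ => Finset.sum_eq_zero fun I _ => ?_
  have : u.ev (fun i => F.Z (J i)) (fun i => F.X (I i)) = 0 :=
    eq_zero_of_sn hB (le_antisymm ((sn_ev_frame_le hB F l u J I).trans h) (sn_nonneg hB l _))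
  rw [this, mul_zero]

variable [IsManifold (𝓡 m) ∞ M] [CompactSpace M] [T2Space M]

theorem exists_sn_mul_le (l : ℕ) : ∃ C : ℝ, 0 ≤ C ∧ ∀ a b : Smooth m M,
    B.sn l (a * b) ≤ C * cNorm F.X (B.θ l) a * B.sn l b := by
  obtain ⟨C, hC, h⟩ := B.exists_mul_bound F l
  refine ⟨C, hC, fun a b => ?_⟩
  have := (h a _ (hB.mem l b)).2
  rwa [smul_toAE] at this

theorem exists_sn_ev_le (l : ℕ) (Z : Fin r → S.H) (X : Fin p → VF m M) :
    ∃ C : ℝ, 0 ≤ C ∧ ∀ u : Form S p r (Smooth m M), B.sn l (u.ev Z X) ≤ C * B.sNorm F l u := by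
  obtain ⟨c, hc⟩ := Form.exists_expansion F Z X
  obtain ⟨C, hC, h⟩ := exists_sn_mul_le hB F l
  refine ⟨∑ J, ∑ I, C * cNorm F.X (B.θ l) (c J I), Finset.sum_nonneg fun _ _ =>
    Finset.sum_nonneg fun _ _ => mul_nonneg hC (cNorm_nonneg _ _ _), fun u => ?_⟩
  rw [hc]
  refine (sn_sum_le hB l _ _).trans ?_
  rw [Finset.sum_mul]
  refine Finset.sum_le_sum fun J _ => (sn_sum_le hB l _ _).trans ?_
  rw [Finset.sum_mul]
  refine Finset.sum_le_sum fun I _ => (h _ _).trans ?_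
  exact mul_le_mul_of_nonneg_left (sn_ev_frame_le hB F l u J I)
    (mul_nonneg hC (cNorm_nonneg _ _ _))

theorem exists_sn_le_succ (l : ℕ) : ∃ C : ℝ, 0 ≤ C ∧ ∀ a : Smooth m M,
    B.sn l a ≤ C * B.sn (l + 1) a := by
  obtain ⟨C, hC, h⟩ := B.exists_incl_bound l
  exact ⟨C, hC, fun a => h _ (hB.mem (l + 1) a)⟩

theorem exists_sNorm_le_succ (l p r : ℕ) : ∃ C : ℝ, 0 ≤ C ∧ ∀ u : Form S p r (Smooth m M),
    B.sNorm F l u ≤ C * B.sNorm F (l + 1) u := by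
  obtain ⟨C, hC, h⟩ := exists_sn_le_succ hB l
  refine ⟨C, hC, fun u => ?_⟩
  simp only [sNorm, Finset.mul_sum]
  exact Finset.sum_le_sum fun _ _ => Finset.sum_le_sum fun _ _ => h _

variable [IsFiniteMeasure μ] [μ.IsOpenPosMeasure]

theorem exists_sn_deriv_le (hμ : HasSmoothDivergence m μ) (l : ℕ) {Y : VF m M}
    (hY : Y ∈ S.H ⊔ conjSub S.H) : ∃ C : ℝ, 0 ≤ C ∧ ∀ a : Smooth m M,
      B.sn l (Y a) ≤ C * B.sn (l + 1) a := by
  obtain ⟨C, hC, h⟩ := B.exists_deriv_bound l hY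
  refine ⟨C, hC, fun a => ?_⟩
  have := (h _ (hB.mem (l + 1) a)).2
  rwa [weakDeriv_toAE hμ] at this

end AnisotropicSpaces

/-! ### Smallness of the perturbation operator from `B^{l+1}` to `B^l`. -/

section Pert

variable {m : ℕ} {M : Type*} [TopologicalSpace M] [ChartedSpace (EuclideanSpace ℝ (Fin m)) M]
  {d : ℕ}

/-- The horizontal perturbations of a CR structure. -/
def Pert (S : CRStructure m M d) : Type _ :=
  {q : (S.H →ₗ[Smooth m M] conjSub S.H) × CRStructure m M d //
    S.H.map (autΦ q.1 : VF m M →ₗ[Smooth m M] VF m M) = q.2.H}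

end Pert

namespace AnisotropicSpaces

variable {m : ℕ} {M : Type*} [TopologicalSpace M] [ChartedSpace (EuclideanSpace ℝ (Fin m)) M]
  [MeasurableSpace M] [BorelSpace M] {μ : Measure M} {d : ℕ} {S : CRStructure m M d}
  {B : AnisotropicSpaces S μ} (hB : B.InterEqSmooth) (F : Frames S) {p r : ℕ}

/-- An expression in a form and a perturbation whose norm is small compared to that of the form. -/
def IsSmallTerm (B : AnisotropicSpaces S μ) (F : Frames S)
    (𝓕 : Filter (S.H →ₗ[Smooth m M] conjSub S.H)) (l : ℕ)
    (t : Pert S → Form S p r (Smooth m M) → Smooth m M) : Prop :=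
  ∃ η : (S.H →ₗ[Smooth m M] conjSub S.H) → ℝ, Tendsto η 𝓕 (𝓝 0) ∧
    ∀ q u, B.sn l (t q u) ≤ η q.1.1 * B.sNorm F (l + 1) u

variable {𝓕 : Filter (S.H →ₗ[Smooth m M] conjSub S.H)} {l : ℕ}
  {t t' : Pert S → Form S p r (Smooth m M) → Smooth m M}

include hB in
theorem IsSmallTerm.sub (h : B.IsSmallTerm F 𝓕 l t) (h' : B.IsSmallTerm F 𝓕 l t') :
    B.IsSmallTerm F 𝓕 l fun q u => t q u - t' q u := by
  obtain ⟨η, hη, h⟩ := h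
  obtain ⟨η', hη', h'⟩ := h'
  refine ⟨fun Φ => η Φ + η' Φ, by simpa using hη.add hη', fun q u => ?_⟩
  have h1 := sn_sub_le hB l (t q u) (t' q u)
  have h2 := h q u
  have h3 := h' q u
  rw [add_mul]
  linarith

include hB in
theorem IsSmallTerm.neg (h : B.IsSmallTerm F 𝓕 l t) : B.IsSmallTerm F 𝓕 l fun q u => - t q u := by
  obtain ⟨η, hη, h⟩ := h
  exact ⟨η, hη, fun q u => (sn_neg hB l _).trans_le (h q u)⟩

theorem IsSmallTerm.zero : B.IsSmallTerm F 𝓕 l (p := p) (r := r) fun _ _ => 0 :=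
  ⟨fun _ => 0, tendsto_const_nhds, fun q u => by rw [sn_zero, zero_mul]⟩

include hB in
theorem IsSmallTerm.sum {ι : Type*} (s : Finset ι)
    {t : ι → Pert S → Form S p r (Smooth m M) → Smooth m M}
    (h : ∀ i ∈ s, B.IsSmallTerm F 𝓕 l (t i)) :
    B.IsSmallTerm F 𝓕 l fun q u => ∑ i ∈ s, t i q u := by
  classical
  induction s using Finset.induction_on with
  | empty => simpa using IsSmallTerm.zero F
  | insert i s hi ih =>
    simp only [Finset.sum_insert hi]
    have := (h i (Finset.mem_insert_self i s)).sub hB F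
      ((ih fun j hj => h j (Finset.mem_insert_of_mem hj)).neg hB F)
    simpa only [sub_neg_eq_add] using this

include hB in
theorem IsSmallTerm.neg_one_pow_smul (h : B.IsSmallTerm F 𝓕 l t) (i : ℕ) :
    B.IsSmallTerm F 𝓕 l fun q u => (-1 : ℤ) ^ i • t q u := by
  rcases neg_one_pow_eq_or ℤ i with hi | hi
  · simpa only [hi, one_smul] using h
  · simpa only [hi, neg_smul, one_smul] using h.neg hB F

include hB in
theorem isSmallTerm_mul [IsManifold (𝓡 m) ∞ M] [CompactSpace M] [T2Space M]
    {a : (S.H →ₗ[Smooth m M] conjSub S.H) → Smooth m M} (ha : Small F.X 𝓕 a)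
    {v : Form S p r (Smooth m M) → Smooth m M}
    (hv : ∃ C : ℝ, 0 ≤ C ∧ ∀ u, B.sn l (v u) ≤ C * B.sNorm F (l + 1) u) :
    B.IsSmallTerm F 𝓕 l fun q u => a q.1.1 * v u := by
  obtain ⟨C, hC, h⟩ := exists_sn_mul_le hB F l
  obtain ⟨C', hC', h'⟩ := hv
  refine ⟨fun Φ => C * cNorm F.X (B.θ l) (a Φ) * C', ?_, fun q u => (h _ _).trans ?_⟩
  · have h0 : Tendsto (fun Φ => cNorm F.X (B.θ l) (a Φ)) 𝓕 (𝓝 0) := ha (B.θ l)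
    simpa using (h0.const_mul C).mul_const C'
  · rw [mul_assoc _ C']
    exact mul_le_mul_of_nonneg_left (h' u) (mul_nonneg hC (cNorm_nonneg _ _ _))

variable [IsManifold (𝓡 m) ∞ M] [CompactSpace M] [T2Space M] [IsFiniteMeasure μ]
  [μ.IsOpenPosMeasure] (hμ : HasSmoothDivergence m μ) (h𝓕 : ∀ k, Tendsto (F.normΦ k) 𝓕 (𝓝 0))

include hB in
theorem exists_sn_ev_le_succ (l : ℕ) (Z : Fin r → S.H) (X : Fin p → VF m M) : ∃ C : ℝ, 0 ≤ C ∧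
    ∀ u : Form S p r (Smooth m M), B.sn l (u.ev Z X) ≤ C * B.sNorm F (l + 1) u := by
  obtain ⟨C, hC, h⟩ := exists_sn_ev_le hB F l Z X
  obtain ⟨C', hC', h'⟩ := exists_sNorm_le_succ hB F l p r
  refine ⟨C * C', mul_nonneg hC hC', fun u => (h u).trans ?_⟩
  rw [mul_assoc]
  exact mul_le_mul_of_nonneg_left (h' u) hC

-- The only place where the form is differentiated. The direction lies in `H_{1,0}M`, so the
-- derivative costs exactly one step in the scale.
include hB hμ h𝓕 in
theorem isSmallTerm_extΦ (Z : VF m M) (W : Fin r → S.H) (X : Fin p → VF m M) :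
    B.IsSmallTerm F 𝓕 l fun q u => (autΦ q.1.1 Z - Z) (u.ev W X) := by
  have key : ∀ (Φ : S.H →ₗ[Smooth m M] conjSub S.H) (b : Smooth m M),
      (autΦ Φ Z - Z) b = - ∑ i, F.ξ i (extΦ Φ Z) * (S.projBar (F.X i) : VF m M) b := by
    intro Φ b
    have h1 : autΦ Φ Z - Z = -extΦ Φ Z := by rw [autΦ_apply]; abel
    -- Projecting the expansion to `H_{1,0}M` replaces the generators by fixed horizontal fields,
    -- whose derivatives the spaces control; all dependence on `Φ` is in the coefficients.
    have h2 : extΦ Φ Z = ∑ i, F.ξ i (extΦ Φ Z) • (S.projBar (F.X i) : VF m M) := by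
      have h3 : ((S.projBar (extΦ Φ Z) : conjSub S.H) : VF m M) = extΦ Φ Z :=
        congrArg Subtype.val (S.projBar_coe (Φ (S.projH Z)))
      conv_lhs => rw [← h3, ← F.sum_eq (extΦ Φ Z), map_sum]
      simp only [map_smul]
      rw [Submodule.coe_sum]
      rfl
    rw [h1, Derivation.neg_apply]
    conv_lhs => rw [h2, VF.sum_apply]
    rfl
  simp only [key]
  refine (IsSmallTerm.sum hB F _ fun i _ => ?_).neg hB F
  refine isSmallTerm_mul hB F (smallVF_extΦ h𝓕 Z i) (v := fun u =>
    (S.projBar (F.X i) : VF m M) (u.ev W X)) ?_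
  obtain ⟨C, hC, h⟩ := exists_sn_deriv_le hB hμ l
    (Submodule.mem_sup_right (S := S.H) (S.projBar (F.X i)).2)
  obtain ⟨C', hC', h'⟩ := exists_sn_ev_le hB F (l + 1) W X
  refine ⟨C * C', mul_nonneg hC hC', fun u => (h _).trans ?_⟩
  rw [mul_assoc]
  exact mul_le_mul_of_nonneg_left (h' u) hC

include hB h𝓕 in
theorem isSmallTerm_brDiff_left (Z V : S.H) (W : Fin r → S.H) (j : Fin r) (X : Fin p → VF m M) :
    B.IsSmallTerm F 𝓕 l fun q u => u.ev (Function.update W j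
      ⟨brDiff (autΦ q.1.1) Z V, brDiff_mem _ q.2 Z V⟩) X := by
  have key : ∀ q : Pert S, (⟨brDiff (autΦ q.1.1) Z V, brDiff_mem _ q.2 Z V⟩ : S.H)
      = ∑ i, F.ξ i (brDiff (autΦ q.1.1) Z V) • S.projH (F.X i) := by
    intro q
    have h1 : S.projH (brDiff (autΦ q.1.1) Z V)
        = (⟨brDiff (autΦ q.1.1) Z V, brDiff_mem _ q.2 Z V⟩ : S.H) :=
      S.projH_coe ⟨brDiff (autΦ q.1.1) Z V, brDiff_mem _ q.2 Z V⟩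
    rw [← h1]
    conv_lhs => rw [← F.sum_eq (brDiff (autΦ q.1.1) Z V), map_sum]
    simp only [map_smul]
  simp only [key, Form.ev_update_left_sum_smul]
  exact IsSmallTerm.sum hB F _ fun i _ => isSmallTerm_mul hB F (smallVF_brDiff h𝓕 Z V i)
    (v := fun u => u.ev (Function.update W j (S.projH (F.X i))) X)
    (exists_sn_ev_le_succ hB F l _ _)

include hB h𝓕 in
theorem isSmallTerm_brDiff_right (Z V : VF m M) (W : Fin r → S.H) (X : Fin p → VF m M)
    (j : Fin p) : B.IsSmallTerm F 𝓕 l fun q u =>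
      u.ev W (Function.update X j (brDiff (autΦ q.1.1) Z V)) := by
  have key : ∀ q : Pert S, brDiff (autΦ q.1.1) Z V
      = ∑ i, F.ξ i (brDiff (autΦ q.1.1) Z V) • F.X i := fun q => (F.sum_eq _).symm
  have : ∀ (q : Pert S) (u : Form S p r (Smooth m M)),
      u.ev W (Function.update X j (brDiff (autΦ q.1.1) Z V))
      = ∑ i, F.ξ i (brDiff (autΦ q.1.1) Z V) * u.ev W (Function.update X j (F.X i)) := by
    intro q u
    conv_lhs => rw [key q, Form.ev_update_right_sum_smul]
  simp only [this]
  exact IsSmallTerm.sum hB F _ fun i _ => isSmallTerm_mul hB F (smallVF_brDiff h𝓕 Z V i)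
    (v := fun u => u.ev W (Function.update X j (F.X i))) (exists_sn_ev_le_succ hB F l _ _)

include hB hμ h𝓕 in
/-- The perturbation of the tangential Cauchy-Riemann operator has small norm from `B^{l+1}` to
`B^l`. -/
theorem exists_pertOp_bound (l p r : ℕ) : ∃ η : (S.H →ₗ[Smooth m M] conjSub S.H) → ℝ,
    Tendsto η 𝓕 (𝓝 0) ∧ ∀ (q : Pert S) (u : Form S p r (Smooth m M)),
      B.sNorm F l (pertOp (autΦ q.1.1) q.2 u) ≤ η q.1.1 * B.sNorm F (l + 1) u := by
  have key : ∀ (J : Fin (r + 1) → Fin F.N₂) (I : Fin p → Fin F.N₁),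
      B.IsSmallTerm F 𝓕 l fun q (u : Form S p r (Smooth m M)) =>
        (pertOp (autΦ q.1.1) q.2 u).ev (fun i => F.Z (J i)) (fun i => F.X (I i)) := by
    intro J I
    simp only [pertOp_ev]
    refine IsSmallTerm.sum hB F _ fun i _ => IsSmallTerm.neg_one_pow_smul hB F
      (IsSmallTerm.sub hB F (IsSmallTerm.sub hB F (isSmallTerm_extΦ hB F hμ h𝓕 _ _ _)
        (IsSmallTerm.sum hB F _ fun j _ => ?_)) (IsSmallTerm.sum hB F _ fun j _ => ?_)) _
    · by_cases hij : i ≤ j.castSucc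
      · simp only [if_pos hij]
        exact isSmallTerm_brDiff_left hB F h𝓕 _ _ _ _ _
      · simp only [if_neg hij]
        exact IsSmallTerm.zero F
    · exact isSmallTerm_brDiff_right hB F h𝓕 _ _ _ _ _
  choose η hη h using key
  refine ⟨fun Φ => ∑ J, ∑ I, η J I Φ, ?_, fun q u => ?_⟩
  · have := tendsto_finsetSum (Finset.univ : Finset (Fin (r + 1) → Fin F.N₂)) fun J _ =>
      tendsto_finsetSum (Finset.univ : Finset (Fin p → Fin F.N₁)) fun I _ => hη J I
    simpa using this
  · simp only [sNorm, Finset.sum_mul]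
    exact Finset.sum_le_sum fun J _ => Finset.sum_le_sum fun I _ => h J I q u

end AnisotropicSpaces

/-! ### Lifts and limits of alternating maps. -/

section AlternatingLift

variable {R Q N N' ι : Type*} [CommSemiring R] [AddCommMonoid Q] [Module R Q] [AddCommMonoid N]
  [Module R N] [AddCommMonoid N'] [Module R N']

theorem exists_alternating_lift (T : N →ₗ[R] N') (hT : Function.Injective T) (f : Q [⋀^ι]→ₗ[R] N')
    (h : ∀ v, f v ∈ LinearMap.range T) : ∃ g : Q [⋀^ι]→ₗ[R] N, ∀ v, T (g v) = f v := by
  refine ⟨(LinearEquiv.ofInjective T hT).symm.toLinearMap.compAlternatingMap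
    (f.codRestrict (LinearMap.range T) h), fun v => ?_⟩
  exact congrArg Subtype.val
    ((LinearEquiv.ofInjective T hT).apply_symm_apply ⟨f v, h v⟩)

/-- A notion of limit of sequences that is compatible with the module structure. -/
structure IsLinearLimit (R : Type*) {N : Type*} [CommSemiring R] [AddCommMonoid N] [Module R N]
    (Lim : (ℕ → N) → N → Prop) : Prop where
  unique : ∀ {u x y}, Lim u x → Lim u y → x = y
  add : ∀ {u v x y}, Lim u x → Lim v y → Lim (fun n => u n + v n) (x + y)
  smul : ∀ {u x} (c : R), Lim u x → Lim (fun n => c • u n) (c • x)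
  zero : Lim (fun _ => 0) 0

/-- Uniqueness of limits carries the defining identities of alternating maps over to the pointwise
limit. -/
theorem IsLinearLimit.exists_alternating {Lim : (ℕ → N) → N → Prop} (hL : IsLinearLimit R Lim)
    (f : ℕ → Q [⋀^ι]→ₗ[R] N) (h : ∀ v, ∃ x, Lim (fun n => f n v) x) :
    ∃ g : Q [⋀^ι]→ₗ[R] N, ∀ v, Lim (fun n => f n v) (g v) := by
  choose g hg using h
  exact ⟨{ toFun := g
           map_update_add' := fun v i x y => by
             refine hL.unique (hg _) ?_
             simpa only [AlternatingMap.map_update_add] using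
               hL.add (hg (Function.update v i x)) (hg (Function.update v i y))
           map_update_smul' := fun v i c x => by
             refine hL.unique (hg _) ?_
             simpa only [AlternatingMap.map_update_smul] using
               hL.smul c (hg (Function.update v i x))
           map_eq_zero_of_eq' := fun v i j hv hij => by
             refine hL.unique (hg _) ?_
             simpa only [AlternatingMap.map_eq_zero_of_eq _ v hv hij] using hL.zero }, hg⟩

theorem IsLinearLimit.alternating {Lim : (ℕ → N) → N → Prop} (hL : IsLinearLimit R Lim) :
    IsLinearLimit R fun (w : ℕ → Q [⋀^ι]→ₗ[R] N) (w' : Q [⋀^ι]→ₗ[R] N) =>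
      ∀ v, Lim (fun n => w n v) (w' v) where
  unique h h' := AlternatingMap.ext fun v => hL.unique (h v) (h' v)
  add h h' v := hL.add (h v) (h' v)
  smul c h v := hL.smul c (h v)
  zero _ := hL.zero

end AlternatingLift

/-! ### Neumann series and perturbation of an exact complex. -/

/-- A sequence of norms for which the group is complete. -/
structure IsCompleteNorms {E : Type*} [AddCommGroup E] (N : ℕ → E → ℝ) : Prop where
  nonneg : ∀ l u, 0 ≤ N l u
  add_le : ∀ l u v, N l (u + v) ≤ N l u + N l v
  neg : ∀ l u, N l (-u) = N l u
  eq_zero : ∀ u, N 0 u ≤ 0 → u = 0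
  complete : ∀ g : ℕ → E, (∀ l, ∀ ε > 0, ∃ K, ∀ i ≥ K, ∀ j ≥ K, N l (g i - g j) < ε) →
    ∃ u, ∀ l, Tendsto (fun n => N l (g n - u)) atTop (𝓝 0)

namespace IsCompleteNorms

variable {E E₀ E₂ : Type*} [AddCommGroup E] [AddCommGroup E₀] [AddCommGroup E₂] {N : ℕ → E → ℝ}

theorem sub_le (hN : IsCompleteNorms N) (l : ℕ) (u v : E) : N l (u - v) ≤ N l u + N l v := by
  rw [sub_eq_add_neg, ← hN.neg l v]
  exact hN.add_le l u _

/-- Neumann series: `1 + T` is onto if `T` has norm at most `1/2` for all the norms. -/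
theorem exists_add_eq (hN : IsCompleteNorms N) (T : E →+ E)
    (hT : ∀ l u, N l (T u) ≤ 1 / 2 * N l u) (f : E) : ∃ g, g + T g = f := by
  let g : ℕ → E := fun n => Nat.rec 0 (fun _ v => f - T v) n
  have g_zero : g 0 = 0 := rfl
  have g_succ : ∀ n, g (n + 1) = f - T (g n) := fun n => rfl
  have g_bound : ∀ l n, N l (g n) ≤ 2 * N l f := by
    intro l n
    have hf := hN.nonneg l f
    induction n with
    | zero =>
      -- That `0` has norm zero is not among the axioms; writing `0 = f - f` gives the bound that is
      -- needed.
      have := hN.sub_le l f f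
      rw [sub_self] at this
      rw [g_zero]; linarith
    | succ n ih =>
      rw [g_succ]
      have h1 := hN.sub_le l f (T (g n))
      have h2 := hT l (g n)
      linarith
  have g_diff : ∀ l n k, N l (g (n + k) - g n) ≤ (1 / 2) ^ n * (2 * N l f) := by
    intro l n k
    induction n with
    | zero => simpa [g_zero] using g_bound l k
    | succ n ih =>
      rw [show n + 1 + k = n + k + 1 by ring, g_succ, g_succ, sub_sub_sub_cancel_left, ← map_sub,
        ← hN.neg, ← map_neg, neg_sub, pow_succ']
      have := hT l (g (n + k) - g n)
      rw [mul_assoc]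
      linarith
  obtain ⟨u, hu⟩ := hN.complete g fun l ε hε => by
    have ht : Tendsto (fun n : ℕ => (1 / 2 : ℝ) ^ n * (2 * N l f) * 2) atTop (𝓝 0) := by
      have := (tendsto_pow_atTop_nhds_zero_of_lt_one (r := (1 / 2 : ℝ)) (by norm_num)
        (by norm_num)).mul_const (2 * N l f) |>.mul_const 2
      simpa using this
    obtain ⟨K, hK⟩ := (ht.eventually_lt_const hε).exists
    refine ⟨K, fun i hi j hj => ?_⟩
    obtain ⟨i, rfl⟩ := Nat.exists_eq_add_of_le hi
    obtain ⟨j, rfl⟩ := Nat.exists_eq_add_of_le hj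
    have h1 := hN.sub_le l (g (K + i) - g K) (g (K + j) - g K)
    rw [sub_sub_sub_cancel_right] at h1
    have h2 := g_diff l K i
    have h3 := g_diff l K j
    linarith
  refine ⟨u, sub_eq_zero.1 (hN.eq_zero _ ?_)⟩
  have hlim : Tendsto (fun n => N 0 (g (n + 1) - u) + 1 / 2 * N 0 (g n - u)) atTop
      (𝓝 (0 + 1 / 2 * 0)) :=
    ((hu 0).comp (tendsto_add_atTop_nat 1)).add ((hu 0).const_mul _)
  refine (ge_of_tendsto' hlim fun n => ?_).trans_eq (by simp)
  -- The defect of the limit is expressed by the errors of the iteration, which tend to zero.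
  have e : u + T u - f = -(g (n + 1) - u) - T (g n - u) := by
    rw [g_succ, map_sub]; abel
  rw [e]
  have h1 := hN.sub_le 0 (-(g (n + 1) - u)) (T (g n - u))
  rw [hN.neg] at h1
  have h2 := hT 0 (g n - u)
  linarith

/-- If the complex `d` has a homotopy formula at `E` and `D` is a complex close to `d`, then `D` is
exact at `E`. -/
theorem exists_primitive {N₂ : ℕ → E₂ → ℝ} (hN : IsCompleteNorms N) (hN₂ : IsCompleteNorms N₂)
    {d₀ D₀ : E₀ →+ E} {d₁ D₁ : E →+ E₂} {A₁ : E →+ E₀} {A₂ : E₂ →+ E}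
    (hd : ∀ u, d₁ (d₀ u) = 0) (hD : ∀ u, D₁ (D₀ u) = 0) (H : ∀ u, u = d₀ (A₁ u) + A₂ (d₁ u))
    (h₁ : ∀ l u, N l (D₀ (A₁ u) - d₀ (A₁ u)) ≤ 1 / 2 * N l u)
    (h₂ : ∀ u, N₂ 0 (D₁ (A₂ u) - d₁ (A₂ u)) ≤ 1 / 2 * N₂ 0 u) (f : E) (hf : D₁ f = 0) :
    ∃ u, D₀ u = f := by
  obtain ⟨g, hg⟩ := hN.exists_add_eq ((D₀ - d₀).comp A₁) h₁ f
  replace hg : g + (D₀ (A₁ g) - d₀ (A₁ g)) = f := hg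
  have e1 : D₀ (A₁ g) = f - A₂ (d₁ g) := by
    rw [← hg]; nth_rw 2 [H g]; abel
  have e2 : D₁ (A₂ (d₁ g)) = 0 := by
    have : A₂ (d₁ g) = f - D₀ (A₁ g) := by rw [e1]; abel
    rw [this, map_sub, hD, hf, sub_zero]
  -- With `e2`, this shows that `d₁ g` is the negative of the perturbation applied to `A₂ (d₁ g)`,
  -- so its norm is at most half of itself.
  have e3 : d₁ g = d₁ (A₂ (d₁ g)) := by
    conv_lhs => rw [H g, map_add, hd, zero_add]
  have e5 : d₁ g = 0 := by
    refine hN₂.eq_zero _ ?_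
    have h5 := h₂ (d₁ g)
    rw [e2, ← e3, zero_sub, hN₂.neg] at h5
    linarith
  exact ⟨A₁ g, by rw [e1, e5, map_zero, sub_zero]⟩

end IsCompleteNorms

/-! ### Smooth forms inside the forms with measurable coefficients. -/

section SmoothForms

variable {m : ℕ} {M : Type*} [TopologicalSpace M] [ChartedSpace (EuclideanSpace ℝ (Fin m)) M]
  [MeasurableSpace M] [BorelSpace M] {μ : Measure M} {d : ℕ} {S : CRStructure m M d} {p r : ℕ}

/-- Composition of alternating maps with `toAELin`. -/
def toAEAlt (μ : Measure M) (Q : Type*) [AddCommGroup Q] [Module (Smooth m M) Q] (p : ℕ) :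
    (Q [⋀^Fin p]→ₗ[Smooth m M] Smooth m M) →ₗ[Smooth m M]
      (Q [⋀^Fin p]→ₗ[Smooth m M] (M →ₘ[μ] ℂ)) where
  toFun w := (toAELin μ).compAlternatingMap w
  map_add' _ _ := AlternatingMap.ext fun _ => toAE_add _ _
  map_smul' _ _ := AlternatingMap.ext fun _ => (smul_toAE _ _).symm

/-- A smooth form as a form with coefficients in the almost everywhere classes. -/
def Form.toAE (μ : Measure M) (u : Form S p r (Smooth m M)) : Form S p r (M →ₘ[μ] ℂ) :=
  (toAEAlt μ _ p).compAlternatingMap u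

theorem Form.toAE_ev (u : Form S p r (Smooth m M)) (Z : Fin r → S.H) (X : Fin p → VF m M) :
    (u.toAE μ).ev Z X = CR.toAE μ (u.ev Z X) := rfl

theorem Form.toAE_add (u v : Form S p r (Smooth m M)) :
    (u + v).toAE μ = u.toAE μ + v.toAE μ :=
  Form.ext_ev fun _ _ => CR.toAE_add _ _

theorem Form.toAE_injective [μ.IsOpenPosMeasure] {u v : Form S p r (Smooth m M)}
    (h : u.toAE μ = v.toAE μ) : u = v :=
  Form.ext_ev fun Z X => CR.toAE_injective (μ := μ) (by
    rw [← Form.toAE_ev, ← Form.toAE_ev, h])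

/-- `∂̄_b` on smooth forms as a homomorphism. -/
def CRStructure.dHom (S : CRStructure m M d) (p r : ℕ) :
    Form S p r (Smooth m M) →+ Form S p (r + 1) (Smooth m M) :=
  AddMonoidHom.mk' S.dForm S.dForm_add

/-- `pulledD` as a homomorphism. -/
def pulledDHom {S' : CRStructure m M d} (ψ : VF m M ≃ₗ[Smooth m M] VF m M)
    (hψ : S.H.map (ψ : VF m M →ₗ[Smooth m M] VF m M) = S'.H) (p r : ℕ) :
    Form S p r (Smooth m M) →+ Form S p (r + 1) (Smooth m M) :=
  AddMonoidHom.mk' (pulledD ψ hψ) (pulledD_add ψ hψ)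

variable [CompactSpace M] [IsManifold (𝓡 m) ∞ M] [T2Space M]

theorem dbar_toAE [IsFiniteMeasure μ] [μ.IsOpenPosMeasure] (hμ : HasSmoothDivergence m μ)
    (u : Form S p r (Smooth m M)) (Z : Fin (r + 1) → S.H) (X : Fin p → VF m M) :
    dbar weakDeriv (u.toAE μ) Z X = toAE μ ((S.dForm u).ev Z X) := by
  rw [S.dForm_ev]
  change _ = toAELin μ _
  simp only [dbar, map_sum, map_zsmul, map_sub, Form.toAE_ev, weakDeriv_toAE hμ]
  refine Finset.sum_congr rfl fun i _ => ?_
  congr 3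
  refine Finset.sum_congr rfl fun j _ => ?_
  split_ifs
  · rfl
  · exact toAE_zero.symm

end SmoothForms

/-! ### Homotopy operators and completeness on smooth forms. -/

namespace AnisotropicSpaces

variable {m : ℕ} {M : Type*} [TopologicalSpace M] [ChartedSpace (EuclideanSpace ℝ (Fin m)) M]
  [MeasurableSpace M] [BorelSpace M] {μ : Measure M} {d : ℕ} {S : CRStructure m M d}
  {B : AnisotropicSpaces S μ} (hB : B.InterEqSmooth) (F : Frames S) {p r s : ℕ}

include hB

theorem toAE_mem_forms (l : ℕ) (u : Form S p r (Smooth m M)) : u.toAE μ ∈ B.forms l p r :=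
  fun Z X => hB.mem l (u.ev Z X)

/-- Smooth forms in `B^0_{p,r}`. -/
def smoothIncl (u : Form S p r (Smooth m M)) : B.forms 0 p r :=
  ⟨u.toAE μ, toAE_mem_forms hB 0 u⟩

theorem smoothIncl_coe (u : Form S p r (Smooth m M)) : (smoothIncl hB u).1 = u.toAE μ := rfl

theorem smoothIncl_add (u v : Form S p r (Smooth m M)) :
    smoothIncl hB (u + v) = smoothIncl hB u + smoothIncl hB v :=
  Subtype.ext (Form.toAE_add u v)

omit hB in
theorem formNorm_toAE (l : ℕ) (u : Form S p r (Smooth m M)) :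
    B.formNorm F l (u.toAE μ) = B.sNorm F l u := rfl

/-- Each value lies in all `B^l`, hence is smooth. Injectivity of `toAELin` makes the lift
alternating, first in the `T_ℂM / H_{0,1}M` slots and then in the `H_{0,1}M` slots. -/
theorem exists_smooth_form [μ.IsOpenPosMeasure] (v : Form S p r (M →ₘ[μ] ℂ))
    (hv : ∀ l, v ∈ B.forms l p r) : ∃ u : Form S p r (Smooth m M), u.toAE μ = v := by
  have hi : Function.Injective (toAELin μ : Smooth m M →ₗ[Smooth m M] (M →ₘ[μ] ℂ)) :=
    fun a b h => toAE_injective h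
  have hi' : Function.Injective (toAEAlt (m := m) μ (VF m M ⧸ S.H) p) := fun w w' h =>
    AlternatingMap.ext fun X => hi (DFunLike.congr_fun h X)
  have hr : ∀ Z, v Z ∈ LinearMap.range (toAEAlt (m := m) μ (VF m M ⧸ S.H) p) := fun Z => by
    obtain ⟨w, hw⟩ := exists_alternating_lift (toAELin μ) hi (v Z) fun X => by
      choose Y hY using fun j => S.H.mkQ_surjective (X j)
      obtain ⟨a, ha⟩ := (hB (v.ev Z Y)).1 fun l => hv l Z Y
      refine ⟨a, ha.symm.trans ?_⟩
      rw [Form.ev]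
      simp only [hY]
    exact ⟨w, AlternatingMap.ext fun X => hw X⟩
  obtain ⟨u, hu⟩ := exists_alternating_lift (toAEAlt (m := m) μ (VF m M ⧸ S.H) p) hi' v hr
  exact ⟨u, AlternatingMap.ext hu⟩

/-- A smooth form lies in `B^l` for every `l`, so its image lies in every `B^{l+1}` and is smooth.
-/
theorem exists_smooth_operator [μ.IsOpenPosMeasure] (A : B.forms 0 p r →ₗ[ℂ] B.forms 0 p s)
    (hA : B.GainsOne F A) : ∃ A' : Form S p r (Smooth m M) →+ Form S p s (Smooth m M),
      (∀ u, (A' u).toAE μ = (A (smoothIncl hB u)).1) ∧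
      ∀ l, ∃ C : ℝ, 0 ≤ C ∧ ∀ u, B.sNorm F (l + 1) (A' u) ≤ C * B.sNorm F l u := by
  choose A' hA' using fun u : Form S p r (Smooth m M) =>
    exists_smooth_form hB (A (smoothIncl hB u)).1 fun l => by
      cases l with
      | zero => exact (A _).2
      | succ l => exact (hA l).1 _ (toAE_mem_forms hB l u)
  have hadd : ∀ u v, A' (u + v) = A' u + A' v := fun u v => by
    have h1 : (A (smoothIncl hB (u + v))).1
        = (A (smoothIncl hB u)).1 + (A (smoothIncl hB v)).1 :=
      congrArg Subtype.val ((congrArg A (smoothIncl_add hB u v)).trans (A.map_add _ _))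
    have h2 := congrArg₂ (· + ·) (hA' u) (hA' v)
    exact Form.toAE_injective (μ := μ) ((hA' _).trans (h1.trans
      (h2.symm.trans (Form.toAE_add _ _).symm)))
  refine ⟨AddMonoidHom.mk' A' hadd, hA', fun l => ?_⟩
  obtain ⟨C, hC⟩ := (hA l).2
  refine ⟨max C 0, le_max_right _ _, fun u => ?_⟩
  have h1 := hC (smoothIncl hB u) (toAE_mem_forms hB l u)
  rw [← hA', smoothIncl_coe, formNorm_toAE, formNorm_toAE] at h1
  exact h1.trans (mul_le_mul_of_nonneg_right (le_max_left _ _) (sNorm_nonneg hB F l u))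

/-- On smooth forms, adapted spaces provide a homotopy formula. -/
theorem exists_smooth_homotopy [CompactSpace M] [IsManifold (𝓡 m) ∞ M] [T2Space M]
    [IsFiniteMeasure μ] [μ.IsOpenPosMeasure] (hμ : HasSmoothDivergence m μ)
    (hv : CohomologyVanishes S p (r + 1)) (ha : B.IsAdapted F (r + 1)) :
    ∃ (A₁ : Form S p (r + 1) (Smooth m M) →+ Form S p r (Smooth m M))
      (A₂ : Form S p (r + 2) (Smooth m M) →+ Form S p (r + 1) (Smooth m M)),
      (∀ l, ∃ C : ℝ, 0 ≤ C ∧ ∀ u, B.sNorm F (l + 1) (A₁ u) ≤ C * B.sNorm F l u) ∧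
      (∀ l, ∃ C : ℝ, 0 ≤ C ∧ ∀ u, B.sNorm F (l + 1) (A₂ u) ≤ C * B.sNorm F l u) ∧
      ∀ u, u = S.dForm (A₁ u) + A₂ (S.dForm u) := by
  obtain ⟨A₁, A₂, h₁, h₂, H⟩ := ha p hv
  obtain ⟨A₁', e₁, b₁⟩ := exists_smooth_operator hB F A₁ h₁
  obtain ⟨A₂', e₂, b₂⟩ := exists_smooth_operator hB F A₂ h₂
  refine ⟨A₁', A₂', b₁, b₂, fun u => Form.ext_ev fun Z X => toAE_injective (μ := μ) ?_⟩
  have h := H (smoothIncl hB u) (smoothIncl hB (S.dForm u))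
    (toAE_mem_forms hB 1 u) (fun Z X => (dbar_toAE hμ u Z X).symm) Z X
  rw [← e₁, ← e₂, dbar_toAE hμ] at h
  exact h.trans (toAE_add _ _).symm

/-- Convergence in all the spaces `B^l`. -/
def _root_.CR.AnisotropicSpaces.SnLim (B : AnisotropicSpaces S μ) (a : ℕ → Smooth m M)
    (b : Smooth m M) : Prop := ∀ l, Tendsto (fun n => B.sn l (a n - b)) atTop (𝓝 0)

variable [CompactSpace M] [IsManifold (𝓡 m) ∞ M] [T2Space M] [μ.IsOpenPosMeasure]

include F in
theorem isLinearLimit_snLim : IsLinearLimit (Smooth m M) B.SnLim where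
  unique {u x y} h h' := by
    refine sub_eq_zero.1 (eq_zero_of_sn hB (l := 0) (le_antisymm ?_ (sn_nonneg hB 0 _)))
    refine (ge_of_tendsto' ((h' 0).add (h 0)) fun n => ?_).trans_eq (add_zero 0)
    have := sn_sub_le hB 0 (u n - y) (u n - x)
    rwa [sub_sub_sub_cancel_left] at this
  add {u v x y} h h' l := by
    refine squeeze_zero (fun n => sn_nonneg hB l _) (fun n => ?_)
      (by simpa using (h l).add (h' l))
    rw [add_sub_add_comm]
    exact sn_add_le hB l _ _
  smul {u x} c h l := by
    obtain ⟨C, hC, hb⟩ := B.exists_mul_bound F l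
    refine squeeze_zero (fun n => sn_nonneg hB l _) (fun n => ?_)
      (by simpa using (h l).const_mul (C * cNorm F.X (B.θ l) c))
    have := (hb c _ (hB.mem l (u n - x))).2
    rw [smul_toAE] at this
    rw [← smul_sub, smul_eq_mul]
    exact this
  zero l := by simp only [sub_zero, sn_zero, tendsto_const_nhds]

-- A limit exists in each `B^l` by completeness. The continuous inclusions force these limits to
-- agree, so the common limit lies in the intersection and is smooth.
omit [μ.IsOpenPosMeasure] in
theorem exists_snLim (a : ℕ → Smooth m M)
    (h : ∀ l, ∀ ε > 0, ∃ N, ∀ i ≥ N, ∀ j ≥ N, B.sn l (a i - a j) < ε) : ∃ b, B.SnLim a b := by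
  have hc : ∀ l, ∃ f ∈ (B.B l).carrier,
      Tendsto (fun n => (B.B l).nrm (toAE μ (a n) - f)) atTop (𝓝 0) := fun l => by
    obtain ⟨f, hf, H⟩ := (B.B l).complete (fun n => toAE μ (a n)) (fun n => hB.mem l (a n))
      fun ε hε => by
        obtain ⟨N, hN⟩ := h l ε hε
        refine ⟨N, fun i hi j hj => ?_⟩
        have := hN i hi j hj
        rwa [sn, toAE_sub] at this
    refine ⟨f, hf, Metric.tendsto_atTop.2 fun ε hε => ?_⟩
    obtain ⟨N, hN⟩ := H ε hε
    refine ⟨N, fun n hn => ?_⟩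
    rw [Real.dist_eq, sub_zero, abs_of_nonneg
      ((B.B l).nrm_nonneg ((B.B l).carrier.sub_mem (hB.mem l _) hf))]
    exact hN n hn
  choose f hf hlim using hc
  have huniq : ∀ l, f (l + 1) = f l := by
    intro l
    obtain ⟨C, -, hb⟩ := B.exists_incl_bound l
    have hmem := B.antitone_B l (hf (l + 1))
    have h1 : Tendsto (fun n => (B.B l).nrm (toAE μ (a n) - f (l + 1))) atTop (𝓝 0) := by
      refine squeeze_zero (fun n => (B.B l).nrm_nonneg
        ((B.B l).carrier.sub_mem (hB.mem l _) hmem)) (fun n => hb _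
          ((B.B (l + 1)).carrier.sub_mem (hB.mem (l + 1) _) (hf (l + 1)))) ?_
      simpa using (hlim (l + 1)).const_mul C
    refine sub_eq_zero.1 ((B.B l).eq_zero_of_nrm ((B.B l).carrier.sub_mem hmem (hf l))
      (le_antisymm ?_ ((B.B l).nrm_nonneg ((B.B l).carrier.sub_mem hmem (hf l)))))
    refine (ge_of_tendsto' ((hlim l).add h1) fun n => ?_).trans_eq (add_zero 0)
    have m1 := (B.B l).carrier.sub_mem (hB.mem l (a n)) (hf l)
    have m2 := (B.B l).carrier.sub_mem (hB.mem l (a n)) hmem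
    have := (B.B l).nrm_add_le _ m1 _ ((B.B l).carrier.neg_mem m2)
    rw [(B.B l).nrm_neg m2] at this
    have e : toAE μ (a n) - f l + -(toAE μ (a n) - f (l + 1)) = f (l + 1) - f l := by abel
    rwa [e] at this
  have hconst : ∀ l, f l = f 0 := fun l => by
    induction l with
    | zero => rfl
    | succ l ih => rw [huniq, ih]
  obtain ⟨b, hb⟩ := (hB (f 0)).1 fun l => hconst l ▸ hf l
  refine ⟨b, fun l => ?_⟩
  have := hlim l
  rw [hconst l, hb] at this
  simpa only [sn, toAE_sub] using this

/-- Control on the generators gives control of every value, so all values converge; the limit form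
is assembled in its two groups of slots. -/
theorem exists_form_limit (g : ℕ → Form S p r (Smooth m M))
    (h : ∀ l, ∀ ε > 0, ∃ N, ∀ i ≥ N, ∀ j ≥ N, B.sNorm F l (g i - g j) < ε) :
    ∃ u : Form S p r (Smooth m M), ∀ l, Tendsto (fun n => B.sNorm F l (g n - u)) atTop (𝓝 0) := by
  have hL := isLinearLimit_snLim hB F
  have hval : ∀ Z (X : Fin p → VF m M ⧸ S.H), ∃ b, B.SnLim (fun n => g n Z X) b := by
    intro Z X
    choose Y hY using fun j => S.H.mkQ_surjective (X j)
    obtain rfl : (fun j => S.H.mkQ (Y j)) = X := funext hY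
    refine exists_snLim hB _ fun l ε hε => ?_
    obtain ⟨C, hC, hb⟩ := exists_sn_ev_le hB F l Z Y
    -- Division by `C + 1` because `C` may be zero.
    obtain ⟨N, hN⟩ := h l (ε / (C + 1)) (by positivity)
    refine ⟨N, fun i hi j hj => (hb (g i - g j)).trans_lt ?_⟩
    have h1 := hN i hi j hj
    rw [lt_div_iff₀ (by positivity)] at h1
    have h2 := sNorm_nonneg hB F l (g i - g j)
    nlinarith
  obtain ⟨u, hu⟩ := (hL.alternating (ι := Fin p) (Q := VF m M ⧸ S.H)).exists_alternating g
    fun Z => hL.exists_alternating (fun n => g n Z) (hval Z)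
  refine ⟨u, fun l => ?_⟩
  have := tendsto_finsetSum (Finset.univ : Finset (Fin r → Fin F.N₂)) fun J _ =>
    tendsto_finsetSum (Finset.univ : Finset (Fin p → Fin F.N₁)) fun I _ =>
      hu (fun i => F.Z (J i)) (fun i => S.H.mkQ (F.X (I i))) l
  simp only [Finset.sum_const_zero] at this
  exact this

theorem isCompleteNorms : IsCompleteNorms fun l (u : Form S p r (Smooth m M)) => B.sNorm F l u where
  nonneg := sNorm_nonneg hB F
  add_le := sNorm_add_le hB F
  neg := sNorm_neg hB F
  eq_zero u h := eq_zero_of_sNorm hB F h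
  complete := exists_form_limit hB F

/-- Vanishing of the cohomology of the perturbed structure from a homotopy formula. -/
theorem exists_primitive {A₁ : Form S p (r + 1) (Smooth m M) →+ Form S p r (Smooth m M)}
    {A₂ : Form S p (r + 2) (Smooth m M) →+ Form S p (r + 1) (Smooth m M)}
    (H : ∀ u, u = S.dForm (A₁ u) + A₂ (S.dForm u)) {S' : CRStructure m M d}
    (ψ : VF m M ≃ₗ[Smooth m M] VF m M)
    (hψ : S.H.map (ψ : VF m M →ₗ[Smooth m M] VF m M) = S'.H)
    (h₁ : ∀ l u, B.sNorm F l (pertOp ψ hψ (A₁ u)) ≤ 1 / 2 * B.sNorm F l u)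
    (h₂ : ∀ u, B.sNorm F 0 (pertOp ψ hψ (A₂ u)) ≤ 1 / 2 * B.sNorm F 0 u)
    (f : Form S p (r + 1) (Smooth m M)) (hf : pulledD ψ hψ f = 0) :
    ∃ u, pulledD ψ hψ u = f := by
  have h := IsCompleteNorms.exists_primitive (isCompleteNorms hB F (p := p) (r := r + 1))
    (isCompleteNorms hB F (p := p) (r := r + 2)) (d₀ := S.dHom p r) (D₀ := pulledDHom ψ hψ p r)
    (d₁ := S.dHom p (r + 1)) (D₁ := pulledDHom ψ hψ p (r + 1)) (A₁ := A₁) (A₂ := A₂)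
    S.dForm_dForm (pulledD_pulledD ψ hψ) H
  exact h h₁ h₂ f hf

end AnisotropicSpaces

/-! ### Choice of the constants `δ_l`. -/

section NormFilter

variable {X : Type*} {N : ℕ → X → ℝ}

/-- The filter of the sets that contain all `x` with `N l x` small for some `l`. -/
def normFilter (N : ℕ → X → ℝ) : Filter X := ⨅ l, comap (N l) (𝓝 0)

theorem tendsto_normFilter (N : ℕ → X → ℝ) (l : ℕ) : Tendsto (N l) (normFilter N) (𝓝 0) :=
  tendsto_iff_comap.2 (iInf_le _ l)

/-- Monotonicity of the norms makes the infimum of filters directed, so a bound on a single norm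
suffices. -/
theorem exists_of_mem_normFilter (h0 : ∀ l x, 0 ≤ N l x) (hN : Monotone N) {U : Set X}
    (hU : U ∈ normFilter N) : ∃ l, ∃ ε > 0, ∀ x, N l x < ε → x ∈ U := by
  have hle : ∀ {i k}, i ≤ k → comap (N k) (𝓝 0) ≤ comap (N i) (𝓝 0) := fun {i k} hik =>
    tendsto_iff_comap.1 (squeeze_zero (h0 i) (hN hik) tendsto_comap)
  rw [normFilter, mem_iInf_of_directed fun i j =>
    ⟨max i j, hle (le_max_left i j), hle (le_max_right i j)⟩] at hU
  obtain ⟨l, V, hV, hVU⟩ := hU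
  obtain ⟨ε, hε, hb⟩ := Metric.mem_nhds_iff.1 hV
  refine ⟨l, ε, hε, fun x hx => hVU (hb ?_)⟩
  rwa [Metric.mem_ball, Real.dist_eq, sub_zero, abs_of_nonneg (h0 l x)]

/-- A diagonal choice: if condition `j` needs `N (L j) x < ε j`, take `δ l = min(ε 0, …, ε l)` and
use the norm of index `max (L j) j`, which dominates `N (L j)` and has `δ ≤ ε j`. -/
theorem exists_delta (h0 : ∀ l x, 0 ≤ N l x) (hN : Monotone N) {good : ℕ → X → Prop}
    (h : ∀ j, ∀ᶠ x in normFilter N, good j x) :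
    ∃ δ : ℕ → ℝ, (∀ l, 0 < δ l) ∧ ∀ x, (∀ l, N l x < δ l) → ∀ j, good j x := by
  choose L ε hε H using fun j => exists_of_mem_normFilter h0 hN (h j)
  refine ⟨fun l => (Finset.range (l + 1)).inf' Finset.nonempty_range_add_one ε,
    fun l => (Finset.lt_inf'_iff _).2 fun j _ => hε j, fun x hx j => H j x ?_⟩
  refine (hN (le_max_left (L j) j) x).trans_lt ((Finset.lt_inf'_iff _).1 (hx _) j ?_)
  exact Finset.mem_range.2 (Nat.lt_succ_of_le (le_max_right _ _))

end NormFilter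

theorem Frames.normΦ_nonneg {m : ℕ} {M : Type*} [TopologicalSpace M]
    [ChartedSpace (EuclideanSpace ℝ (Fin m)) M] {d : ℕ} {S : CRStructure m M d} (F : Frames S)
    (k : ℕ) (Φ : S.H →ₗ[Smooth m M] conjSub S.H) : 0 ≤ F.normΦ k Φ :=
  Finset.sum_nonneg fun _ _ => Finset.sum_nonneg fun _ _ => cNorm_nonneg _ _ _

theorem Frames.normΦ_mono {m : ℕ} {M : Type*} [TopologicalSpace M]
    [ChartedSpace (EuclideanSpace ℝ (Fin m)) M] {d : ℕ} {S : CRStructure m M d} (F : Frames S) :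
    Monotone F.normΦ := fun _ _ h _ =>
  Finset.sum_le_sum fun _ _ => Finset.sum_le_sum fun _ _ => cNorm_mono _ _ h

theorem cohomologyVanishes_of_isEmpty {m : ℕ} {M : Type*} [TopologicalSpace M]
    [ChartedSpace (EuclideanSpace ℝ (Fin m)) M] [IsEmpty M] {d : ℕ} (S : CRStructure m M d)
    (p r : ℕ) : CohomologyVanishes S p (r + 1) := fun _ _ =>
  ⟨0, fun _ _ => ContMDiffMap.ext fun x => isEmptyElim x⟩

theorem cohomologyVanishes_of_pulledD {m : ℕ} {M : Type*} [TopologicalSpace M]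
    [ChartedSpace (EuclideanSpace ℝ (Fin m)) M] {d : ℕ} {S S' : CRStructure m M d}
    (ψ : VF m M ≃ₗ[Smooth m M] VF m M)
    (h : S.H.map (ψ : VF m M →ₗ[Smooth m M] VF m M) = S'.H) {p r : ℕ}
    (H : ∀ f : Form S p (r + 1) (Smooth m M), pulledD ψ h f = 0 → ∃ u, pulledD ψ h u = f) :
    CohomologyVanishes S' p (r + 1) := by
  refine (cohomologyVanishes_succ_iff _ _ _).2 fun f hf => ?_
  have h0 : pulledD ψ h ((Form.transport ψ h p (r + 1)).symm f) = 0 := by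
    simp only [pulledD, LinearEquiv.apply_symm_apply, hf, map_zero]
  obtain ⟨u, hu⟩ := H _ h0
  exact ⟨_, (Form.transport ψ h p (r + 1)).symm.injective hu⟩

/-! ### Stability of vanishing cohomology under small perturbations. -/

namespace AnisotropicSpaces

variable {m : ℕ} {M : Type*} [TopologicalSpace M] [ChartedSpace (EuclideanSpace ℝ (Fin m)) M]
  [MeasurableSpace M] [BorelSpace M] {μ : Measure M} {d : ℕ} {S : CRStructure m M d}
  {B : AnisotropicSpaces S μ} (hB : B.InterEqSmooth) (F : Frames S)
  [IsManifold (𝓡 m) ∞ M] [CompactSpace M] [T2Space M] [IsFiniteMeasure μ] [μ.IsOpenPosMeasure]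

include hB

/-- Small horizontal perturbations preserve the vanishing of the cohomology in an adapted
degree. -/
theorem exists_condition {𝓕 : Filter (S.H →ₗ[Smooth m M] conjSub S.H)}
    (hμ : HasSmoothDivergence m μ) (h𝓕 : ∀ k, Tendsto (F.normΦ k) 𝓕 (𝓝 0)) (p r : ℕ) :
    ∃ good : ℕ → (S.H →ₗ[Smooth m M] conjSub S.H) → Prop, (∀ l, ∀ᶠ Φ in 𝓕, good l Φ) ∧
      (CohomologyVanishes S p (r + 1) → B.IsAdapted F (r + 1) →
        ∀ q : Pert S, (∀ l, good l q.1.1) → CohomologyVanishes q.1.2 p (r + 1)) := by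
  -- The smallness conditions are fixed before vanishing and adaptedness are assumed, so that `δ`
  -- can be chosen uniformly. When one of the two fails, empty conditions do.
  by_cases h : CohomologyVanishes S p (r + 1) ∧ B.IsAdapted F (r + 1)
  swap
  · exact ⟨fun _ _ => True, fun _ => Eventually.of_forall fun _ => trivial,
      fun hv ha => absurd ⟨hv, ha⟩ h⟩
  obtain ⟨A₁, A₂, hA₁, hA₂, H⟩ := exists_smooth_homotopy hB F hμ h.1 h.2
  choose C₁ hC₁ hb₁ using hA₁
  choose C₂ hC₂ hb₂ using hA₂
  choose η₁ hη₁ hp₁ using fun l => exists_pertOp_bound hB F hμ h𝓕 l p r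
  obtain ⟨η₂, hη₂, hp₂⟩ := exists_pertOp_bound hB F hμ h𝓕 0 p (r + 1)
  have hev : ∀ {η : (S.H →ₗ[Smooth m M] conjSub S.H) → ℝ} (C : ℝ), Tendsto η 𝓕 (𝓝 0) →
      ∀ᶠ Φ in 𝓕, |η Φ| * C ≤ 1 / 2 := fun C hη =>
    (by simpa using hη.abs.mul_const C : Tendsto _ 𝓕 (𝓝 (0 : ℝ))).eventually_le_const
      (by norm_num)
  have hle : ∀ {x y z e C : ℝ}, x ≤ e * y → y ≤ C * z → |e| * C ≤ 1 / 2 → 0 ≤ y → 0 ≤ z →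
      x ≤ 1 / 2 * z := fun {x y z e C} h1 h2 h3 hy hz =>
    calc x ≤ |e| * y := h1.trans (mul_le_mul_of_nonneg_right (le_abs_self e) hy)
      _ ≤ |e| * (C * z) := mul_le_mul_of_nonneg_left h2 (abs_nonneg e)
      _ = |e| * C * z := (mul_assoc _ _ _).symm
      _ ≤ 1 / 2 * z := mul_le_mul_of_nonneg_right h3 hz
  -- The Neumann series must converge in every norm, whereas the vanishing of `dg` is tested in
  -- `B^0` only. The conditions involve `Φ` alone, not the CR structure on its graph.
  refine ⟨fun l Φ => |η₁ l Φ| * C₁ l ≤ 1 / 2 ∧ |η₂ Φ| * C₂ 0 ≤ 1 / 2,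
    fun l => (hev _ (hη₁ l)).and (hev _ hη₂), fun _ _ q hq => ?_⟩
  have hprim := exists_primitive hB F H (autΦ q.1.1) q.2
    (fun l u => hle (hp₁ l q (A₁ u)) (hb₁ l u) (hq l).1 (sNorm_nonneg hB F _ _)
      (sNorm_nonneg hB F _ _))
    (fun u => hle (hp₂ q (A₂ u)) (hb₂ 0 u) (hq 0).2 (sNorm_nonneg hB F _ _)
      (sNorm_nonneg hB F _ _))
  exact cohomologyVanishes_of_pulledD _ _ hprim

/-- Horizontal perturbations that are small in all the norms `C^{θ(l)}` preserve the vanishing of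
the cohomology in all adapted degrees. -/
theorem exists_delta_cohomologyVanishes (hμ : HasSmoothDivergence m μ) (hm : 0 < m) :
    ∃ δ : ℕ → ℝ, (∀ l, 0 < δ l) ∧
      ∀ (Φ : S.H →ₗ[Smooth m M] conjSub S.H) (S' : CRStructure m M d), S'.H = graph S Φ →
        (∀ l, F.normΦ (B.θ l) Φ < δ l) → ∀ p r, CohomologyVanishes S p (r + 1) →
          B.IsAdapted F (r + 1) → CohomologyVanishes S' p (r + 1) := by
  rcases isEmpty_or_nonempty M with hM | hM
  · exact ⟨fun _ => 1, fun _ => one_pos, fun _ S' _ _ p r _ _ =>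
      cohomologyVanishes_of_isEmpty S' p r⟩
  have h𝓕 : ∀ k, Tendsto (F.normΦ k) (normFilter fun l => F.normΦ (B.θ l)) (𝓝 0) := fun k => by
    -- Since `θ` is unbounded, each `C^k` norm is dominated by some `C^{θ(l)}` norm.
    obtain ⟨l, hl⟩ := B.exists_le_theta hB hm k
    exact squeeze_zero (F.normΦ_nonneg k) (F.normΦ_mono hl)
      (tendsto_normFilter (fun l => F.normΦ (B.θ l)) l)
  choose good hgood hvan using exists_condition hB F hμ h𝓕
  -- The conditions are indexed by `(p, r, l)`; an enumeration lets one sequence `δ` serve all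
  -- bidegrees at once.
  obtain ⟨e, he⟩ := exists_surjective_nat (ℕ × ℕ × ℕ)
  obtain ⟨δ, hδ, H⟩ := exists_delta (N := fun l => F.normΦ (B.θ l))
    (fun l => F.normΦ_nonneg _) (F.normΦ_mono.comp B.monotone_θ)
    (good := fun j => good (e j).1 (e j).2.1 (e j).2.2) fun j => hgood _ _ _
  refine ⟨δ, hδ, fun Φ S' hS' hΦ p r hv ha => hvan p r hv ha
    ⟨(Φ, S'), (map_autΦ Φ).trans hS'.symm⟩ fun l => ?_⟩
  obtain ⟨j, hj⟩ := he (p, r, l)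
  have := H Φ hΦ j
  rwa [hj] at this

end AnisotropicSpaces

end CR

end

theorem corollary3p3 (n k : ℕ) {M : Type*} [TopologicalSpace M]
    [ChartedSpace (EuclideanSpace ℝ (Fin (2 * n - k))) M]
    [IsManifold (𝓡 (2 * n - k)) ∞ M] [CompactSpace M] [T2Space M]
    [MeasurableSpace M] [BorelSpace M]
    (μ : Measure M) [IsFiniteMeasure μ] [μ.IsOpenPosMeasure]
    (hμ : CR.HasSmoothDivergence (2 * n - k) μ)
    (S : CR.CRStructure (2 * n - k) M (n - k)) (F : CR.Frames S)
    (B : CR.AnisotropicSpaces S μ) (hB : B.InterEqSmooth)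
    (q : ℕ) (hq : 1 ≤ q) (hqn : 2 * q ≤ n - k) (s₁ s₂ : ℕ → ℕ) :
    ∃ δ : ℕ → ℝ, (∀ l, 0 < δ l) ∧
      ∀ (Φ : S.H →ₗ[CR.Smooth (2 * n - k) M] CR.conjSub S.H)
        (S' : CR.CRStructure (2 * n - k) M (n - k)), S'.H = CR.graph S Φ →
        (∀ l, F.normΦ (B.θ l) Φ < δ l) →
        ((∀ r, 1 ≤ r → r ≤ s₁ q → B.IsAdapted F r) →
          ∀ r, 1 ≤ r → r ≤ s₁ q →
            (∀ p < r, CR.CohomologyVanishes S p (r - p)) →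
            CR.CohomologyVanishes S' 0 r) ∧
        ((∀ r, 1 ≤ r → s₂ q ≤ r → r ≤ n - k → B.IsAdapted F r) →
          ∀ r, 1 ≤ r → s₂ q ≤ r → r ≤ n - k →
            (∀ p ≤ n - k - r, CR.CohomologyVanishes S (n - p) (r + p)) →
            CR.CohomologyVanishes S' n r) := by
  -- The dimension `2n - k` is positive because `n - k ≥ 2q ≥ 2`, also with truncated subtraction.
  obtain ⟨δ, hδ, H⟩ := CR.AnisotropicSpaces.exists_delta_cohomologyVanishes hB F hμ (by omega)
  refine ⟨δ, hδ, fun Φ S' hS' hΦ => ⟨fun ha r hr hrs hv => ?_, fun ha r hr hrs hrn hv => ?_⟩⟩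
  · obtain ⟨r, rfl⟩ := Nat.exists_eq_add_of_le' hr
    -- The index `p = 0` is the one in the bidegree `(0, r)` of the perturbed group.
    exact H Φ S' hS' hΦ 0 r (hv 0 hr) (ha _ hr hrs)
  · obtain ⟨r, rfl⟩ := Nat.exists_eq_add_of_le' hr
    exact H Φ S' hS' hΦ n r (hv 0 (Nat.zero_le _)) (ha _ hr hrs hrn)
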